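/- All graphs are finite and simple. A set $S$ of vertices of a graph $G$ is a connected dominating set if every vertex outside $S$ has a neighbor in $S$ and the induced subgraph $G[S]$ is connected; it is a minimal connected dominating set if, in addition, no proper subset of $S$ is a connected dominating set. There is a constant $\varepsilon > 10^{-50}$ such that the following two statements hold. (i) There is a constant $C$ such that, for every $n$, every graph on $n$ vertices has at most $C\cdot 2^{(1-\varepsilon)n}$ minimal connected dominating sets. (ii) There are an algorithm and a polynomial $p$ such that, for every $n$ and every graph $G$ on the vertex set $\{0,\dots,n-1\}$, given $n$ and the adjacency matrix of $G$, the algorithm lists all minimal connected dominating sets of $G$, each exactly once, and halts after at most $2^{(1-\varepsilon)n}\cdot p(n)$ steps. Here an algorithm is a program for a random access machine with unit-cost instructions whose only arithmetic operations are adding and subtracting one. -/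

import Mathlib

namespace CDS

/-! ### Connected dominating sets -/

section Graphs

variable {V : Type*}

/-- `S` is a dominating set: every vertex outside `S` has a neighbour in `S`. -/
def IsDominating (G : SimpleGraph V) (S : Finset V) : Prop :=
  ∀ v, v ∉ S → ∃ u ∈ S, G.Adj v u

/-- `S` is a connected dominating set: it is dominating and `G[S]` is connected. -/
def IsConnectedDominating (G : SimpleGraph V) (S : Finset V) : Prop :=
  IsDominating G S ∧ (G.induce (S : Set V)).Connected

/-- `S` is a connected dominating set no proper subset of which is a connected dominating set. -/
def IsMinimalConnectedDominating (G : SimpleGraph V) (S : Finset V) : Prop :=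
  IsConnectedDominating G S ∧ ∀ T, T ⊂ S → ¬ IsConnectedDominating G T

/-- The family of all minimal connected dominating sets. -/
def minimalConnectedDominatingSets (G : SimpleGraph V) : Set (Finset V) :=
  {S | IsMinimalConnectedDominating G S}

end Graphs

/-! ### The machine model

A random access machine whose programs are structured (sequencing, conditionals, loops). A program
works with finitely many registers and finitely many one-dimensional arrays of natural numbers
(those that occur in its text), and with a write-only output tape. Every executed elementary
instruction and every evaluated test costs one unit of time. The only arithmetic is adding and
subtracting one (a successor machine), so in `t` steps no number can exceed the largest initial one
(or the largest constant of the program) by more than `t`, and unit cost is not an abuse: compared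
with the logarithmic cost measure, or with a machine that has addition and multiplication on
machine words, running times change only by a factor polynomial in the length of the numbers. -/

/-- Tests: comparison of two registers. -/
inductive Test : Type
  /-- The two registers hold the same number. -/
  | eq (x y : ℕ)
  /-- The first register holds a smaller number than the second. -/
  | lt (x y : ℕ)

/-- Programs. The letters `x`, `y`, `i` stand for (numbers of) registers, `a` for an array. -/
inductive Program : Type
  /-- Do nothing (at no cost). -/
  | skip
  /-- `x := c`, for a constant `c` -/
  | const (x c : ℕ)
  /-- `x := y` -/
  | copy (x y : ℕ)
  /-- `x := x + 1` -/
  | succ (x : ℕ)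
  /-- `x := x - 1`, truncated at zero -/
  | pred (x : ℕ)
  /-- `x := a[i]`, where the register `i` holds the index -/
  | load (x a i : ℕ)
  /-- `a[i] := x`, where the register `i` holds the index -/
  | store (a i x : ℕ)
  /-- Append the contents of the register `x` to the output. -/
  | emit (x : ℕ)
  /-- First `P`, then `Q`. -/
  | seq (P Q : Program)
  /-- If `b` holds then `P`, else `Q`. -/
  | cond (b : Test) (P Q : Program)
  /-- While `b` holds, repeat `P`. -/
  | loop (b : Test) (P : Program)

/-- Memory and output of the machine. -/
structure State where
  /-- contents of the registers -/
  reg : ℕ → ℕ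
  /-- `arr a i` is the entry of the array `a` at index `i` -/
  arr : ℕ → ℕ → ℕ
  /-- what has been written so far, oldest first -/
  out : List ℕ

/-- The state with the number `c` written to the register `x`. -/
def State.setReg (s : State) (x c : ℕ) : State :=
  { s with reg := Function.update s.reg x c }

/-- The state with the number `c` written to the entry `i` of the array `a`. -/
def State.setArr (s : State) (a i c : ℕ) : State :=
  { s with arr := Function.update s.arr a (Function.update (s.arr a) i c) }

/-- Truth of a test in a state. -/
def Test.Holds : Test → State → Prop
  | .eq x y, s => s.reg x = s.reg y
  | .lt x y, s => s.reg x < s.reg y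

/-- `Runs P s s' t`: started in the state `s`, the program `P` halts in the state `s'` after exactly
`t` steps. -/
inductive Runs : Program → State → State → ℕ → Prop
  | skip (s : State) : Runs .skip s s 0
  | const (s : State) (x c : ℕ) : Runs (.const x c) s (s.setReg x c) 1
  | copy (s : State) (x y : ℕ) : Runs (.copy x y) s (s.setReg x (s.reg y)) 1
  | succ (s : State) (x : ℕ) : Runs (.succ x) s (s.setReg x (s.reg x + 1)) 1
  | pred (s : State) (x : ℕ) : Runs (.pred x) s (s.setReg x (s.reg x - 1)) 1
  | load (s : State) (x a i : ℕ) : Runs (.load x a i) s (s.setReg x (s.arr a (s.reg i))) 1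
  | store (s : State) (a i x : ℕ) : Runs (.store a i x) s (s.setArr a (s.reg i) (s.reg x)) 1
  | emit (s : State) (x : ℕ) : Runs (.emit x) s { s with out := s.out ++ [s.reg x] } 1
  | seq {P Q : Program} {s s' s'' : State} {t t' : ℕ} :
      Runs P s s' t → Runs Q s' s'' t' → Runs (.seq P Q) s s'' (t + t')
  | cond_true {b : Test} {P Q : Program} {s s' : State} {t : ℕ} :
      b.Holds s → Runs P s s' t → Runs (.cond b P Q) s s' (t + 1)
  | cond_false {b : Test} {P Q : Program} {s s' : State} {t : ℕ} :
      ¬ b.Holds s → Runs Q s s' t → Runs (.cond b P Q) s s' (t + 1)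
  | loop_true {b : Test} {P : Program} {s s' s'' : State} {t t' : ℕ} :
      b.Holds s → Runs P s s' t → Runs (.loop b P) s' s'' t' → Runs (.loop b P) s s'' (t + t' + 1)
  | loop_false {b : Test} {P : Program} {s : State} :
      ¬ b.Holds s → Runs (.loop b P) s s 1

/-! ### Input and output -/

open Classical in
/-- The initial state on a graph with vertex set `{0, …, n - 1}`: register `0` holds `n`, array `0`
holds the adjacency matrix row by row (the entry for `u`, `v` at index `u * n + v`), everything else
is zero, and the output is empty. -/
noncomputable def inputState {n : ℕ} (G : SimpleGraph (Fin n)) : State where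
  reg x := if x = 0 then n else 0
  arr a i := if a = 0 ∧ ∃ u v : Fin n, G.Adj u v ∧ i = (u : ℕ) * n + (v : ℕ) then 1 else 0
  out := []

/-- A vertex set is printed as its characteristic vector, a sequence of `n` zeros and ones. -/
def charVector {n : ℕ} (S : Finset (Fin n)) : List ℕ :=
  List.ofFn fun v : Fin n => if v ∈ S then 1 else 0

/-- On input `G`, the program `P` halts after exactly `t` steps, and its output consists of the
members of the family `F`, one after the other, in some order, each of them exactly once. -/
def ListsInTime {n : ℕ} (P : Program) (G : SimpleGraph (Fin n)) (F : Set (Finset (Fin n)))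
    (t : ℕ) : Prop :=
  ∃ (s : State) (L : List (Finset (Fin n))),
    Runs P (inputState G) s t ∧ s.out = (L.map charVector).flatten ∧ L.Nodup ∧ ∀ S, S ∈ L ↔ S ∈ F

end CDS

/-! Both statements come from one nondeterministic search: a binary tree that asks for bits, has at
most `2 ^ 210 * 2 ^ ((1 - ε) * n)` leaves with `ε = 1 / 2 ^ 130`, and has every minimal connected
dominating set among its results. Counting the leaves gives (i), traversing the tree gives (ii).

Structure (`IsMinimalConnectedDominating.exists_sparse`). Let `S` be a minimal connected dominating
set with at least 12 members. Deleting a member `v` destroys domination, and then some vertex has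
`v` as its only neighbour in `S`, or it destroys connectedness. If a third of the members keep
`G[S]` connected when deleted, such private neighbours are plentiful. Otherwise there are many cut
vertices, and each cut vertex `c` is represented by the vertex nearest to a root in a part that `c`
separates from the root. Either way there is a set `U` with `|U| ≥ |S| / 4` such that each `u ∈ U`
has at most 8 neighbours in `S` and each `s ∈ S` has at most 3 neighbours in `U`.

Search. Sets with at most `n / 4` members are enumerated directly, so let `|U| > n / 16`. For `A ⊆
U` the neighbourhood `N(A)` contains at most `8 |A|` members of `S`. If `N(A)` is large compared
with `A`, guessing `A` and these few members costs less than deciding `N(A)` freely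
(`mem_leaves_decode_of_large`). This is tried at two very different scales of `|A|`. If it fails at
both, a tiny maximal `A` leaves every `u ∈ U` fewer than 256 neighbours outside `N(A)`, and failure
at the coarser scale shows that most `u` have fewer than 80 undecided ones. Every vertex has a
neighbour in `S`, so an undecided neighbourhood of size `c` of a vertex with no chosen neighbour
admits only `2 ^ c - 1` choices. Once the few vertices that lie in too many of these neighbourhoods
have been decided, linearly many disjoint blocks of this kind are found one after the other, and
each saves a factor `1 - 1 / 2 ^ 80` (`mem_leaves_decode_of_small`). The leaves are counted in
`size_decode_le` and `size_search_le`; completeness is `mem_leaves_search`.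

Algorithm. A deterministic program keeps a bit string, replays the search along it, tests the
result, prints it unless a trie shows that it was printed before, and moves to the lexicographically
next string. Each leaf costs polynomial time (`exists_loopTo`, `exists_program`). -/

namespace CDS

/-! ### Structure of minimal connected dominating sets -/

section Structure

variable {V : Type*}

/-- `B` is a union of connected components of `G[S]`. -/
def ClosedIn (G : SimpleGraph V) (S B : Finset V) : Prop :=
  ∀ x ∈ B, ∀ y ∈ S, G.Adj x y → y ∈ B

/-- A walk cannot leave a closed set, and the set of vertices reachable from a given one is closed.
This form of connectedness spares the later arguments all walks. -/
lemma induce_connected_iff (G : SimpleGraph V) (S : Finset V) :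
    (G.induce (S : Set V)).Connected ↔
      S.Nonempty ∧ ∀ B ⊆ S, B.Nonempty → ClosedIn G S B → B = S := by
  classical
  constructor
  · intro h
    obtain ⟨⟨r, hr⟩⟩ := h.nonempty
    refine ⟨⟨r, hr⟩, fun B hB hne hcl => ?_⟩
    obtain ⟨b, hb⟩ := hne
    refine Finset.Subset.antisymm hB fun y hy => ?_
    obtain ⟨w⟩ := h.preconnected ⟨b, hB hb⟩ ⟨y, hy⟩
    have key : ∀ (u v : ((S : Set V) : Type _)), (G.induce (S : Set V)).Walk u v →
        (u : V) ∈ B → (v : V) ∈ B := by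
      intro u v w
      induction w with
      | nil => exact id
      | @cons u v x huv _ ih => exact fun hu => ih (hcl _ hu _ v.2 huv)
    exact key _ _ w hb
  · rintro ⟨⟨r, hr⟩, h⟩
    have : Nonempty ((S : Set V) : Type _) := ⟨⟨r, hr⟩⟩
    refine SimpleGraph.Connected.mk fun u v => ?_
    have := h (S.filter fun x => ∃ hx : x ∈ S, (G.induce (S : Set V)).Reachable u ⟨x, hx⟩)
      (Finset.filter_subset _ _) ⟨u, by simp only [Finset.mem_filter]; exact ⟨u.2, u.2, .refl _⟩⟩ ?_
    · exact (Finset.mem_filter.1 ((Finset.ext_iff.1 this v).2 v.2)).2.2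
    · intro x hx y hy hxy
      rw [Finset.mem_filter] at hx ⊢
      obtain ⟨hx, hx', hr⟩ := hx
      refine ⟨hy, hy, hr.trans (SimpleGraph.Adj.reachable ?_)⟩
      exact hxy

/-- A nonempty closed set of `G[S]` meets `T` because `T` dominates, so it contains the connected
set `T`, and then everything adjacent to `T`. Minimality can therefore be tested by deleting single
vertices. -/
lemma IsConnectedDominating.mono {G : SimpleGraph V} {T S : Finset V}
    (hT : IsConnectedDominating G T) (hTS : T ⊆ S) : IsConnectedDominating G S := by
  classical
  obtain ⟨hd, hc⟩ := hT
  rw [induce_connected_iff] at hc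
  refine ⟨fun v hv => ?_, ?_⟩
  · obtain ⟨u, hu, h⟩ := hd v fun h => hv (hTS h)
    exact ⟨u, hTS hu, h⟩
  rw [induce_connected_iff]
  refine ⟨hc.1.mono hTS, fun B hB ⟨b, hb⟩ hcl => ?_⟩
  have hne : (B ∩ T).Nonempty := by
    by_cases hbT : b ∈ T
    · exact ⟨b, by simp [hb, hbT]⟩
    · obtain ⟨u, hu, h⟩ := hd b hbT
      exact ⟨u, Finset.mem_inter.2 ⟨hcl b hb u (hTS hu) h, hu⟩⟩
  have := hc.2 (B ∩ T) Finset.inter_subset_right hne fun x hx y hy hxy =>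
    Finset.mem_inter.2 ⟨hcl x (Finset.mem_inter.1 hx).1 y (hTS hy) hxy, hy⟩
  have hTB : T ⊆ B := by rw [← this]; exact Finset.inter_subset_left
  refine Finset.Subset.antisymm hB fun y hy => ?_
  by_cases hyT : y ∈ T
  · exact hTB hyT
  · obtain ⟨u, hu, h⟩ := hd y hyT
    exact hcl u (hTB hu) y hy h.symm

lemma isMinimalConnectedDominating_iff [DecidableEq V] (G : SimpleGraph V) (S : Finset V) :
    IsMinimalConnectedDominating G S ↔
      IsConnectedDominating G S ∧ ∀ v ∈ S, ¬ IsConnectedDominating G (S.erase v) := by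
  refine and_congr_right fun _ => ⟨fun h v hv => h _ (Finset.erase_ssubset hv), fun h T hT hc => ?_⟩
  obtain ⟨v, hv, hvT⟩ := Finset.exists_of_ssubset hT
  exact h v hv (hc.mono fun x hx =>
    Finset.mem_erase.2 ⟨fun e => hvT (e ▸ hx), hT.1 hx⟩)

/-- A connected graph on at least two vertices has no isolated vertex. -/
lemma exists_adj_of_connected {G : SimpleGraph V} {S : Finset V}
    (hc : (G.induce (S : Set V)).Connected) (h2 : 2 ≤ S.card) {v : V} (hv : v ∈ S) :
    ∃ u ∈ S, G.Adj v u := by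
  classical
  rw [induce_connected_iff] at hc
  by_contra! hno
  have := hc.2 {v} (by simpa using hv) (by simp) (by
    intro x hx y hy hxy
    rw [Finset.mem_singleton] at hx
    subst hx
    exact absurd hxy (hno y hy))
  rw [← this] at h2
  simp at h2

/-- Domination becomes total: members of `S` have neighbours in `S` too. This is what forces `S` to
meet the blocks of the search, whichever vertex they belong to. -/
lemma IsConnectedDominating.exists_adj {G : SimpleGraph V} {S : Finset V}
    (h : IsConnectedDominating G S) (h2 : 2 ≤ S.card) (v : V) : ∃ u ∈ S, G.Adj v u := by
  by_cases hv : v ∈ S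
  · exact exists_adj_of_connected h.2 h2 hv
  · exact h.1 v hv

/-- Distances from `r` in the connected graph `G[S]`. -/
lemma exists_levels {G : SimpleGraph V} {S : Finset V}
    (hc : (G.induce (S : Set V)).Connected) {r : V} (hr : r ∈ S) :
    ∃ l : V → ℕ, (∀ x ∈ S, x ≠ r → ∃ z ∈ S, G.Adj x z ∧ l z + 1 = l x) ∧
      ∀ x ∈ S, ∀ y ∈ S, G.Adj x y → l x ≤ l y + 1 := by
  classical
  set H := G.induce (S : Set V) with hH
  refine ⟨fun x => if hx : x ∈ S then H.dist ⟨x, hx⟩ ⟨r, hr⟩ else 0, ?_, ?_⟩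
  · intro x hx hxr
    obtain ⟨w, hw⟩ := hc.exists_walk_length_eq_dist ⟨x, hx⟩ ⟨r, hr⟩
    cases w with
    | nil => exact absurd rfl hxr
    | @cons _ z _ hxz p =>
      have hz : (z : V) ∈ S := z.2
      refine ⟨z, hz, hxz, ?_⟩
      simp only [hx, hz, dif_pos]
      have h1 : H.dist z ⟨r, hr⟩ ≤ p.length := SimpleGraph.dist_le p
      have h2 : H.dist ⟨x, hx⟩ ⟨r, hr⟩ ≤ H.dist ⟨x, hx⟩ z + H.dist z ⟨r, hr⟩ := hc.dist_triangle
      have h3 : H.dist ⟨x, hx⟩ z = 1 := SimpleGraph.dist_eq_one_iff_adj.2 hxz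
      rw [SimpleGraph.Walk.length_cons] at hw
      change H.dist z _ + 1 = _
      omega
  · intro x hx y hy hxy
    simp only [hx, hy, dif_pos]
    have h2 : H.dist ⟨x, hx⟩ ⟨r, hr⟩ ≤ H.dist ⟨x, hx⟩ ⟨y, hy⟩ + H.dist ⟨y, hy⟩ ⟨r, hr⟩ :=
      hc.dist_triangle
    have h3 : H.dist ⟨x, hx⟩ ⟨y, hy⟩ = 1 := SimpleGraph.dist_eq_one_iff_adj.2 hxy
    omega

/-- The cut vertices of a connected graph (other than a root) inject into the vertices in such a way
that every vertex has at most three neighbours in the image. -/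
lemma exists_sparse_image_of_cut {G : SimpleGraph V} {S C : Finset V} [DecidableEq V]
    [DecidableRel G.Adj]
    (hc : (G.induce (S : Set V)).Connected) {r : V} (hr : r ∈ S) (hC : C ⊆ S.erase r)
    (hcut : ∀ c ∈ C, ¬ (G.induce ((S.erase c : Finset V) : Set V)).Connected) :
    ∃ I ⊆ S, I.card = C.card ∧ ∀ s ∈ S, (I.filter fun v => G.Adj s v).card ≤ 3 := by
  obtain ⟨l, hl, hl'⟩ := exists_levels hc hr
  have hB : ∀ c ∈ C, ∃ B ⊆ S.erase c, r ∉ B ∧ B.Nonempty ∧ ClosedIn G (S.erase c) B := by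
    intro c hcC
    have h1 := hcut c hcC
    have hrc : r ∈ S.erase c :=
      Finset.mem_erase.2 ⟨fun e => (Finset.mem_erase.1 (hC hcC)).1 e.symm, hr⟩
    rw [induce_connected_iff] at h1
    push Not at h1
    obtain ⟨B, hB, hne, hcl, hBS⟩ := h1 ⟨r, hrc⟩
    -- The complement of a closed set is closed, so one of the two avoids `r`.
    by_cases hrB : r ∈ B
    · refine ⟨S.erase c \ B, Finset.sdiff_subset, by simp [hrB], ?_, ?_⟩
      · rw [Finset.sdiff_nonempty]
        exact fun h => hBS (Finset.Subset.antisymm hB h)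
      · intro x hx y hy hxy
        rw [Finset.mem_sdiff] at hx ⊢
        exact ⟨hy, fun hyB => hx.2 (hcl y hyB x hx.1 hxy.symm)⟩
    · exact ⟨B, hB, hrB, hne, hcl⟩
  choose! B hBS hrB hBne hBcl using hB
  -- The representative `f c` is a vertex of `B c` of least level.
  have hf : ∀ c ∈ C, ∃ y ∈ B c, ∀ z ∈ B c, l y ≤ l z := fun c hcC =>
    Finset.exists_min_image (B c) l (hBne c hcC)
  choose! f hfB hfmin using hf
  have hBS' : ∀ c ∈ C, ∀ x ∈ B c, x ∈ S ∧ x ≠ c ∧ x ≠ r := fun c hcC x hx =>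
    ⟨(Finset.mem_erase.1 (hBS c hcC hx)).2, (Finset.mem_erase.1 (hBS c hcC hx)).1,
      fun e => hrB c hcC (e ▸ hx)⟩
  have hpar : ∀ c ∈ C, ∀ x ∈ B c, ∃ z ∈ S, l z + 1 = l x ∧ (z = c ∨ z ∈ B c) := by
    intro c hcC x hx
    obtain ⟨h1, h2, h3⟩ := hBS' c hcC x hx
    obtain ⟨z, hz, hxz, hlz⟩ := hl x h1 h3
    refine ⟨z, hz, hlz, ?_⟩
    by_cases hzc : z = c
    · exact Or.inl hzc
    · exact Or.inr (hBcl c hcC x hx z (Finset.mem_erase.2 ⟨hzc, hz⟩) hxz)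
  -- By minimality a neighbour of `f c` one level lower is outside `B c`, so it is `c`.
  have hlf : ∀ c ∈ C, l (f c) = l c + 1 := by
    intro c hcC
    obtain ⟨z, hz, hlz, h⟩ := hpar c hcC _ (hfB c hcC)
    rcases h with h | h
    · rw [← hlz, h]
    · have := hfmin c hcC z h
      omega
  have hlB : ∀ c ∈ C, ∀ x ∈ B c, l c + 1 ≤ l x := fun c hcC x hx => by
    rw [← hlf c hcC]; exact hfmin c hcC x hx
  -- A vertex `x` lies in `B c` for at most one `c` of each level: moving from `x` towards the root
  -- stays inside `B c` until the level of `c`, where the vertex reached is `c` itself.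
  have huniq : ∀ k : ℕ, ∀ x, l x = k → ∀ c ∈ C, ∀ c' ∈ C, x ∈ B c → x ∈ B c' → l c = l c' →
      c = c' := by
    intro k
    induction k with
    | zero =>
      intro x hx c hcC c' hcC' h h'
      have := hlB c hcC x h
      omega
    | succ k ih =>
      intro x hx c hcC c' hcC' h h' hll
      by_cases hlk : l c = k
      · obtain ⟨z, hz, hlz, h1⟩ := hl x (hBS' c hcC x h).1 (hBS' c hcC x h).2.2
        have e1 : z = c := by
          by_contra hzc
          have := hlB c hcC z (hBcl c hcC x h z (Finset.mem_erase.2 ⟨hzc, hz⟩) hlz)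
          omega
        have e2 : z = c' := by
          by_contra hzc
          have := hlB c' hcC' z (hBcl c' hcC' x h' z (Finset.mem_erase.2 ⟨hzc, hz⟩) hlz)
          omega
        rw [← e1, e2]
      · obtain ⟨z, hz, hxz, h1⟩ := hl x (hBS' c hcC x h).1 (hBS' c hcC x h).2.2
        refine ih z (by omega) c hcC c' hcC' ?_ ?_ hll
        · refine hBcl c hcC x h z (Finset.mem_erase.2 ⟨?_, hz⟩) hxz
          rintro rfl
          omega
        · refine hBcl c' hcC' x h' z (Finset.mem_erase.2 ⟨?_, hz⟩) hxz
          rintro rfl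
          omega
  have hinj : Set.InjOn f C := by
    intro c hcC c' hcC' h
    have h1 := hlf c hcC
    have h2 := hlf c' hcC'
    refine huniq _ (f c) rfl c hcC c' hcC' (hfB c hcC) (h ▸ hfB c' hcC') ?_
    rw [h] at h1
    omega
  refine ⟨C.image f, ?_, Finset.card_image_of_injOn hinj, ?_⟩
  · intro x hx
    obtain ⟨c, hcC, rfl⟩ := Finset.mem_image.1 hx
    exact (hBS' c hcC _ (hfB c hcC)).1
  · intro s hs
    -- A neighbour `s ≠ c` of `f c` lies in `B c`, and its level exceeds that of `c` by one or two.
    -- Together with `s = c` these are three possibilities, each with at most one `c` by `huniq`.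
    have hsub : (C.image f).filter (fun v => G.Adj s v) ⊆
        (({s} ∪ C.filter fun c => s ∈ B c ∧ l c + 1 = l s) ∪
          C.filter fun c => s ∈ B c ∧ l c + 2 = l s).image f := by
      intro v hv
      obtain ⟨hv, hsv⟩ := Finset.mem_filter.1 hv
      obtain ⟨c, hcC, rfl⟩ := Finset.mem_image.1 hv
      refine Finset.mem_image_of_mem f ?_
      by_cases hcs : s = c
      · simp [hcs]
      · have hsB : s ∈ B c :=
          hBcl c hcC _ (hfB c hcC) s (Finset.mem_erase.2 ⟨hcs, hs⟩) hsv.symm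
        have h1 := hlB c hcC s hsB
        have h2 := hl' s hs _ (hBS' c hcC _ (hfB c hcC)).1 hsv
        rw [hlf c hcC] at h2
        simp only [Finset.mem_union, Finset.mem_filter, Finset.mem_singleton]
        rcases (by omega : l c + 1 = l s ∨ l c + 2 = l s) with h | h
        · exact Or.inl (Or.inr ⟨hcC, hsB, h⟩)
        · exact Or.inr ⟨hcC, hsB, h⟩
    have hone : ∀ j : ℕ, (C.filter fun c => s ∈ B c ∧ l c + j = l s).card ≤ 1 := by
      intro j
      rw [Finset.card_le_one]
      intro c hc1 c' hc2
      obtain ⟨a1, a2, a3⟩ := Finset.mem_filter.1 hc1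
      obtain ⟨b1, b2, b3⟩ := Finset.mem_filter.1 hc2
      exact huniq _ s rfl c a1 c' b1 a2 b2 (by omega)
    calc _ ≤ _ := Finset.card_le_card hsub
      _ ≤ _ := Finset.card_image_le
      _ ≤ _ := Finset.card_union_le _ _
      _ ≤ (({s} : Finset V).card + _) + _ := Nat.add_le_add_right (Finset.card_union_le _ _) _
      _ ≤ (1 + 1) + 1 := by
        gcongr
        · simp
        · exact hone 1
        · exact hone 2

/-- Every minimal connected dominating set `S` admits a set of at least `|S| / 4` vertices
that have few neighbours in `S` and are few among the neighbours of each vertex of `S`. -/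
theorem IsMinimalConnectedDominating.exists_sparse {G : SimpleGraph V} {S : Finset V}
    [DecidableEq V] [DecidableRel G.Adj]
    (h : IsMinimalConnectedDominating G S) (h12 : 12 ≤ S.card) :
    ∃ U : Finset V, S.card ≤ 4 * U.card ∧ (∀ u ∈ U, (S.filter fun s => G.Adj u s).card ≤ 8) ∧
      ∀ s ∈ S, (U.filter fun u => G.Adj s u).card ≤ 3 := by
  classical
  set W := S.filter fun v => (G.induce ((S.erase v : Finset V) : Set V)).Connected with hW
  -- Since `S.erase v` is connected, minimality says that it does not dominate; a vertex it misses
  -- still has a neighbour in `S`, which can only be `v`.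
  have hpriv : ∀ v ∈ W, ∃ u, S.filter (fun s => G.Adj u s) = {v} := by
    intro v hv
    obtain ⟨hvS, hcon⟩ := Finset.mem_filter.1 hv
    have hnd : ¬ IsDominating G (S.erase v) := fun hd => h.2 _ (Finset.erase_ssubset hvS) ⟨hd, hcon⟩
    unfold IsDominating at hnd
    push Not at hnd
    obtain ⟨u, -, hu⟩ := hnd
    refine ⟨u, ?_⟩
    obtain ⟨x, hx, hux⟩ := h.1.exists_adj (by omega) u
    have hxv : ∀ y ∈ S, G.Adj u y → y = v := fun y hy huy => by
      by_contra hne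
      exact hu y (Finset.mem_erase.2 ⟨hne, hy⟩) huy
    ext y
    simp only [Finset.mem_filter, Finset.mem_singleton]
    exact ⟨fun hy => hxv y hy.1 hy.2, fun e => by
      rw [e, ← hxv x hx hux]; exact ⟨hx, hux⟩⟩
  choose! p hp using hpriv
  by_cases hcase : S.card ≤ 3 * W.card
  · have hpinj : Set.InjOn p W := by
      intro v hv v' hv' hvv
      have h1 := hp v hv
      rw [hvv, hp v' hv', Finset.singleton_inj] at h1
      exact h1.symm
    refine ⟨W.image p, ?_, ?_, ?_⟩
    · rw [Finset.card_image_of_injOn hpinj]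
      omega
    · intro u hu
      obtain ⟨v, hv, rfl⟩ := Finset.mem_image.1 hu
      rw [hp v hv]
      simp
    · intro s hs
      refine le_trans (Finset.card_le_card (t := {p s}) ?_) (by simp)
      intro u hu
      obtain ⟨hu, hsu⟩ := Finset.mem_filter.1 hu
      obtain ⟨v, hv, rfl⟩ := Finset.mem_image.1 hu
      have : s ∈ S.filter (fun s => G.Adj (p v) s) := Finset.mem_filter.2 ⟨hs, hsu.symm⟩
      rw [hp v hv, Finset.mem_singleton] at this
      simp [this]
  · obtain ⟨r, hr⟩ : S.Nonempty := Finset.card_pos.1 (by omega)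
    obtain ⟨I, hIS, hIc, hI⟩ := exists_sparse_image_of_cut h.1.2 hr
      (C := (S \ W).erase r) (Finset.erase_subset_erase _ Finset.sdiff_subset) (by
        intro c hc hcon
        obtain ⟨hc1, hc2⟩ := Finset.mem_sdiff.1 (Finset.mem_erase.1 hc).2
        exact hc2 (Finset.mem_filter.2 ⟨hc1, hcon⟩))
    -- The root is the one member that may be neither represented nor in `W`.
    have hcard : S.card ≤ I.card + W.card + 1 := by
      have h1 : (S \ W).card + W.card = S.card :=
        Finset.card_sdiff_add_card_eq_card (Finset.filter_subset _ _)
      have h2 := Finset.pred_card_le_card_erase (s := S \ W) (a := r)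
      omega
    have hdc : ∑ u ∈ I, (S.filter fun s => G.Adj u s).card ≤ 3 * S.card := by
      have := Finset.sum_card_bipartiteAbove_eq_sum_card_bipartiteBelow (s := I) (t := S)
        (fun u s => G.Adj u s)
      unfold Finset.bipartiteAbove Finset.bipartiteBelow at this
      rw [this, mul_comm, ← smul_eq_mul]
      refine Finset.sum_le_card_nsmul _ _ _ fun s hs => ?_
      have e : (I.filter fun u => G.Adj u s) = I.filter fun u => G.Adj s u :=
        Finset.filter_congr fun u _ => G.adj_comm u s
      rw [e]
      exact hI s hs
    set U := I.filter fun u => (S.filter fun s => G.Adj u s).card ≤ 8 with hU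
    -- At most `|S| / 3` representatives have 9 or more neighbours in `S`. As `|I| > 2 |S| / 3 - 1`,
    -- more than `|S| / 3 - 1 ≥ |S| / 4` remain; here `12 ≤ |S|` is needed.
    have hbad : 9 * (I \ U).card ≤ 3 * S.card := by
      refine le_trans ?_ hdc
      refine le_trans ?_ (Finset.sum_le_sum_of_subset (Finset.sdiff_subset : I \ U ⊆ I))
      rw [mul_comm, ← smul_eq_mul]
      refine Finset.card_nsmul_le_sum _ _ _ fun u hu => ?_
      obtain ⟨h1, h2⟩ := Finset.mem_sdiff.1 hu
      by_contra hlt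
      exact h2 (Finset.mem_filter.2 ⟨h1, by omega⟩)
    have hUI : (I \ U).card + U.card = I.card :=
      Finset.card_sdiff_add_card_eq_card (Finset.filter_subset _ _)
    refine ⟨U, by omega, fun u hu => (Finset.mem_filter.1 hu).2, fun s hs => ?_⟩
    exact le_trans (Finset.card_le_card (Finset.filter_subset_filter _ (Finset.filter_subset _ _)))
      (hI s hs)

end Structure

end CDS

namespace CDS

/-! ### Computations that ask for bits -/

/-- A nondeterministic computation: a binary tree whose inner nodes ask for a bit and whose leaves
hold the results. -/
inductive BitTree (α : Type) : Type
  | leaf (a : α)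
  | node (l r : BitTree α)

namespace BitTree

variable {α β σ : Type}

/-- Sequential composition. -/
def bind : BitTree α → (α → BitTree β) → BitTree β
  | leaf a, f => f a
  | node l r, f => node (l.bind f) (r.bind f)

/-- The results, from left to right. -/
def leaves : BitTree α → List α
  | leaf a => [a]
  | node l r => l.leaves ++ r.leaves

/-- The number of results. -/
def size (t : BitTree α) : ℕ := t.leaves.length

/-- `t.Path π a`: answering the questions of `t` by the bits `π` leads to the result `a`. -/
inductive Path : BitTree α → List Bool → α → Prop
  | leaf (a : α) : Path (leaf a) [] a
  | left {l r : BitTree α} {π : List Bool} {a : α} : Path l π a → Path (node l r) (false :: π) a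
  | right {l r : BitTree α} {π : List Bool} {a : α} : Path r π a → Path (node l r) (true :: π) a

/-- Loop over a list. -/
def forL : List β → (β → σ → BitTree σ) → σ → BitTree σ
  | [], _, s => leaf s
  | b :: l, f, s => (f b s).bind (forL l f)

@[simp] lemma bind_leaf (a : α) (f : α → BitTree β) : (leaf a).bind f = f a := rfl

@[simp] lemma bind_node (l r : BitTree α) (f : α → BitTree β) :
    (node l r).bind f = node (l.bind f) (r.bind f) := rfl

@[simp] lemma size_leaf (a : α) : (leaf a).size = 1 := rfl

@[simp] lemma size_node (l r : BitTree α) : (node l r).size = l.size + r.size := by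
  simp [size, leaves]

lemma size_pos (t : BitTree α) : 0 < t.size := by
  induction t with
  | leaf a => simp
  | node l r ih _ => rw [size_node]; omega

@[simp] lemma mem_leaves_leaf {a b : α} : b ∈ (leaf a).leaves ↔ b = a := by simp [leaves]

@[simp] lemma mem_leaves_node {l r : BitTree α} {b : α} :
    b ∈ (node l r).leaves ↔ b ∈ l.leaves ∨ b ∈ r.leaves := by simp [leaves]

@[simp] lemma mem_leaves_bind {t : BitTree α} {f : α → BitTree β} {b : β} :
    b ∈ (t.bind f).leaves ↔ ∃ a ∈ t.leaves, b ∈ (f a).leaves := by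
  induction t with
  | leaf a => simp
  | node l r ihl ihr => simp [ihl, ihr, or_and_right, exists_or]

lemma size_bind_le {t : BitTree α} {f : α → BitTree β} {B : ℝ}
    (h : ∀ a ∈ t.leaves, ((f a).size : ℝ) ≤ B) : ((t.bind f).size : ℝ) ≤ t.size * B := by
  induction t with
  | leaf a => simpa using h
  | node l r ihl ihr =>
    have h1 := ihl fun a ha => h a (by simp [ha])
    have h2 := ihr fun a ha => h a (by simp [ha])
    simp only [bind_node, size_node, Nat.cast_add]
    linarith

lemma Path.bind {t : BitTree α} {f : α → BitTree β} {π ρ : List Bool} {a : α} {b : β}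
    (h : t.Path π a) (h' : (f a).Path ρ b) : (t.bind f).Path (π ++ ρ) b := by
  induction h with
  | leaf a => simpa using h'
  | left _ ih => exact .left (ih h')
  | right _ ih => exact .right (ih h')

end BitTree

open BitTree

/-! ### Asking for bounded subsets and for nonempty subsets -/

section Asking

variable {V : Type} [DecidableEq V]

/-- Ask whether the vertex `v` of `sel` belongs to the set under construction, unless it has `cap`
members already. -/
def askStep (sel : Finset V) (cap : ℕ) (v : V) (T : Finset V) : BitTree (Finset V) :=
  if v ∈ sel ∧ T.card < cap then node (leaf T) (leaf (insert v T)) else leaf T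

/-- The bound is a potential: a question either keeps the capacity or lowers it by one, which
accounts for the factor `1 + 1 / μ`. The free parameter `μ` replaces estimates of binomial sums; `μ
= 1` gives all subsets. -/
lemma size_forL_askStep_le (sel : Finset V) (cap : ℕ) {μ : ℝ} (hμ : 1 ≤ μ) :
    ∀ (l : List V), l.Nodup → ∀ T : Finset V, (∀ v ∈ l, v ∉ T) →
      ((forL l (askStep sel cap) T).size : ℝ) ≤
        μ ^ (cap - T.card) * (1 + 1 / μ) ^ (l.filter (· ∈ sel)).length := by
  have hμ0 : 0 < μ := by linarith
  have h1 : 1 ≤ 1 + 1 / μ := by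
    have : 0 < 1 / μ := by positivity
    linarith
  intro l
  induction l with
  | nil =>
    intro _ T _
    simpa [forL] using one_le_pow₀ hμ
  | cons v l ih =>
    intro hnd T hT
    obtain ⟨hv, hnd⟩ := List.nodup_cons.1 hnd
    have ih1 := ih hnd T fun w hw => hT w (List.mem_cons_of_mem _ hw)
    by_cases hc : v ∈ sel ∧ T.card < cap
    · have ih2 := ih hnd (insert v T) fun w hw => by
        rw [Finset.mem_insert, not_or]
        exact ⟨fun e => hv (e ▸ hw), hT w (List.mem_cons_of_mem _ hw)⟩
      rw [Finset.card_insert_of_notMem (hT v List.mem_cons_self)] at ih2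
      simp only [forL, askStep, if_pos hc, bind_node, bind_leaf, size_node, Nat.cast_add]
      rw [List.filter_cons_of_pos (by simpa using hc.1), List.length_cons]
      obtain ⟨c, hcc⟩ : ∃ c, cap - T.card = c + 1 := ⟨cap - T.card - 1, by omega⟩
      have hcc' : cap - (T.card + 1) = c := by omega
      rw [hcc] at ih1 ⊢
      rw [hcc'] at ih2
      refine (add_le_add ih1 ih2).trans_eq ?_
      rw [pow_succ μ, pow_succ (1 + 1 / μ)]
      field_simp
    · simp only [forL, askStep, if_neg hc, bind_leaf]
      refine ih1.trans ?_
      gcongr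
      · exact ((List.sublist_cons_self v l).filter _).length_le

lemma mem_leaves_forL_askStep {sel : Finset V} {cap : ℕ} :
    ∀ (l : List V) (T S : Finset V), T ⊆ S → S ⊆ sel → S.card ≤ cap → (∀ v ∈ S, v ∈ T ∨ v ∈ l) →
      S ∈ (forL l (askStep sel cap) T).leaves := by
  intro l
  induction l with
  | nil =>
    intro T S h1 _ _ h4
    have : S = T := Finset.Subset.antisymm (fun v hv => by simpa using h4 v hv) h1
    simp [forL, this]
  | cons v l ih =>
    intro T S h1 h2 h3 h4
    have skip : (v ∈ S → v ∈ T) → ∀ w ∈ S, w ∈ T ∨ w ∈ l := by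
      intro h w hw
      rcases h4 w hw with h' | h'
      · exact Or.inl h'
      · rcases List.mem_cons.1 h' with rfl | h'
        · exact Or.inl (h hw)
        · exact Or.inr h'
    by_cases hc : v ∈ sel ∧ T.card < cap
    · simp only [forL, askStep, if_pos hc, bind_node, bind_leaf, mem_leaves_node]
      by_cases hvS : v ∈ S
      · refine Or.inr (ih _ _ (Finset.insert_subset hvS h1) h2 h3 fun w hw => ?_)
        rcases h4 w hw with h' | h'
        · exact Or.inl (Finset.mem_insert_of_mem h')
        · rcases List.mem_cons.1 h' with rfl | h'
          · exact Or.inl (Finset.mem_insert_self _ _)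
          · exact Or.inr h'
      · exact Or.inl (ih _ _ h1 h2 h3 (skip fun h => absurd h hvS))
    · simp only [forL, askStep, if_neg hc, bind_leaf]
      refine ih _ _ h1 h2 h3 (skip fun hvS => ?_)
      by_contra hvT
      -- If no question is asked about `v`, the set is full; being properly contained in `S`, it
      -- would make `S` too large.
      have hcap : cap ≤ T.card := by
        by_contra hlt
        exact hc ⟨h2 hvS, by omega⟩
      have : T.card < S.card := Finset.card_lt_card
        (Finset.ssubset_iff_subset_ne.2 ⟨h1, fun e => hvT (e ▸ hvS)⟩)
      omega

/-- Ask whether the vertex `v` of `B` belongs to the set under construction; `c` vertices of `B`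
have not been considered yet, and the last of them is added without a question when the set is
still empty. -/
def blockStep (B : Finset V) (v : V) (Tc : Finset V × ℕ) : BitTree (Finset V × ℕ) :=
  if v ∈ B then
    if Tc.2 - 1 = 0 ∧ Tc.1 = ∅ then leaf (insert v Tc.1, Tc.2 - 1)
    else node (leaf (Tc.1, Tc.2 - 1)) (leaf (insert v Tc.1, Tc.2 - 1))
  else leaf Tc

lemma size_forL_blockStep_of_nonempty (B : Finset V) :
    ∀ (l : List V) (T : Finset V) (c : ℕ), T ≠ ∅ →
      (forL l (blockStep B) (T, c)).size = 2 ^ (l.filter (· ∈ B)).length := by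
  intro l
  induction l with
  | nil => intro T c _; simp [forL]
  | cons v l ih =>
    intro T c hT
    by_cases hv : v ∈ B
    · rw [List.filter_cons_of_pos (by simpa using hv), List.length_cons]
      simp only [forL, blockStep, if_pos hv, hT, and_false, if_false, bind_node, bind_leaf,
        size_node]
      rw [ih _ _ hT, ih _ _ (Finset.insert_ne_empty _ _)]
      ring
    · rw [List.filter_cons_of_neg (by simpa using hv)]
      simp only [forL, blockStep, if_neg hv, bind_leaf]
      exact ih _ _ hT

/-- Only the all-negative sequence of answers is lost, because the last question is suppressed when
the set is still empty. -/
lemma size_forL_blockStep (B : Finset V) :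
    ∀ (l : List V) (c : ℕ), c = (l.filter (· ∈ B)).length → 0 < c →
      (forL l (blockStep B) (∅, c)).size + 1 = 2 ^ c := by
  intro l
  induction l with
  | nil => intro c h h'; simp at h; omega
  | cons v l ih =>
    intro c hc hpos
    by_cases hv : v ∈ B
    · rw [List.filter_cons_of_pos (by simpa using hv), List.length_cons] at hc
      simp only [forL, blockStep, if_pos hv]
      by_cases h0 : c - 1 = 0
      · simp only [h0, and_self, if_true, bind_leaf]
        rw [size_forL_blockStep_of_nonempty _ _ _ _ (Finset.insert_ne_empty _ _)]
        have : (l.filter (· ∈ B)).length = 0 := by omega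
        rw [this, (by omega : c = 1)]
        norm_num
      · simp only [h0, false_and, if_false, bind_node, bind_leaf, size_node]
        rw [size_forL_blockStep_of_nonempty _ _ _ _ (Finset.insert_ne_empty _ _)]
        have := ih (c - 1) (by omega) (by omega)
        have e : (l.filter (· ∈ B)).length = c - 1 := by omega
        rw [e]
        obtain ⟨d, rfl⟩ : ∃ d, c = d + 1 := ⟨c - 1, by omega⟩
        rw [Nat.add_sub_cancel] at this ⊢
        rw [pow_succ]
        omega
    · rw [List.filter_cons_of_neg (by simpa using hv)] at hc
      simp only [forL, blockStep, if_neg hv, bind_leaf]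
      exact ih _ hc hpos

lemma mem_leaves_forL_blockStep {B : Finset V} :
    ∀ (l : List V), l.Nodup → ∀ (T S : Finset V), T ⊆ S → (∀ v ∈ S, v ∈ T ∨ v ∈ l) →
      S ⊆ B → (∀ v ∈ l, v ∉ T) → S.Nonempty →
      (S, 0) ∈ (forL l (blockStep B) (T, (l.filter (· ∈ B)).length)).leaves := by
  intro l
  induction l with
  | nil =>
    intro _ T S h1 h4 _ _ _
    have : S = T := Finset.Subset.antisymm (fun v hv => by simpa using h4 v hv) h1
    simp [forL, this]
  | cons v l ih =>
    intro hnd T S h1 h4 hSB hlT hS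
    obtain ⟨hvl, hnd⟩ := List.nodup_cons.1 hnd
    have hlT' : ∀ w ∈ l, w ∉ T := fun w hw => hlT w (List.mem_cons_of_mem _ hw)
    have hlT2 : ∀ w ∈ l, w ∉ insert v T := fun w hw => by
      rw [Finset.mem_insert, not_or]
      exact ⟨fun e => hvl (e ▸ hw), hlT' w hw⟩
    have hadd : ∀ w ∈ S, w ∈ insert v T ∨ w ∈ l := by
      intro w hw
      rcases h4 w hw with h' | h'
      · exact Or.inl (Finset.mem_insert_of_mem h')
      · rcases List.mem_cons.1 h' with rfl | h'
        · exact Or.inl (Finset.mem_insert_self _ _)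
        · exact Or.inr h'
    have hskip : v ∉ S → ∀ w ∈ S, w ∈ T ∨ w ∈ l := by
      intro hv w hw
      rcases h4 w hw with h' | h'
      · exact Or.inl h'
      · rcases List.mem_cons.1 h' with rfl | h'
        · exact absurd hw hv
        · exact Or.inr h'
    by_cases hv : v ∈ B
    · rw [List.filter_cons_of_pos (by simpa using hv), List.length_cons]
      simp only [forL, blockStep, if_pos hv, Nat.add_sub_cancel]
      by_cases h0 : (l.filter (· ∈ B)).length = 0 ∧ T = ∅
      · rw [if_pos h0, bind_leaf]
        have hvS : v ∈ S := by
          obtain ⟨w, hw⟩ := hS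
          rcases h4 w hw with h' | h'
          · simp [h0.2] at h'
          · rcases List.mem_cons.1 h' with rfl | h'
            · exact hw
            · have : w ∈ l.filter (· ∈ B) := List.mem_filter.2 ⟨h', by simpa using hSB hw⟩
              rw [List.length_eq_zero_iff.1 h0.1] at this
              simp at this
        exact ih hnd _ _ (Finset.insert_subset hvS h1) hadd hSB hlT2 hS
      · rw [if_neg h0, bind_node, mem_leaves_node, bind_leaf, bind_leaf]
        by_cases hvS : v ∈ S
        · exact Or.inr (ih hnd _ _ (Finset.insert_subset hvS h1) hadd hSB hlT2 hS)
        · exact Or.inl (ih hnd _ _ h1 (hskip hvS) hSB hlT' hS)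
    · rw [List.filter_cons_of_neg (by simpa using hv)]
      simp only [forL, blockStep, if_neg hv, bind_leaf]
      exact ih hnd _ _ h1 (hskip fun h => hv (hSB h)) hSB hlT' hS

end Asking

section FinRange

variable {n : ℕ}

lemma length_filter_finRange (F : Finset (Fin n)) :
    ((List.finRange n).filter (· ∈ F)).length = F.card := by
  rw [← List.toFinset_card_of_nodup ((List.nodup_finRange n).filter _)]
  congr 1
  ext v
  simp

/-- Ask for a subset of `sel` with at most `cap` members. -/
def askSet (sel : Finset (Fin n)) (cap : ℕ) : BitTree (Finset (Fin n)) :=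
  forL (List.finRange n) (askStep sel cap) ∅

lemma size_askSet_le (sel : Finset (Fin n)) (cap : ℕ) {μ : ℝ} (hμ : 1 ≤ μ) :
    ((askSet sel cap).size : ℝ) ≤ μ ^ cap * (1 + 1 / μ) ^ sel.card := by
  have := size_forL_askStep_le sel cap hμ (List.finRange n) (List.nodup_finRange n) ∅ (by simp)
  rwa [length_filter_finRange] at this

lemma size_askSet_le_two_pow (sel : Finset (Fin n)) (cap : ℕ) :
    ((askSet sel cap).size : ℝ) ≤ 2 ^ sel.card := by
  have := size_askSet_le sel cap (le_refl (1 : ℝ))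
  norm_num at this ⊢
  exact this

lemma mem_leaves_askSet {sel S : Finset (Fin n)} {cap : ℕ} (h : S ⊆ sel) (hc : S.card ≤ cap) :
    S ∈ (askSet sel cap).leaves :=
  mem_leaves_forL_askStep _ _ _ (Finset.empty_subset _) h hc fun v _ => Or.inr (by simp)

/-- Ask for a nonempty subset of `B`. -/
def askBlock (B : Finset (Fin n)) : BitTree (Finset (Fin n) × ℕ) :=
  forL (List.finRange n) (blockStep B) (∅, B.card)

lemma size_askBlock {B : Finset (Fin n)} (hB : 0 < B.card) :
    ((askBlock B).size : ℝ) = 2 ^ B.card - 1 := by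
  have := size_forL_blockStep B (List.finRange n) B.card (length_filter_finRange B).symm hB
  rw [eq_sub_iff_add_eq]
  exact_mod_cast this

lemma mem_leaves_askBlock {B S : Finset (Fin n)} (h : S ⊆ B) (hS : S.Nonempty) :
    (S, 0) ∈ (askBlock B).leaves := by
  have := mem_leaves_forL_blockStep (B := B) (List.finRange n) (List.nodup_finRange n) ∅ S
    (Finset.empty_subset _) (fun v _ => Or.inr (by simp)) h (by simp) hS
  rwa [length_filter_finRange] at this

end FinRange

end CDS

namespace CDS

open BitTree

/-! ### The decoder: definition, size and completeness -/

section Decoder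

variable {n : ℕ}

/-- The neighbours of `u` in `F`. -/
noncomputable def nbrs (G : SimpleGraph (Fin n)) (F : Finset (Fin n)) (u : Fin n) :
    Finset (Fin n) :=
  open Classical in F.filter fun v => G.Adj u v

lemma mem_nbrs {G : SimpleGraph (Fin n)} {F : Finset (Fin n)} {u v : Fin n} :
    v ∈ nbrs G F u ↔ v ∈ F ∧ G.Adj u v := by
  simp [nbrs]

/-- The vertices with a neighbour in `A`. -/
noncomputable def nbhd (G : SimpleGraph (Fin n)) (A : Finset (Fin n)) : Finset (Fin n) :=
  Finset.univ.filter fun v => 0 < (nbrs G A v).card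

lemma mem_nbhd {G : SimpleGraph (Fin n)} {A : Finset (Fin n)} {v : Fin n} :
    v ∈ nbhd G A ↔ ∃ u ∈ A, G.Adj v u := by
  simp only [nbhd, Finset.mem_filter, Finset.mem_univ, true_and, Finset.card_pos]
  exact ⟨fun ⟨u, hu⟩ => ⟨u, mem_nbrs.1 hu⟩, fun ⟨u, hu⟩ => ⟨u, mem_nbrs.2 hu⟩⟩

/-- Parameters of the decoder. -/
structure Params where
  /-- bound for the number of centres -/
  a : ℕ
  /-- bound for the number of members in the neighbourhood of the centres -/
  cap : ℕ
  /-- quotient of neighbours and centres that makes a neighbourhood large -/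
  ratio : ℕ
  /-- bound for degrees outside of the neighbourhood -/
  deg : ℕ
  /-- threshold for the vertices that are decided before the blocks -/
  codeg : ℕ
  /-- bound for the sizes of the blocks -/
  blk : ℕ
  /-- number of blocks -/
  num : ℕ
  /-- bound for the number of members among the vertices that are decided last -/
  rest : ℕ

/-- When the vertex `u` has no neighbour in the set `x.2.1` constructed so far, and few neighbours
in the set `x.1` of undecided vertices, decide the latter. -/
noncomputable def selectStep (G : SimpleGraph (Fin n)) (p : Params) (u : Fin n)
    (x : Finset (Fin n) × Finset (Fin n) × ℕ) :
    BitTree (Finset (Fin n) × Finset (Fin n) × ℕ) :=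
  if x.2.2 < p.num ∧ (nbrs G x.2.1 u).card = 0 ∧ 0 < (nbrs G x.1 u).card ∧
      (nbrs G x.1 u).card < p.blk then
    (askBlock (nbrs G x.1 u)).bind fun T =>
      leaf (x.1 \ nbrs G x.1 u, x.2.1 ∪ T.1, x.2.2 + 1)
  else leaf x

/-- The vertices of small degree to `R` that have no neighbour in `T`. -/
noncomputable def lowVertices (G : SimpleGraph (Fin n)) (p : Params) (R T : Finset (Fin n)) :
    Finset (Fin n) :=
  Finset.univ.filter fun u => (nbrs G R u).card < p.deg ∧ (nbrs G T u).card = 0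

/-- The vertices of `R` with many neighbours in `Q`. -/
noncomputable def hubs (G : SimpleGraph (Fin n)) (p : Params) (R Q : Finset (Fin n)) :
    Finset (Fin n) :=
  R.filter fun v => p.codeg < (nbrs G Q v).card

/-- The part of the decoder for small neighbourhoods. The result consists of the undecided
vertices, the set constructed so far, and a flag that allows to continue. -/
noncomputable def decodeLow (G : SimpleGraph (Fin n)) (p : Params) (R T : Finset (Fin n)) :
    BitTree (Finset (Fin n) × Finset (Fin n) × Bool) :=
  (askSet (hubs G p R (lowVertices G p R T)) n).bind fun T' =>
    (forL (List.finRange n) (selectStep G p)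
      (R \ hubs G p R (lowVertices G p R T), T ∪ T', 0)).bind fun x =>
        leaf (x.1, x.2.1, decide (¬ x.2.2 < p.num))

/-- All but the last phase of the decoder. -/
noncomputable def decodeStart (G : SimpleGraph (Fin n)) (p : Params) :
    BitTree (Finset (Fin n) × Finset (Fin n) × Bool) :=
  (askSet Finset.univ p.a).bind fun A =>
    (askSet (nbhd G A) p.cap).bind fun T =>
      if (nbhd G A).card / p.ratio < p.a then decodeLow G p (nbhd G A)ᶜ T
      else leaf ((nbhd G A)ᶜ, T, true)

/-- The last phase of the decoder. -/
def decodeRest (p : Params) (x : Finset (Fin n) × Finset (Fin n) × Bool) :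
    BitTree (Finset (Fin n)) :=
  if x.2.2 = true then (askSet x.1 p.rest).bind fun T => leaf (x.2.1 ∪ T) else leaf x.2.1

/-- The decoder: asks for a few centres and then for the members of a set. -/
noncomputable def decode (G : SimpleGraph (Fin n)) (p : Params) : BitTree (Finset (Fin n)) :=
  (decodeStart G p).bind (decodeRest p)

lemma BitTree.bind_assoc {α β γ : Type} (t : BitTree α) (f : α → BitTree β) (g : β → BitTree γ) :
    (t.bind f).bind g = t.bind fun a => (f a).bind g := by
  induction t with
  | leaf a => rfl
  | node l r ihl ihr => simp [ihl, ihr]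

lemma sum_card_nbrs_comm (G : SimpleGraph (Fin n)) (A B : Finset (Fin n)) :
    ∑ v ∈ A, (nbrs G B v).card = ∑ u ∈ B, (nbrs G A u).card := by
  classical
  have := Finset.sum_card_bipartiteAbove_eq_sum_card_bipartiteBelow (s := A) (t := B)
    (fun u s => G.Adj u s)
  unfold Finset.bipartiteAbove Finset.bipartiteBelow at this
  convert this using 2
  · unfold nbrs; congr
  · unfold nbrs; congr; simp only [G.adj_comm]

/-- Count the edges between hubs and low vertices: more than `codeg` at each hub, fewer than `deg`
at each low vertex. -/
lemma card_hubs_mul_le (G : SimpleGraph (Fin n)) (p : Params) (R T : Finset (Fin n)) :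
    (hubs G p R (lowVertices G p R T)).card * p.codeg ≤ n * p.deg := by
  set Q := lowVertices G p R T with hQ
  calc (hubs G p R Q).card * p.codeg
      ≤ ∑ v ∈ hubs G p R Q, (nbrs G Q v).card := by
        rw [← smul_eq_mul]
        exact Finset.card_nsmul_le_sum _ _ _ fun v hv => (Finset.mem_filter.1 hv).2.le
    _ = ∑ u ∈ Q, (nbrs G (hubs G p R Q) u).card := sum_card_nbrs_comm _ _ _
    _ ≤ Q.card * p.deg := by
        rw [← smul_eq_mul]
        refine Finset.sum_le_card_nsmul _ _ _ fun u hu => ?_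
        refine le_trans (Finset.card_le_card fun v hv => ?_) (Finset.mem_filter.1 hu).2.1.le
        rw [mem_nbrs] at hv ⊢
        exact ⟨(Finset.mem_filter.1 hv.1).1, hv.2⟩
    _ ≤ n * p.deg := Nat.mul_le_mul_right _ (by simpa using Finset.card_le_univ Q)

/-! ### The number of leaves -/

/-- Bound for the number of leaves when `r` vertices are undecided and `k` blocks are missing. -/
noncomputable def selectBound (b r k : ℕ) : ℝ :=
  2 ^ r * (1 - 1 / 2 ^ b) ^ k + if k = 0 then 0 else 2 ^ (b * k)

/-- A block of `c < b` vertices has `2 ^ c - 1` fillings. The first summand absorbs this because `2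
^ c - 1 ≤ 2 ^ c * (1 - 1 / 2 ^ b)`, the second because `2 ^ c - 1 ≤ 2 ^ b`. -/
lemma selectBound_step {b c r k : ℕ} (hc : c < b) (hcr : c ≤ r) :
    ((2 : ℝ) ^ c - 1) * selectBound b (r - c) k ≤ selectBound b r (k + 1) := by
  unfold selectBound
  have h1 : (1 : ℝ) ≤ 2 ^ c := one_le_pow₀ (by norm_num)
  have hcb : (2 : ℝ) ^ c ≤ 2 ^ b := pow_le_pow_right₀ (by norm_num) hc.le
  have hb : (1 : ℝ) ≤ 2 ^ b := one_le_pow₀ (by norm_num)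
  have hρ : (0 : ℝ) ≤ 1 - 1 / 2 ^ b := by
    rw [sub_nonneg, div_le_one (by positivity)]; exact hb
  have hsplit : (2 : ℝ) ^ r = 2 ^ c * 2 ^ (r - c) := by rw [← pow_add]; congr 1; omega
  have e1 : ((2 : ℝ) ^ c - 1) * (2 ^ (r - c) * (1 - 1 / 2 ^ b) ^ k) ≤
      2 ^ r * (1 - 1 / 2 ^ b) ^ (k + 1) := by
    have : ((2 : ℝ) ^ c - 1) ≤ 2 ^ c * (1 - 1 / 2 ^ b) := by
      have : (2 : ℝ) ^ c / 2 ^ b ≤ 1 := by rw [div_le_one (by positivity)]; exact hcb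
      linarith [show (2 : ℝ) ^ c * (1 - 1 / 2 ^ b) = 2 ^ c - 2 ^ c / 2 ^ b by ring]
    calc ((2 : ℝ) ^ c - 1) * (2 ^ (r - c) * (1 - 1 / 2 ^ b) ^ k)
        ≤ (2 ^ c * (1 - 1 / 2 ^ b)) * (2 ^ (r - c) * (1 - 1 / 2 ^ b) ^ k) := by gcongr
      _ = 2 ^ r * (1 - 1 / 2 ^ b) ^ (k + 1) := by rw [hsplit]; ring
  have e2 : ((2 : ℝ) ^ c - 1) * (if k = 0 then 0 else 2 ^ (b * k) : ℝ) ≤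
      (if k + 1 = 0 then 0 else 2 ^ (b * (k + 1)) : ℝ) := by
    rw [if_neg (Nat.succ_ne_zero k)]
    split_ifs
    · rw [mul_zero]; positivity
    · rw [Nat.mul_succ, pow_add, mul_comm]
      gcongr
      linarith
  rw [mul_add]
  exact add_le_add e1 e2

/-- The continuation `g` is the last phase: a free choice of all undecided vertices when enough
blocks have been filled, a single dead end otherwise. The dead ends are what the second summand of
`selectBound` counts; they are few because only block vertices have been decided. -/
lemma size_select_le (G : SimpleGraph (Fin n)) (p : Params)
    (g : Finset (Fin n) × Finset (Fin n) × ℕ → BitTree (Finset (Fin n)))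
    (hg : ∀ x, p.num ≤ x.2.2 → ((g x).size : ℝ) ≤ 2 ^ x.1.card)
    (hg' : ∀ x, x.2.2 < p.num → (g x).size = 1) :
    ∀ (l : List (Fin n)) (x : Finset (Fin n) × Finset (Fin n) × ℕ),
      (((forL l (selectStep G p) x).bind g).size : ℝ) ≤
        selectBound p.blk x.1.card (p.num - x.2.2) := by
  have hρ : (0 : ℝ) ≤ 1 - 1 / 2 ^ p.blk := by
    rw [sub_nonneg, div_le_one (by positivity)]; exact one_le_pow₀ (by norm_num)
  intro l
  induction l with
  | nil =>
    intro x
    simp only [forL, bind_leaf]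
    by_cases h : x.2.2 < p.num
    · rw [hg' x h, selectBound, if_neg (by omega)]
      have : (1 : ℝ) ≤ 2 ^ (p.blk * (p.num - x.2.2)) := one_le_pow₀ (by norm_num)
      have : (0 : ℝ) ≤ 2 ^ x.1.card * (1 - 1 / 2 ^ p.blk) ^ (p.num - x.2.2) := by positivity
      push_cast
      linarith
    · rw [selectBound, Nat.sub_eq_zero_of_le (not_lt.1 h)]
      simpa using hg x (not_lt.1 h)
  | cons u l ih =>
    intro x
    simp only [forL, selectStep]
    split_ifs with h
    · obtain ⟨h1, h2, h3, h4⟩ := h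
      rw [bind_assoc, bind_assoc]
      simp only [bind_leaf]
      refine (size_bind_le (B := selectBound p.blk (x.1.card - (nbrs G x.1 u).card)
        (p.num - (x.2.2 + 1))) fun T _ => ?_).trans ?_
      · have := ih (x.1 \ nbrs G x.1 u, x.2.1 ∪ T.1, x.2.2 + 1)
        rwa [Finset.card_sdiff_of_subset (fun v hv => (mem_nbrs.1 hv).1)] at this
      · rw [size_askBlock h3]
        have e : p.num - x.2.2 = (p.num - (x.2.2 + 1)) + 1 := by omega
        rw [e]
        exact selectBound_step h4 (Finset.card_le_card fun v hv => (mem_nbrs.1 hv).1)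
    · rw [bind_leaf]
      exact ih x

/-- Deciding the hubs costs `2 ^ |Y|`; in the first summand this is regained since the hubs leave
`R`, in the second it stays. -/
lemma size_decodeLow_le (G : SimpleGraph (Fin n)) (p : Params) (R T : Finset (Fin n)) :
    (((decodeLow G p R T).bind (decodeRest p)).size : ℝ) ≤
      2 ^ R.card * (1 - 1 / 2 ^ p.blk) ^ p.num +
        2 ^ ((hubs G p R (lowVertices G p R T)).card + p.blk * p.num) := by
  set Y := hubs G p R (lowVertices G p R T) with hY
  have hYR : Y ⊆ R := Finset.filter_subset _ _
  rw [decodeLow, bind_assoc]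
  refine (size_bind_le (B := selectBound p.blk (R.card - Y.card) p.num) fun T' _ => ?_).trans ?_
  · rw [bind_assoc]
    refine (size_select_le G p _ (fun x hx => ?_) (fun x hx => ?_) _ _).trans ?_
    · have : ¬ x.2.2 < p.num := not_lt.2 hx
      simp only [bind_leaf, decodeRest, this, not_false_eq_true, decide_true, if_true]
      refine (size_bind_le (B := 1) fun _ _ => by simp).trans ?_
      rw [mul_one]
      exact size_askSet_le_two_pow _ _
    · simp [decodeRest, hx]
    · rw [← hY, Finset.card_sdiff_of_subset hYR, Nat.sub_zero]
  · have h1 := size_askSet_le_two_pow Y n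
    have hρ : (0 : ℝ) ≤ 1 - 1 / 2 ^ p.blk := by
      rw [sub_nonneg, div_le_one (by positivity)]; exact one_le_pow₀ (by norm_num)
    have h0 : 0 ≤ selectBound p.blk (R.card - Y.card) p.num := by
      unfold selectBound; split_ifs <;> positivity
    calc _ ≤ 2 ^ Y.card * selectBound p.blk (R.card - Y.card) p.num := by gcongr
      _ = 2 ^ R.card * (1 - 1 / 2 ^ p.blk) ^ p.num +
          2 ^ Y.card * (if p.num = 0 then 0 else 2 ^ (p.blk * p.num)) := by
        have e : (2 : ℝ) ^ R.card = 2 ^ Y.card * 2 ^ (R.card - Y.card) := by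
          rw [← pow_add, Nat.add_sub_cancel' (Finset.card_le_card hYR)]
        rw [selectBound, e]; ring
      _ ≤ _ := by
        rw [pow_add]
        gcongr
        split_ifs
        · positivity
        · exact le_rfl

/-- The estimates that depend on the parameters are left to `hB1` (large neighbourhood of the
centres) and `hB2` (small one). In the small case the members in the neighbourhood are counted by
all of its subsets, so `cap` plays no role there. -/
theorem size_decode_le (G : SimpleGraph (Fin n)) (p : Params) {SA B μ : ℝ} {Rb : ℕ → ℝ}
    (hA : ((askSet (Finset.univ : Finset (Fin n)) p.a).size : ℝ) ≤ SA)
    (hR : ∀ R : Finset (Fin n), ((askSet R p.rest).size : ℝ) ≤ Rb R.card)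
    (hμ : 1 ≤ μ)
    (hB1 : ∀ x ≤ n, ¬ x / p.ratio < p.a → μ ^ p.cap * (1 + 1 / μ) ^ x * Rb (n - x) ≤ B)
    (hB2 : ∀ x ≤ n, ∀ y, x / p.ratio < p.a → y * p.codeg ≤ n * p.deg → y ≤ n →
      2 ^ n * (1 - 1 / 2 ^ p.blk) ^ p.num + 2 ^ (x + (y + p.blk * p.num)) ≤ B) :
    ((decode G p).size : ℝ) ≤ SA * B := by
  rw [decode, decodeStart, bind_assoc]
  have key : ∀ A : Finset (Fin n), ((((askSet (nbhd G A) p.cap).bind fun T =>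
      if (nbhd G A).card / p.ratio < p.a then decodeLow G p (nbhd G A)ᶜ T
      else leaf ((nbhd G A)ᶜ, T, true)).bind (decodeRest p)).size : ℝ) ≤ B := by
    intro A
    set X := nbhd G A with hX
    have hXn : X.card ≤ n := by simpa using Finset.card_le_univ X
    have hXc : Xᶜ.card = n - X.card := by simp [Finset.card_compl]
    rw [bind_assoc]
    by_cases h : X.card / p.ratio < p.a
    · simp only [if_pos h]
      have hρ : (0 : ℝ) ≤ 1 - 1 / 2 ^ p.blk := by
        rw [sub_nonneg, div_le_one (by positivity)]; exact one_le_pow₀ (by norm_num)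
      -- The set of hubs depends on `T`; the largest number of hubs serves all `T` at once.
      obtain ⟨y, hy1, hy2, hy3⟩ : ∃ y : ℕ, y * p.codeg ≤ n * p.deg ∧ y ≤ n ∧
          ∀ T, (hubs G p Xᶜ (lowVertices G p Xᶜ T)).card ≤ y := by
        obtain ⟨T₀, -, hT₀⟩ := Finset.exists_max_image (Finset.univ : Finset (Finset (Fin n)))
          (fun T => (hubs G p Xᶜ (lowVertices G p Xᶜ T)).card) Finset.univ_nonempty
        exact ⟨_, card_hubs_mul_le G p Xᶜ T₀, by simpa using Finset.card_le_univ (hubs G p Xᶜ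
          (lowVertices G p Xᶜ T₀)), fun T => hT₀ T (Finset.mem_univ _)⟩
      refine (size_bind_le (B := 2 ^ (n - X.card) * (1 - 1 / 2 ^ p.blk) ^ p.num +
        2 ^ (y + p.blk * p.num)) fun T _ => (size_decodeLow_le G p Xᶜ T).trans ?_).trans ?_
      · rw [hXc]
        gcongr
        · norm_num
        · exact hy3 T
      · refine le_trans ?_ (hB2 _ hXn y h hy1 hy2)
        calc _ ≤ 2 ^ X.card * (2 ^ (n - X.card) * (1 - 1 / 2 ^ p.blk) ^ p.num +
              2 ^ (y + p.blk * p.num) : ℝ) := by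
              gcongr
              exact size_askSet_le_two_pow _ _
          _ = _ := by
            have e : (2 : ℝ) ^ n = 2 ^ X.card * 2 ^ (n - X.card) := by
              rw [← pow_add, Nat.add_sub_cancel' hXn]
            rw [e, pow_add 2 X.card]; ring
    · simp only [if_neg h, bind_leaf, decodeRest, if_true]
      have hRb : 0 ≤ Rb Xᶜ.card := le_trans (by positivity) (hR Xᶜ)
      refine (size_bind_le (B := Rb Xᶜ.card) fun T _ => ?_).trans ?_
      · refine (size_bind_le (B := 1) fun _ _ => by simp).trans ?_
        rw [mul_one]
        exact hR _
      · refine le_trans ?_ (hB1 _ hXn h)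
        rw [← hXc]
        gcongr
        exact size_askSet_le _ _ hμ
  have hB : 0 ≤ B := le_trans (by positivity) (key ∅)
  refine (size_bind_le fun A _ => key A).trans ?_
  gcongr

/-! ### Sets that are found -/

/-- A set with few members in a large neighbourhood is found. -/
theorem mem_leaves_decode_of_large (G : SimpleGraph (Fin n)) (p : Params)
    {A S : Finset (Fin n)} (hA : A.card ≤ p.a) (hX : ¬ (nbhd G A).card / p.ratio < p.a)
    (hcap : (S ∩ nbhd G A).card ≤ p.cap) (hrest : (S \ nbhd G A).card ≤ p.rest) :
    S ∈ (decode G p).leaves := by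
  simp only [decode, decodeStart, mem_leaves_bind]
  refine ⟨((nbhd G A)ᶜ, S ∩ nbhd G A, true), ⟨A, mem_leaves_askSet (Finset.subset_univ _) hA,
    S ∩ nbhd G A, mem_leaves_askSet Finset.inter_subset_right hcap, ?_⟩, ?_⟩
  · rw [if_neg hX]; simp
  · simp only [decodeRest, if_true, mem_leaves_bind]
    refine ⟨S \ nbhd G A, mem_leaves_askSet (fun v hv => ?_) hrest, ?_⟩
    · simpa using (Finset.mem_sdiff.1 hv).2
    · rw [mem_leaves_leaf, Finset.union_comm, Finset.sdiff_union_inter]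

/-- Follow the run whose answers agree with `S`, so that the set constructed is always `S` minus the
undecided vertices. If the blocks do not reach the required number, every vertex that qualified at
the beginning was either chosen in its turn or had been touched by an earlier block. -/
lemma exists_mem_leaves_select (G : SimpleGraph (Fin n)) (p : Params) {S : Finset (Fin n)}
    (hS : ∀ u, ∃ s ∈ S, G.Adj u s) :
    ∀ (l : List (Fin n)) (R : Finset (Fin n)) (m : ℕ), ∃ (R' : Finset (Fin n)) (m' : ℕ),
      (R', S \ R', m') ∈ (forL l (selectStep G p) (R, S \ R, m)).leaves ∧ R' ⊆ R ∧ m ≤ m' ∧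
      (R \ R').card ≤ (m' - m) * p.blk ∧
      (p.num ≤ m' ∨ ∀ u ∈ l, (nbrs G (S \ R) u).card = 0 → 0 < (nbrs G R u).card →
        (nbrs G R u).card < p.blk → (nbrs G (R \ R') u).Nonempty) := by
  intro l
  induction l with
  | nil =>
    intro R m
    exact ⟨R, m, by simp [forL], subset_rfl, le_rfl, by simp, Or.inr (by simp)⟩
  | cons u l ih =>
    intro R m
    by_cases h : m < p.num ∧ (nbrs G (S \ R) u).card = 0 ∧ 0 < (nbrs G R u).card ∧
      (nbrs G R u).card < p.blk
    · set B := nbrs G R u with hB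
      have hBR : B ⊆ R := fun v hv => (mem_nbrs.1 hv).1
      obtain ⟨R', m', h1, h2, h3, h4, h5⟩ := ih (R \ B) (m + 1)
      have hBR' : B ⊆ R \ R' := fun v hv =>
        Finset.mem_sdiff.2 ⟨hBR hv, fun h' => (Finset.mem_sdiff.1 (h2 h')).2 hv⟩
      refine ⟨R', m', ?_, h2.trans Finset.sdiff_subset, by omega, ?_, ?_⟩
      · have hne : (S ∩ B).Nonempty := by
          obtain ⟨s, hs, hus⟩ := hS u
          have hsR : s ∈ R := by
            by_contra hsR
            have : s ∈ nbrs G (S \ R) u := mem_nbrs.2 ⟨Finset.mem_sdiff.2 ⟨hs, hsR⟩, hus⟩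
            rw [Finset.card_eq_zero.1 h.2.1] at this
            simp at this
          exact ⟨s, Finset.mem_inter.2 ⟨hs, mem_nbrs.2 ⟨hsR, hus⟩⟩⟩
        have e : S \ (R \ B) = S \ R ∪ S ∩ B := by
          ext v
          simp only [Finset.mem_sdiff, Finset.mem_union, Finset.mem_inter]
          have := @hBR v
          tauto
        simp only [forL, selectStep]
        rw [if_pos h, bind_assoc, mem_leaves_bind]
        refine ⟨(S ∩ B, 0), mem_leaves_askBlock Finset.inter_subset_right hne, ?_⟩
        rw [bind_leaf, ← hB, ← e]
        exact h1
      · have hsub : R \ R' ⊆ B ∪ (R \ B) \ R' := by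
          intro v hv
          simp only [Finset.mem_sdiff, Finset.mem_union] at hv ⊢
          tauto
        have := (Finset.card_le_card hsub).trans (Finset.card_union_le _ _)
        have e : m' - m = (m' - (m + 1)) + 1 := by omega
        rw [e, Nat.succ_mul]
        omega
      · refine h5.imp id fun h5 w hw hw1 hw2 hw3 => ?_
        -- A vertex not touched by the block has the same decided and undecided neighbours as
        -- before, so the induction hypothesis applies to it.
        by_cases hwB : (nbrs G B w).Nonempty
        · obtain ⟨v, hv⟩ := hwB
          exact ⟨v, mem_nbrs.2 ⟨hBR' (mem_nbrs.1 hv).1, (mem_nbrs.1 hv).2⟩⟩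
        · rcases List.mem_cons.1 hw with rfl | hw
          · obtain ⟨v, hv⟩ := Finset.card_pos.1 hw2
            exact absurd ⟨v, mem_nbrs.2 ⟨hv, (mem_nbrs.1 hv).2⟩⟩ hwB
          · have hB' : ∀ v ∈ B, ¬ G.Adj w v := fun v hv hwv => hwB ⟨v, mem_nbrs.2 ⟨hv, hwv⟩⟩
            have e1 : nbrs G (R \ B) w = nbrs G R w := by
              ext v
              simp only [mem_nbrs, Finset.mem_sdiff]
              exact ⟨fun h => ⟨h.1.1, h.2⟩, fun h => ⟨⟨h.1, fun hv => hB' v hv h.2⟩, h.2⟩⟩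
            have e2 : nbrs G (S \ (R \ B)) w = nbrs G (S \ R) w := by
              ext v
              simp only [mem_nbrs, Finset.mem_sdiff]
              have := hB' v
              tauto
            obtain ⟨v, hv⟩ := h5 w hw (by rw [e2]; exact hw1) (by rw [e1]; exact hw2)
              (by rw [e1]; exact hw3)
            refine ⟨v, ?_⟩
            simp only [mem_nbrs, Finset.mem_sdiff] at hv ⊢
            tauto
    · obtain ⟨R', m', h1, h2, h3, h4, h5⟩ := ih R m
      refine ⟨R', m', ?_, h2, h3, h4, ?_⟩
      · simp only [forL, selectStep]
        rw [if_neg h, bind_leaf]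
        exact h1
      · refine h5.elim Or.inl fun h5 => ?_
        by_cases hm : p.num ≤ m
        · exact Or.inl (hm.trans h3)
        · refine Or.inr fun w hw hw1 hw2 hw3 => ?_
          rcases List.mem_cons.1 hw with rfl | hw
          · exact absurd ⟨not_le.1 hm, hw1, hw2, hw3⟩ h
          · exact h5 w hw hw1 hw2 hw3

/-- A family of small sets with small multiplicities has a large disjoint subfamily. -/
lemma exists_disjoint_subfamily (G : SimpleGraph (Fin n)) (R U : Finset (Fin n)) {d e : ℕ}
    (hne : ∀ u ∈ U, (nbrs G R u).Nonempty)
    (hd : ∀ u ∈ U, (nbrs G R u).card ≤ d) (he : ∀ v ∈ R, (nbrs G U v).card ≤ e) :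
    ∃ A ⊆ U, U.card ≤ A.card * d * e ∧
      ∀ u ∈ A, ∀ v ∈ A, u ≠ v → Disjoint (nbrs G R u) (nbrs G R v) := by
  classical
  obtain ⟨A, hA, hmax⟩ := Finset.exists_max_image
    (U.powerset.filter fun A => ∀ u ∈ A, ∀ v ∈ A, u ≠ v → Disjoint (nbrs G R u) (nbrs G R v))
    Finset.card ⟨∅, by simp⟩
  obtain ⟨hAU, hdis⟩ := Finset.mem_filter.1 hA
  rw [Finset.mem_powerset] at hAU
  refine ⟨A, hAU, ?_, hdis⟩
  -- By maximality each neighbourhood meets the union of the chosen ones. This union has at most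
  -- `|A| * d` vertices, and each has at most `e` neighbours in `U`.
  have hcover : U ⊆ (A.biUnion fun u => nbrs G R u).biUnion fun v => nbrs G U v := by
    intro w hw
    by_contra hcon
    have hno : ∀ u ∈ A, Disjoint (nbrs G R w) (nbrs G R u) := by
      intro u hu
      rw [Finset.disjoint_left]
      intro v hv hv'
      refine hcon (Finset.mem_biUnion.2 ⟨v, Finset.mem_biUnion.2 ⟨u, hu, hv'⟩, ?_⟩)
      exact mem_nbrs.2 ⟨hw, (mem_nbrs.1 hv).2.symm⟩
    have hwA : w ∉ A := fun hwA => by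
      obtain ⟨v, hv⟩ := hne w hw
      exact Finset.disjoint_left.1 (hno w hwA) hv hv
    have := hmax (insert w A) (by
      rw [Finset.mem_filter, Finset.mem_powerset]
      refine ⟨Finset.insert_subset hw hAU, ?_⟩
      intro u hu v hv huv
      rcases Finset.mem_insert.1 hu with hu' | hu' <;> rcases Finset.mem_insert.1 hv with hv' | hv'
      · exact absurd (hu'.trans hv'.symm) huv
      · rw [hu']; exact hno v hv'
      · rw [hv']; exact (hno u hu').symm
      · exact hdis u hu' v hv' huv)
    rw [Finset.card_insert_of_notMem hwA] at this
    omega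
  refine (Finset.card_le_card hcover).trans (Finset.card_biUnion_le.trans ?_)
  refine (Finset.sum_le_card_nsmul _ _ e fun v hv => ?_).trans ?_
  · obtain ⟨u, -, hv⟩ := Finset.mem_biUnion.1 hv
    exact he v (mem_nbrs.1 hv).1
  · rw [smul_eq_mul]
    refine Nat.mul_le_mul_right _ (Finset.card_biUnion_le.trans ?_)
    rw [← smul_eq_mul]
    exact Finset.sum_le_card_nsmul _ _ _ fun u hu => hd u (hAU hu)

/-- A set that has no large neighbourhood with few members is found by the search for blocks. -/
theorem mem_leaves_decode_of_small (G : SimpleGraph (Fin n)) (p : Params)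
    {A S U : Finset (Fin n)} {b : ℕ} (hA : A.card ≤ p.a)
    (hX : (nbhd G A).card / p.ratio < p.a) (hcap : (S ∩ nbhd G A).card ≤ p.cap)
    (hrest : n ≤ p.rest) (hS : ∀ u, ∃ s ∈ S, G.Adj u s)
    (hUS : ∀ s ∈ S, (nbrs G U s).card ≤ 3)
    (hUX : ∀ u ∈ U, (nbrs G (nbhd G A)ᶜ u).card < p.deg)
    (hb : ∀ A' ⊆ U, A'.card = b → (nbhd G A').card < p.blk * b)
    (hnum : ∀ y, y * p.codeg ≤ n * p.deg →
      3 * p.cap + 3 * y + b * p.deg * p.codeg + p.num * p.blk * p.codeg < U.card) :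
    S ∈ (decode G p).leaves := by
  classical
  set X := nbhd G A with hXdef
  set T := S ∩ X with hT
  set Q := lowVertices G p Xᶜ T with hQ
  set Y := hubs G p Xᶜ Q with hY
  set R := Xᶜ \ Y with hR
  have hYle : Y.card * p.codeg ≤ n * p.deg := card_hubs_mul_le G p Xᶜ T
  have hSR : S \ R = T ∪ S ∩ Y := by
    ext v
    simp only [hR, hT, Finset.mem_sdiff, Finset.mem_union, Finset.mem_inter, Finset.mem_compl]
    tauto
  obtain ⟨R', m', h1, h2, -, h4, h5⟩ := exists_mem_leaves_select G p hS (List.finRange n) R 0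
  -- If too few blocks were found, `U` would be the union of three small classes: vertices with a
  -- decided neighbour in `S`, vertices with at least `blk` undecided neighbours, and vertices
  -- touched by a block. This contradicts `hnum`.
  have hm : ¬ m' < p.num := by
    intro hlt
    have htouch := h5.resolve_left (not_le.2 hlt)
    set U₁ := U.filter fun u => (nbrs G (S \ R) u).card = 0 with hU₁
    have hU₁Q : ∀ u ∈ U₁, u ∈ Q := by
      intro u hu
      obtain ⟨huU, hu0⟩ := Finset.mem_filter.1 hu
      refine Finset.mem_filter.2 ⟨Finset.mem_univ _, hUX u huU, ?_⟩
      rw [Finset.card_eq_zero] at hu0 ⊢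
      refine Finset.subset_empty.1 fun v hv => hu0 ▸ ?_
      rw [mem_nbrs] at hv ⊢
      exact ⟨by rw [hSR]; exact Finset.mem_union_left _ hv.1, hv.2⟩
    -- After removal of the hubs, an undecided vertex lies in few neighbourhoods of low vertices;
    -- this controls the second and the third class.
    have hRQ : ∀ v ∈ R, (nbrs G Q v).card ≤ p.codeg := by
      intro v hv
      obtain ⟨hv1, hv2⟩ := Finset.mem_sdiff.1 hv
      by_contra hcon
      exact hv2 (Finset.mem_filter.2 ⟨hv1, not_le.1 hcon⟩)
    have hsubQ : ∀ W ⊆ U₁, ∀ v ∈ R, (nbrs G W v).card ≤ p.codeg := fun W hW v hv =>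
      le_trans (Finset.card_le_card fun w hw => mem_nbrs.2
        ⟨hU₁Q w (hW (mem_nbrs.1 hw).1), (mem_nbrs.1 hw).2⟩) (hRQ v hv)
    have hnonempty : ∀ u ∈ U₁, (nbrs G R u).Nonempty := by
      intro u hu
      obtain ⟨s, hs, hus⟩ := hS u
      refine ⟨s, mem_nbrs.2 ⟨?_, hus⟩⟩
      by_contra hsR
      have : s ∈ nbrs G (S \ R) u := mem_nbrs.2 ⟨Finset.mem_sdiff.2 ⟨hs, hsR⟩, hus⟩
      rw [Finset.card_eq_zero.1 (Finset.mem_filter.1 hu).2] at this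
      simp at this
    -- The decided members of `S` are at most `cap` plus the number of hubs, and each has at most 3
    -- neighbours in `U`.
    have hlost : (U \ U₁).card ≤ 3 * p.cap + 3 * Y.card := by
      have hsub : U \ U₁ ⊆ (S \ R).biUnion fun s => nbrs G U s := by
        intro u hu
        obtain ⟨hu1, hu2⟩ := Finset.mem_sdiff.1 hu
        have : (nbrs G (S \ R) u).card ≠ 0 := fun h0 => hu2 (Finset.mem_filter.2 ⟨hu1, h0⟩)
        obtain ⟨s, hs⟩ := Finset.card_pos.1 (Nat.pos_of_ne_zero this)
        exact Finset.mem_biUnion.2 ⟨s, (mem_nbrs.1 hs).1, mem_nbrs.2 ⟨hu1, (mem_nbrs.1 hs).2.symm⟩⟩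
      refine (Finset.card_le_card hsub).trans (Finset.card_biUnion_le.trans ?_)
      refine (Finset.sum_le_card_nsmul _ _ 3 fun s hs => hUS s (Finset.mem_sdiff.1 hs).1).trans ?_
      have : (S \ R).card ≤ T.card + Y.card := by
        rw [hSR]
        exact (Finset.card_union_le _ _).trans
          (Nat.add_le_add_left (Finset.card_le_card Finset.inter_subset_right) _)
      rw [smul_eq_mul]
      omega
    set Ub := U₁.filter fun u => p.blk ≤ (nbrs G R u).card with hUb
    -- More than `b` disjoint large neighbourhoods would include `b` vertices of `U` with at least
    -- `blk * b` neighbours, against `hb`. So a disjoint subfamily is small, and with it the class.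
    have hbig : Ub.card ≤ b * p.deg * p.codeg := by
      have hUbU : Ub ⊆ U₁ := Finset.filter_subset _ _
      obtain ⟨A', hA', hcard, hdis⟩ := exists_disjoint_subfamily G R Ub (d := p.deg) (e := p.codeg)
        (fun u hu => hnonempty u (hUbU hu))
        (fun u hu => by
          refine le_trans (Finset.card_le_card fun v hv => ?_)
            (hUX u (Finset.mem_filter.1 (hUbU hu)).1).le
          exact mem_nbrs.2 ⟨(Finset.mem_sdiff.1 (mem_nbrs.1 hv).1).1, (mem_nbrs.1 hv).2⟩)
        (hsubQ Ub hUbU)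
      have hA'b : A'.card ≤ b := by
        by_contra hlt
        obtain ⟨A'', hA'', hc⟩ := Finset.exists_subset_card_eq (not_le.1 hlt).le
        have hl := hb A'' ((hA''.trans hA').trans (hUbU.trans (Finset.filter_subset _ _))) hc
        have hu : (A''.biUnion fun u => nbrs G R u) ⊆ nbhd G A'' := by
          intro v hv
          obtain ⟨u, hu, hv⟩ := Finset.mem_biUnion.1 hv
          exact mem_nbhd.2 ⟨u, hu, (mem_nbrs.1 hv).2.symm⟩
        have := Finset.card_le_card hu
        rw [Finset.card_biUnion fun u hu v hv huv => hdis u (hA'' hu) v (hA'' hv) huv] at this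
        have h' := Finset.card_nsmul_le_sum A'' (fun u => (nbrs G R u).card) p.blk fun u hu =>
          (Finset.mem_filter.1 (hA' (hA'' hu))).2
        rw [smul_eq_mul, hc, mul_comm] at h'
        omega
      calc Ub.card ≤ A'.card * p.deg * p.codeg := hcard
        _ ≤ _ := by gcongr
    -- The blocks contain at most `num * blk` vertices, each adjacent to at most `codeg` vertices of
    -- this class.
    have hsmall : (U₁ \ Ub).card ≤ p.num * p.blk * p.codeg := by
      have hsub : U₁ \ Ub ⊆ (R \ R').biUnion fun v => nbrs G U₁ v := by
        intro u hu
        obtain ⟨hu1, hu2⟩ := Finset.mem_sdiff.1 hu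
        obtain ⟨v, hv⟩ := htouch u (by simp) (Finset.mem_filter.1 hu1).2
          (Finset.card_pos.2 (hnonempty u hu1)) (by
            by_contra hcon
            exact hu2 (Finset.mem_filter.2 ⟨hu1, not_lt.1 hcon⟩))
        exact Finset.mem_biUnion.2 ⟨v, (mem_nbrs.1 hv).1, mem_nbrs.2 ⟨hu1, (mem_nbrs.1 hv).2.symm⟩⟩
      refine (Finset.card_le_card hsub).trans (Finset.card_biUnion_le.trans ?_)
      refine (Finset.sum_le_card_nsmul _ _ p.codeg fun v hv =>
        hsubQ U₁ subset_rfl v (Finset.mem_sdiff.1 hv).1).trans ?_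
      rw [smul_eq_mul]
      refine Nat.mul_le_mul_right _ (h4.trans (Nat.mul_le_mul_right _ ?_))
      omega
    have e1 : (U \ U₁).card + U₁.card = U.card :=
      Finset.card_sdiff_add_card_eq_card (Finset.filter_subset _ _)
    have e2 : (U₁ \ Ub).card + Ub.card = U₁.card :=
      Finset.card_sdiff_add_card_eq_card (Finset.filter_subset _ _)
    have := hnum Y.card hYle
    omega
  simp only [decode, decodeStart, mem_leaves_bind]
  refine ⟨(R', S \ R', true), ⟨A, mem_leaves_askSet (Finset.subset_univ _) hA, T,
    mem_leaves_askSet Finset.inter_subset_right hcap, ?_⟩, ?_⟩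
  · rw [if_pos hX]
    simp only [decodeLow, mem_leaves_bind]
    refine ⟨S ∩ Y, mem_leaves_askSet Finset.inter_subset_right
      (by simpa using Finset.card_le_univ (S ∩ Y)), (R', S \ R', m'), ?_, ?_⟩
    · rw [← hSR]; exact h1
    · simp [hm]
  · simp only [decodeRest, if_true, mem_leaves_bind]
    refine ⟨S ∩ R', mem_leaves_askSet Finset.inter_subset_right
      ((by simpa using Finset.card_le_univ (S ∩ R') : (S ∩ R').card ≤ n).trans hrest), ?_⟩
    rw [mem_leaves_leaf, Finset.sdiff_union_inter]

end Decoder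

end CDS

namespace CDS

/-! ### Programs with bounded loops -/

/-- Programs whose only loops are counting loops `for i < n`, where `n` is in register `0`. -/
inductive Cmd : Type
  | skip
  | const (x c : ℕ)
  | copy (x y : ℕ)
  | succ (x : ℕ)
  | pred (x : ℕ)
  | load (x a i : ℕ)
  | store (a i x : ℕ)
  | emit (x : ℕ)
  | seq (c d : Cmd)
  | ite (b : Test) (c d : Cmd)
  | forn (i : ℕ) (c : Cmd)

namespace Cmd

infixr:60 " ;; " => Cmd.seq

/-- Translation to programs. -/
def compile : Cmd → Program
  | skip => .skip
  | const x c => .const x c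
  | copy x y => .copy x y
  | succ x => .succ x
  | pred x => .pred x
  | load x a i => .load x a i
  | store a i x => .store a i x
  | emit x => .emit x
  | seq c d => .seq c.compile d.compile
  | ite b c d => .cond b c.compile d.compile
  | forn i c => .seq (.const i 0) (.loop (.lt i 0) (.seq c.compile (.succ i)))

open Classical in
/-- The effect of a program. -/
noncomputable def exec : Cmd → State → State
  | skip, s => s
  | const x c, s => s.setReg x c
  | copy x y, s => s.setReg x (s.reg y)
  | succ x, s => s.setReg x (s.reg x + 1)
  | pred x, s => s.setReg x (s.reg x - 1)
  | load x a i, s => s.setReg x (s.arr a (s.reg i))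
  | store a i x, s => s.setArr a (s.reg i) (s.reg x)
  | emit x, s => { s with out := s.out ++ [s.reg x] }
  | seq c d, s => d.exec (c.exec s)
  | ite b c d, s => if b.Holds s then c.exec s else d.exec s
  | forn i c, s =>
    Nat.rec (s.setReg i 0) (fun k st => (c.exec st).setReg i (k + 1)) (s.reg 0)

/-- The registers that are written. -/
def regs : Cmd → List ℕ
  | skip | store _ _ _ | emit _ => []
  | const x _ | copy x _ | succ x | pred x | load x _ _ => [x]
  | seq c d | ite _ c d => c.regs ++ d.regs
  | forn i c => i :: c.regs

/-- The arrays that are written. -/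
def arrs : Cmd → List ℕ
  | skip | const _ _ | copy _ _ | succ _ | pred _ | load _ _ _ | emit _ => []
  | store a _ _ => [a]
  | seq c d | ite _ c d => c.arrs ++ d.arrs
  | forn _ c => c.arrs

/-- Nothing is written to the output. -/
def silent : Cmd → Bool
  | emit _ => false
  | seq c d | ite _ c d => c.silent && d.silent
  | forn _ c => c.silent
  | _ => true

/-- Loop counters are not written inside of the loops. -/
def loopsOk : Cmd → Bool
  | seq c d | ite _ c d => c.loopsOk && d.loopsOk
  | forn i c => (i ∉ c.regs : Bool) && c.loopsOk
  | _ => true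

/-- A bound for the number of steps. -/
noncomputable def cost : Cmd → Polynomial ℕ
  | skip => 0
  | seq c d => c.cost + d.cost
  | ite _ c d => c.cost + d.cost + 1
  | forn _ c => Polynomial.X * (c.cost + 2) + 2
  | _ => 1

end Cmd

open Cmd

section StateLemmas

variable (s : State) (x y c a b i : ℕ)

@[simp] lemma setReg_reg : (s.setReg x c).reg y = if y = x then c else s.reg y := by
  simp [State.setReg, Function.update_apply]

@[simp] lemma setReg_arr : (s.setReg x c).arr = s.arr := rfl

@[simp] lemma setReg_out : (s.setReg x c).out = s.out := rfl

@[simp] lemma setArr_reg : (s.setArr a i c).reg = s.reg := rfl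

@[simp] lemma setArr_out : (s.setArr a i c).out = s.out := rfl

lemma setArr_arr : (s.setArr a i c).arr b =
    if b = a then Function.update (s.arr a) i c else s.arr b := by
  simp [State.setArr, Function.update_apply]

@[simp] lemma setArr_arr_apply (j : ℕ) : (s.setArr a i c).arr b j =
    if b = a ∧ j = i then c else s.arr b j := by
  rw [setArr_arr]
  by_cases h : b = a
  · subst h; simp [Function.update_apply]
  · simp [h]

end StateLemmas

section Exec

variable (s : State)

@[simp] lemma exec_skip : exec skip s = s := rfl
@[simp] lemma exec_const (x c : ℕ) : exec (const x c) s = s.setReg x c := rfl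
@[simp] lemma exec_copy (x y : ℕ) : exec (copy x y) s = s.setReg x (s.reg y) := rfl
@[simp] lemma exec_succ (x : ℕ) : exec (succ x) s = s.setReg x (s.reg x + 1) := rfl
@[simp] lemma exec_pred (x : ℕ) : exec (pred x) s = s.setReg x (s.reg x - 1) := rfl
@[simp] lemma exec_load (x a i : ℕ) : exec (load x a i) s = s.setReg x (s.arr a (s.reg i)) := rfl
@[simp] lemma exec_store (a i x : ℕ) :
    exec (store a i x) s = s.setArr a (s.reg i) (s.reg x) := rfl
@[simp] lemma exec_emit (x : ℕ) :
    exec (emit x) s = { s with out := s.out ++ [s.reg x] } := rfl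
@[simp] lemma exec_seq (c d : Cmd) : exec (c ;; d) s = exec d (exec c s) := rfl

lemma exec_ite_of_holds {b : Test} {c d : Cmd} (h : b.Holds s) :
    exec (ite b c d) s = exec c s := by simp [exec, h]

lemma exec_ite_of_not_holds {b : Test} {c d : Cmd} (h : ¬ b.Holds s) :
    exec (ite b c d) s = exec d s := by simp [exec, h]

@[simp] lemma exec_ite_eq (x y : ℕ) (c d : Cmd) :
    exec (ite (.eq x y) c d) s = if s.reg x = s.reg y then exec c s else exec d s := by
  split_ifs with h <;> simp [exec, Test.Holds, h]

@[simp] lemma exec_ite_lt (x y : ℕ) (c d : Cmd) :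
    exec (ite (.lt x y) c d) s = if s.reg x < s.reg y then exec c s else exec d s := by
  split_ifs with h <;> simp [exec, Test.Holds, h]

end Exec

/-- The states of a counting loop after `k` rounds. -/
noncomputable def iter (i : ℕ) (c : Cmd) (s : State) (k : ℕ) : State :=
  Nat.rec (s.setReg i 0) (fun k st => (exec c st).setReg i (k + 1)) k

lemma iter_succ (i : ℕ) (c : Cmd) (s : State) (k : ℕ) :
    iter i c s (k + 1) = (exec c (iter i c s k)).setReg i (k + 1) := rfl

lemma exec_forn (i : ℕ) (c : Cmd) (s : State) :
    exec (forn i c) s = iter i c s (s.reg 0) := rfl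

/-- This frame condition and the next two are syntactic, so for concrete programs they are settled
by evaluation. -/
lemma exec_reg {c : Cmd} : ∀ {s : State} {x : ℕ}, x ∉ c.regs → (exec c s).reg x = s.reg x := by
  induction c with
  | skip | store | emit => intros; rfl
  | const | copy | succ | pred | load =>
    intro s x h
    simp only [regs, List.mem_singleton] at h
    simp [h]
  | seq c d ihc ihd =>
    intro s x h
    simp only [regs, List.mem_append, not_or] at h
    rw [exec_seq, ihd h.2, ihc h.1]
  | ite b c d ihc ihd =>
    intro s x h
    simp only [regs, List.mem_append, not_or] at h
    by_cases hb : b.Holds s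
    · rw [exec_ite_of_holds s hb, ihc h.1]
    · rw [exec_ite_of_not_holds s hb, ihd h.2]
  | forn i c ih =>
    intro s x h
    simp only [regs, List.mem_cons, not_or] at h
    rw [exec_forn]
    induction s.reg 0 with
    | zero => simp [iter, h.1]
    | succ k ihk => rw [iter_succ, setReg_reg, if_neg h.1, ih h.2, ihk]

lemma exec_arr {c : Cmd} : ∀ {s : State} {a : ℕ}, a ∉ c.arrs → (exec c s).arr a = s.arr a := by
  induction c with
  | skip | const | copy | succ | pred | load | emit => intros; rfl
  | store =>
    intro s x h
    simp only [arrs, List.mem_singleton] at h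
    simp [setArr_arr, h]
  | seq c d ihc ihd =>
    intro s x h
    simp only [arrs, List.mem_append, not_or] at h
    rw [exec_seq, ihd h.2, ihc h.1]
  | ite b c d ihc ihd =>
    intro s x h
    simp only [arrs, List.mem_append, not_or] at h
    by_cases hb : b.Holds s
    · rw [exec_ite_of_holds s hb, ihc h.1]
    · rw [exec_ite_of_not_holds s hb, ihd h.2]
  | forn i c ih =>
    intro s x h
    rw [exec_forn]
    induction s.reg 0 with
    | zero => rfl
    | succ k ihk => rw [iter_succ, setReg_arr, ih h, ihk]

lemma exec_out {c : Cmd} : ∀ {s : State}, c.silent = true → (exec c s).out = s.out := by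
  induction c with
  | skip | const | copy | succ | pred | load | store => intros; rfl
  | emit => intro s h; simp [silent] at h
  | seq c d ihc ihd =>
    intro s h
    simp only [silent, Bool.and_eq_true] at h
    rw [exec_seq, ihd h.2, ihc h.1]
  | ite b c d ihc ihd =>
    intro s h
    simp only [silent, Bool.and_eq_true] at h
    by_cases hb : b.Holds s
    · rw [exec_ite_of_holds s hb, ihc h.1]
    · rw [exec_ite_of_not_holds s hb, ihd h.2]
  | forn i c ih =>
    intro s h
    rw [exec_forn]
    induction s.reg 0 with
    | zero => rfl
    | succ k ihk => rw [iter_succ, setReg_out, ih h, ihk]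

lemma iter_reg_zero {i : ℕ} {c : Cmd} {s : State} (hi : i ≠ 0) (h0 : 0 ∉ c.regs) (k : ℕ) :
    (iter i c s k).reg 0 = s.reg 0 := by
  induction k with
  | zero => simp [iter, hi.symm]
  | succ k ih => rw [iter_succ, setReg_reg, if_neg hi.symm, exec_reg h0, ih]

lemma iter_reg_self {i : ℕ} {c : Cmd} {s : State} (k : ℕ) : (iter i c s k).reg i = k := by
  cases k with
  | zero => simp [iter]
  | succ k => simp [iter_succ]

/-- No command writes to register `0` and no loop body writes to its counter, so every loop makes
exactly `n` rounds; the cost is then a polynomial in `n` that can be read off the text. -/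
lemma runs_compile {c : Cmd} : ∀ {s : State}, 0 ∉ c.regs → c.loopsOk = true →
    ∃ t ≤ c.cost.eval (s.reg 0), Runs c.compile s (exec c s) t := by
  induction c with
  | skip => intro s _ _; exact ⟨0, by simp [cost], .skip s⟩
  | const x c => intro s _ _; exact ⟨1, by simp [cost], .const s x c⟩
  | copy x y => intro s _ _; exact ⟨1, by simp [cost], .copy s x y⟩
  | succ x => intro s _ _; exact ⟨1, by simp [cost], .succ s x⟩
  | pred x => intro s _ _; exact ⟨1, by simp [cost], .pred s x⟩
  | load x a i => intro s _ _; exact ⟨1, by simp [cost], .load s x a i⟩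
  | store a i x => intro s _ _; exact ⟨1, by simp [cost], .store s a i x⟩
  | emit x => intro s _ _; exact ⟨1, by simp [cost], .emit s x⟩
  | seq c d ihc ihd =>
    intro s h0 hl
    simp only [regs, List.mem_append, not_or] at h0
    simp only [loopsOk, Bool.and_eq_true] at hl
    obtain ⟨t, ht, hr⟩ := ihc h0.1 hl.1 (s := s)
    obtain ⟨t', ht', hr'⟩ := ihd h0.2 hl.2 (s := exec c s)
    rw [exec_reg h0.1] at ht'
    exact ⟨t + t', by simp only [cost, Polynomial.eval_add]; omega, .seq hr hr'⟩
  | ite b c d ihc ihd =>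
    intro s h0 hl
    simp only [regs, List.mem_append, not_or] at h0
    simp only [loopsOk, Bool.and_eq_true] at hl
    simp only [cost, Polynomial.eval_add, Polynomial.eval_one]
    by_cases hb : b.Holds s
    · obtain ⟨t, ht, hr⟩ := ihc h0.1 hl.1 (s := s)
      exact ⟨t + 1, by omega, by rw [exec_ite_of_holds s hb]; exact .cond_true hb hr⟩
    · obtain ⟨t, ht, hr⟩ := ihd h0.2 hl.2 (s := s)
      exact ⟨t + 1, by omega, by rw [exec_ite_of_not_holds s hb]; exact .cond_false hb hr⟩
  | forn i c ih =>
    intro s h0 hl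
    simp only [regs, List.mem_cons, not_or] at h0
    simp only [loopsOk, Bool.and_eq_true, decide_eq_true_eq] at hl
    have hi : i ≠ 0 := fun e => h0.1 e.symm
    set N := s.reg 0 with hN
    -- Induction on the number `j` of rounds still to be made; the additional unit pays for the
    -- final failing test.
    have key : ∀ j k, k + j = N → ∃ t ≤ j * (c.cost.eval N + 2) + 1,
        Runs (.loop (.lt i 0) (.seq c.compile (.succ i))) (iter i c s k) (iter i c s N) t := by
      intro j
      induction j with
      | zero =>
        intro k hk
        obtain rfl : k = N := hk
        refine ⟨1, by omega, .loop_false ?_⟩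
        simp [Test.Holds, iter_reg_self, iter_reg_zero hi h0.2, hN]
      | succ j ihj =>
        intro k hk
        obtain ⟨t', ht', hr'⟩ := ihj (k + 1) (by omega)
        obtain ⟨t, ht, hr⟩ := ih h0.2 hl.2 (s := iter i c s k)
        rw [iter_reg_zero hi h0.2, ← hN] at ht
        refine ⟨(t + 1) + t' + 1, ?_, .loop_true ?_ (.seq hr (.succ _ i)) ?_⟩
        · rw [Nat.succ_mul]; omega
        · simp only [Test.Holds, iter_reg_self, iter_reg_zero hi h0.2]
          omega
        · rw [exec_reg hl.1, iter_reg_self]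
          exact hr'
    obtain ⟨t, ht, hr⟩ := key N 0 (by omega)
    refine ⟨1 + t, ?_, .seq (.const s i 0) hr⟩
    simp only [cost, Polynomial.eval_add, Polynomial.eval_mul, Polynomial.eval_X,
      Polynomial.eval_ofNat]
    omega

/-- Invariants of counting loops. -/
lemma exec_forn_induction {i : ℕ} {c : Cmd} {s : State} (I : ℕ → State → Prop)
    (h0 : I 0 (s.setReg i 0)) (hi : i ∉ 0 :: c.regs) (hc : 0 ∉ c.regs)
    (step : ∀ k st, k < s.reg 0 → st.reg i = k → st.reg 0 = s.reg 0 → I k st →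
      I (k + 1) ((exec c st).setReg i (k + 1))) :
    I (s.reg 0) (exec (forn i c) s) := by
  rw [List.mem_cons, not_or] at hi
  rw [exec_forn]
  have : ∀ k ≤ s.reg 0, I k (iter i c s k) := by
    intro k
    induction k with
    | zero => intro _; exact h0
    | succ k ih =>
      intro hk
      exact step k _ (by omega) (iter_reg_self k) (iter_reg_zero hi.1 hc k) (ih (by omega))
  exact this _ le_rfl

/-! ### Programs that ask for bits -/

/-- One more than the position of the last zero among the first `p` bits; zero if there is none. -/
def lastZero (orc : ℕ → Bool) : ℕ → ℕ
  | 0 => 0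
  | p + 1 => if orc p = false then p + 1 else lastZero orc p

/-- `p` bits of the sequence `orc` have been asked. Registers `1`, `2`, `3` hold `p`, the
number of bits that are prescribed, and the position after the last asked bit that is zero; array
`1` holds the bits. -/
structure AskInv (orc : ℕ → Bool) (p : ℕ) (s : State) : Prop where
  pos : s.reg 1 = p
  last : s.reg 3 = lastZero orc p
  zero : s.reg 5 = 0
  bits : ∀ i, i < p ∨ i < s.reg 2 → s.arr 1 i = (orc i).toNat
  rest : ∀ i, p ≤ i → s.reg 2 ≤ i → orc i = false

/-- The program `c` computes what the tree `t` prescribes. -/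
def Sim {α : Type} (P : State → Prop) (c : Cmd) (t : BitTree α) (Q : α → State → Prop) : Prop :=
  ∀ orc p s, P s → AskInv orc p s → ∃ π a, t.Path π a ∧ Q a (exec c s) ∧
    AskInv orc (p + π.length) (exec c s) ∧ ∀ i (h : i < π.length), π[i] = orc (p + i)

/-- The bookkeeping of the questions is not touched. -/
def Cmd.noAsk (c : Cmd) : Bool :=
  (1 ∉ c.regs : Bool) && (2 ∉ c.regs : Bool) && (3 ∉ c.regs : Bool) && (5 ∉ c.regs : Bool) &&
    (1 ∉ c.arrs : Bool)

lemma AskInv.congr {orc : ℕ → Bool} {p : ℕ} {s s' : State} (h : AskInv orc p s)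
    (h1 : s'.reg 1 = s.reg 1) (h2 : s'.reg 2 = s.reg 2) (h3 : s'.reg 3 = s.reg 3)
    (h5 : s'.reg 5 = s.reg 5) (ha : s'.arr 1 = s.arr 1) : AskInv orc p s' :=
  ⟨h1 ▸ h.pos, h3 ▸ h.last, h5 ▸ h.zero, by rw [h2, ha]; exact h.bits, by rw [h2]; exact h.rest⟩

lemma AskInv.exec {orc : ℕ → Bool} {p : ℕ} {s : State} {c : Cmd} (h : AskInv orc p s)
    (hc : c.noAsk = true) : AskInv orc p (exec c s) := by
  simp only [noAsk, Bool.and_eq_true, decide_eq_true_eq] at hc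
  obtain ⟨⟨⟨⟨h1, h2⟩, h3⟩, h5⟩, ha⟩ := hc
  exact h.congr (exec_reg h1) (exec_reg h2) (exec_reg h3) (exec_reg h5) (exec_arr ha)

namespace Sim

variable {α β σ : Type} {P : State → Prop} {c d : Cmd}

lemma pure {a : α} {Q : α → State → Prop} (hc : c.noAsk = true)
    (h : ∀ s, P s → Q a (exec c s)) : Sim P c (.leaf a) Q := fun _ _ s hP hA =>
  ⟨[], a, .leaf a, h s hP, hA.exec hc, by simp⟩

lemma bind {t : BitTree α} {f : α → BitTree β} {Q : α → State → Prop} {R : β → State → Prop}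
    (h : Sim P c t Q) (h' : ∀ a, Sim (Q a) d (f a) R) : Sim P (c ;; d) (t.bind f) R := by
  intro orc p s hP hA
  obtain ⟨π, a, hπ, hQ, hA', hb⟩ := h orc p s hP hA
  obtain ⟨ρ, b, hρ, hR, hA'', hb'⟩ := h' a orc _ _ hQ hA'
  refine ⟨π ++ ρ, b, hπ.bind hρ, hR, ?_, ?_⟩
  · rw [List.length_append, ← add_assoc]; exact hA''
  · intro i hi
    rw [List.getElem_append]
    split_ifs with hlt
    · exact hb i hlt
    · rw [hb']
      congr 1
      omega

lemma bind_pure {t : BitTree α} {Q : α → State → Prop} {g : α → β}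
    {R : β → State → Prop} (h : Sim P c t Q) (hd : d.noAsk = true)
    (h' : ∀ a s, Q a s → R (g a) (exec d s)) :
    Sim P (c ;; d) (t.bind fun a => .leaf (g a)) R :=
  h.bind fun a => pure hd (h' a)

lemma pre {t : BitTree α} {Q : State → Prop} {R : α → State → Prop}
    (hc : c.noAsk = true) (h : ∀ s, P s → Q (exec c s)) (h' : Sim Q d t R) :
    Sim P (c ;; d) t R := by
  have := bind (pure (a := ()) (Q := fun _ => Q) hc h) (f := fun _ => t) fun _ => h'
  exact this

lemma ite {φ : Prop} [Decidable φ] {b : Test} {t t' : BitTree α} {Q : α → State → Prop}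
    (hb : ∀ s, P s → (b.Holds s ↔ φ)) (h : φ → Sim P c t Q) (h' : ¬ φ → Sim P d t' Q) :
    Sim P (.ite b c d) (if φ then t else t') Q := by
  intro orc p s hP hA
  by_cases hφ : φ
  · rw [exec_ite_of_holds s ((hb s hP).2 hφ), if_pos hφ]
    exact h hφ orc p s hP hA
  · rw [exec_ite_of_not_holds s (fun hh => hφ ((hb s hP).1 hh)), if_neg hφ]
    exact h' hφ orc p s hP hA

lemma weaken {t : BitTree α} {P' : State → Prop} {Q Q' : α → State → Prop}
    (h : Sim P c t Q) (hP : ∀ s, P' s → P s) (hQ : ∀ a s, Q a s → Q' a s) : Sim P' c t Q' := by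
  intro orc p s hs hA
  obtain ⟨π, a, h1, h2, h3, h4⟩ := h orc p s (hP s hs) hA
  exact ⟨π, a, h1, hQ _ _ h2, h3, h4⟩

end Sim

lemma BitTree.forL_append {β σ : Type} (f : β → σ → BitTree σ) (l₁ l₂ : List β) (s : σ) :
    BitTree.forL (l₁ ++ l₂) f s = (BitTree.forL l₁ f s).bind (BitTree.forL l₂ f) := by
  induction l₁ generalizing s with
  | nil => rfl
  | cons b l ih =>
    simp only [List.cons_append, BitTree.forL]
    rw [BitTree.bind_assoc]
    congr 1
    exact funext fun s => ih s

/-- Counting loops compute loops over the vertices. -/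
lemma Sim.forn {σ : Type} {n : ℕ} {P : State → Prop} {i : ℕ} {c : Cmd}
    {f : Fin n → σ → BitTree σ} {st₀ : σ}
    (I : ℕ → σ → State → Prop) (hi : i ∉ 0 :: 1 :: 2 :: 3 :: 5 :: c.regs) (hc : 0 ∉ c.regs)
    (h0 : ∀ s, P s → s.reg 0 = n ∧ I 0 st₀ (s.setReg i 0))
    (step : ∀ (v : Fin n) (st : σ), Sim (fun s => I v st s ∧ s.reg i = v ∧ s.reg 0 = n) c
      (f v st) fun st' s => I (v + 1) st' (s.setReg i (v + 1))) :
    Sim P (forn i c) (BitTree.forL (List.finRange n) f st₀) (I n) := by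
  simp only [List.mem_cons, not_or] at hi
  obtain ⟨i0, i1, i2, i3, i5, hi⟩ := hi
  intro orc p s hP hA
  obtain ⟨hn, hI0⟩ := h0 s hP
  have key : ∀ k ≤ n, ∃ π a, (BitTree.forL ((List.finRange n).take k) f st₀).Path π a ∧
      I k a (iter i c s k) ∧ AskInv orc (p + π.length) (iter i c s k) ∧
      ∀ j (h : j < π.length), π[j] = orc (p + j) := by
    intro k
    induction k with
    | zero =>
      intro _
      refine ⟨[], st₀, .leaf st₀, hI0, hA.congr ?_ ?_ ?_ ?_ rfl, by simp⟩ <;>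
        exact (setReg_reg _ _ _ _).trans (if_neg (by omega))
    | succ k ih =>
      intro hk
      obtain ⟨π, a, h1, h2, h3, h4⟩ := ih (by omega)
      obtain ⟨ρ, b, g1, g2, g3, g4⟩ := step ⟨k, hk⟩ a orc _ _
        ⟨h2, iter_reg_self k, (iter_reg_zero i0 hc k).trans hn⟩ h3
      refine ⟨π ++ ρ, b, ?_, g2, ?_, ?_⟩
      · rw [List.take_add_one, List.getElem?_eq_getElem (by simpa using hk), BitTree.forL_append]
        refine h1.bind ?_
        simpa [BitTree.forL] using g1.bind (.leaf b) (f := fun x => BitTree.leaf x)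
      · rw [List.length_append, ← add_assoc, iter_succ]
        refine g3.congr ?_ ?_ ?_ ?_ rfl <;> simp <;> omega
      · intro j hj
        rw [List.getElem_append]
        split_ifs with hlt
        · exact h4 j hlt
        · rw [g4]
          congr 1
          omega
  obtain ⟨π, a, h1, h2, h3, h4⟩ := key n le_rfl
  rw [exec_forn, hn]
  refine ⟨π, a, ?_, h2, h3, h4⟩
  rwa [List.take_of_length_le (by simp)] at h1

/-- Ask for a bit. -/
def ask (z : ℕ) : Cmd :=
  ite (.lt 1 2) (load z 1 1) (const z 0 ;; store 1 1 z) ;; succ 1 ;;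
    ite (.eq z 5) (copy 3 1) skip

/-- A prescribed bit is read from array `1`. Beyond the prescribed part the answer zero is given and
recorded, which agrees with `orc` because `orc` vanishes there. -/
lemma Sim.ask {P : State → Prop} {z : ℕ} {Q : Bool → State → Prop} (hz : z ∉ [1, 2, 3, 5])
    (h : ∀ s s' (b : Bool), P s → s'.reg z = b.toNat →
      (∀ x, x ≠ z → x ≠ 1 → x ≠ 3 → s'.reg x = s.reg x) → (∀ a, a ≠ 1 → s'.arr a = s.arr a) →
      s'.out = s.out → Q b s') :
    Sim P (ask z) (.node (.leaf false) (.leaf true)) Q := by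
  simp only [List.mem_cons, not_or] at hz
  obtain ⟨z1, z2, z3, z5, -⟩ := hz
  intro orc p s hP hA
  have hpath : ∀ b : Bool, (BitTree.node (.leaf false) (.leaf true)).Path [b] b := by
    intro b; cases b
    · exact .left (.leaf _)
    · exact .right (.leaf _)
  have hreg : ∀ x, x ≠ z → x ≠ 1 → x ≠ 3 → (exec (CDS.ask z) s).reg x = s.reg x := by
    intro x h1 h2 h3
    refine exec_reg ?_
    simp [CDS.ask, regs, h1, h2, h3]
  have harr : ∀ a, a ≠ 1 → (exec (CDS.ask z) s).arr a = s.arr a := by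
    intro a ha
    refine exec_arr ?_
    simp [CDS.ask, arrs, ha]
  obtain ⟨s₁, hs₁⟩ : ∃ s₁, s₁ = exec (Cmd.ite (.lt 1 2) (load z 1 1) (const z 0 ;; store 1 1 z)) s :=
    ⟨_, rfl⟩
  have hs : exec (CDS.ask z) s = exec (succ 1 ;; Cmd.ite (.eq z 5) (copy 3 1) skip) s₁ := by
    rw [hs₁]; rfl
  have hpos := hA.pos
  have hreg₁ : ∀ x, x ≠ z → s₁.reg x = s.reg x := by
    intro x hx
    rw [hs₁]
    refine exec_reg ?_
    simp [regs, hx]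
  have hz₁ : s₁.reg z = (orc p).toNat ∧ ∀ i, i < p + 1 ∨ i < s.reg 2 →
      s₁.arr 1 i = (orc i).toNat := by
    by_cases hlt : s.reg 1 < s.reg 2
    · rw [hs₁, exec_ite_lt, if_pos hlt]
      simp only [exec_load, setReg_reg, if_true, setReg_arr]
      exact ⟨by rw [hpos]; exact hA.bits p (by omega), fun i hi => hA.bits i (by omega)⟩
    · have hp := hA.rest p le_rfl (by omega)
      rw [hs₁, exec_ite_lt, if_neg hlt]
      simp only [exec_seq, exec_const, exec_store, setReg_reg, setArr_reg, if_true,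
        setArr_arr_apply, setReg_arr, hp, Bool.toNat_false, true_and]
      intro i hi
      rw [if_neg (fun e : 1 = z => z1 e.symm), hpos]
      split_ifs with hip
      · rw [hip, hp]; rfl
      · exact hA.bits i (by omega)
  have h₁ : s₁.reg 1 = p := (hreg₁ 1 (by omega)).trans hpos
  have h₃ : s₁.reg 3 = lastZero orc p := (hreg₁ 3 (by omega)).trans hA.last
  have h₅ : s₁.reg 5 = 0 := (hreg₁ 5 (by omega)).trans hA.zero
  have hposz : (exec (CDS.ask z) s).reg 1 = p + 1 := by
    rw [hs]
    simp only [exec_seq, exec_ite_eq, exec_succ, setReg_reg]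
    split_ifs <;> simp [h₁]
  have hzval : (exec (CDS.ask z) s).reg z = (orc p).toNat := by
    rw [hs, ← hz₁.1]
    refine exec_reg ?_
    simp [regs, z1, z3]
  -- The position is copied after it has been increased, so zero is left to mean that no asked bit
  -- was zero.
  have hlast : (exec (CDS.ask z) s).reg 3 = lastZero orc (p + 1) := by
    rw [hs]
    simp only [exec_seq, exec_ite_eq, exec_succ, setReg_reg, if_neg z1, h₅, hz₁.1, lastZero,
      OfNat.ofNat_ne_one, if_false]
    cases orc p <;> simp [h₁, h₃]
  have hbits : ∀ i, i < p + 1 ∨ i < s.reg 2 →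
      (exec (CDS.ask z) s).arr 1 i = (orc i).toNat := by
    intro i hi
    rw [hs, ← hz₁.2 i hi]
    exact congrFun (exec_arr (by simp [arrs])) i
  refine ⟨[orc p], orc p, hpath _, h s _ _ hP hzval hreg harr ?_, ?_, ?_⟩
  · exact exec_out (by rfl)
  · refine ⟨hposz, hlast, ?_, ?_, ?_⟩
    · rw [hreg 5 (by omega) (by omega) (by omega)]; exact hA.zero
    · rw [hreg 2 (by omega) (by omega) (by omega)]; exact hbits
    · rw [hreg 2 (by omega) (by omega) (by omega)]
      intro i hi hi'
      simp only [List.length_singleton] at hi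
      exact hA.rest i (by omega) hi'
  · intro i hi
    have : i = 0 := by simpa using hi
    subst this
    simp

end CDS

namespace CDS

open Cmd BitTree

/-! ### Subroutines: sets in arrays, counting neighbours, asking for sets -/

section Subroutines

variable {n : ℕ}

/-- Everything that a command does not write is left unchanged. -/
structure Frame (c : Cmd) (s s' : State) : Prop where
  reg : ∀ {x}, x ∉ c.regs → s'.reg x = s.reg x
  arr : ∀ {a}, a ∉ c.arrs → s'.arr a = s.arr a
  out : c.silent = true → s'.out = s.out

lemma frame_exec (c : Cmd) (s : State) : Frame c s (exec c s) := ⟨exec_reg, exec_arr, exec_out⟩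

/-- With the initial state fixed, what is known about it are ordinary hypotheses, and the tree may
depend on its register contents. -/
lemma Sim.of_forall {α : Type} {P : State → Prop} {c : Cmd} {t : BitTree α}
    {Q : α → State → Prop} (h : ∀ s, P s → Sim (· = s) c t Q) : Sim P c t Q :=
  fun orc p s hP hA => h s hP orc p s rfl hA

/-- States after a question may be assumed to differ from the state before in what is written. -/
lemma Sim.bind' {α β : Type} {c d : Cmd} {t : BitTree α} {f : α → BitTree β} {s : State}
    {Q : α → State → Prop} {R : β → State → Prop} (h : Sim (· = s) c t Q)
    (h' : ∀ a s', Q a s' → Frame c s s' → Sim (· = s') d (f a) R) :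
    Sim (· = s) (c ;; d) (t.bind f) R := by
  refine Sim.bind (Q := fun a s' => Q a s' ∧ Frame c s s') ?_
    fun a => Sim.of_forall fun s' hs' => h' a s' hs'.1 hs'.2
  intro orc p s' hs hA
  subst hs
  obtain ⟨π, a, h1, h2, h3, h4⟩ := h orc p s' rfl hA
  exact ⟨π, a, h1, ⟨h2, frame_exec c s'⟩, h3, h4⟩

lemma Sim.pre' {β : Type} {c d : Cmd} {t : BitTree β} {s : State} {R : β → State → Prop}
    (hc : c.noAsk = true) (h : Sim (· = exec c s) d t R) : Sim (· = s) (c ;; d) t R :=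
  Sim.pre hc (by rintro _ rfl; rfl) h

lemma Sim.pure' {α : Type} {c : Cmd} {s : State} {a : α} {Q : α → State → Prop}
    (hc : c.noAsk = true) (h : Q a (exec c s)) : Sim (· = s) c (.leaf a) Q :=
  Sim.pure hc (by rintro _ rfl; exact h)

lemma Sim.ite' {α : Type} {c d : Cmd} {s : State} {φ : Prop} [Decidable φ] {b : Test}
    {t t' : BitTree α} {Q : α → State → Prop} (hb : b.Holds s ↔ φ) (h : φ → Sim (· = s) c t Q)
    (h' : ¬ φ → Sim (· = s) d t' Q) : Sim (· = s) (.ite b c d) (if φ then t else t') Q :=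
  Sim.ite (by rintro _ rfl; exact hb) h h'

lemma Sim.ite_true {α : Type} {c d : Cmd} {s : State} {b : Test} {t : BitTree α}
    {Q : α → State → Prop} (hb : b.Holds s) (h : Sim (· = s) c t Q) :
    Sim (· = s) (.ite b c d) t Q := by
  rintro orc p s' rfl hA
  rw [exec_ite_of_holds _ hb]
  exact h orc p _ rfl hA

lemma Sim.ite_false {α : Type} {c d : Cmd} {s : State} {b : Test} {t : BitTree α}
    {Q : α → State → Prop} (hb : ¬ b.Holds s) (h : Sim (· = s) d t Q) :
    Sim (· = s) (.ite b c d) t Q := by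
  rintro orc p s' rfl hA
  rw [exec_ite_of_not_holds _ hb]
  exact h orc p _ rfl hA

/-- Stronger rule for invariants of counting loops: what is not written stays unchanged. -/
lemma exec_forn_induction' {i : ℕ} {c : Cmd} {s : State} (hn : s.reg 0 = n)
    (I : ℕ → State → Prop) (hi : i ∉ 0 :: c.regs) (hc : 0 ∉ c.regs)
    (h0 : I 0 (s.setReg i 0))
    (step : ∀ (v : Fin n) st, st.reg i = (v : ℕ) → Frame (forn i c) s st → I v st →
      I (v + 1) ((exec c st).setReg i (v + 1))) :
    I n (exec (forn i c) s) := by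
  have := exec_forn_induction (c := c) (s := s) (i := i)
    (fun k st => I k st ∧ Frame (forn i c) s st) ⟨h0, ?_⟩ hi hc ?_
  · rw [hn] at this; exact this.1
  · refine ⟨fun hx => ?_, fun _ => rfl, fun _ => rfl⟩
    rw [setReg_reg, if_neg]
    simp only [regs, List.mem_cons, not_or] at hx
    exact hx.1
  · intro k st hk hki _ hI
    refine ⟨step ⟨k, hn ▸ hk⟩ st hki hI.2 hI.1, fun {x} hx => ?_, fun ha => ?_, fun hs => ?_⟩
    · rw [setReg_reg, if_neg, exec_reg, hI.2.reg hx]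
      · exact fun h => hx (List.mem_cons_of_mem _ h)
      · exact fun h => hx (h ▸ List.mem_cons_self)
    · rw [setReg_arr, exec_arr (c := c) ha, hI.2.arr ha]
    · rw [setReg_out, exec_out (c := c) hs, hI.2.out hs]

/-- Array `a` holds the characteristic function of `F`. -/
def Rep (s : State) (a : ℕ) (F : Finset (Fin n)) : Prop :=
  ∀ v : Fin n, s.arr a v = if v ∈ F then 1 else 0

lemma Rep.congr {s s' : State} {a : ℕ} {F : Finset (Fin n)} (h : Rep s a F)
    (h' : s'.arr a = s.arr a) : Rep s' a F := fun v => by rw [h']; exact h v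

lemma Rep.frame {s s' : State} {a : ℕ} {F : Finset (Fin n)} {c : Cmd} (h : Rep s a F)
    (hf : Frame c s s') (ha : a ∉ c.arrs) : Rep s' a F := h.congr (hf.arr ha)

open Classical in
/-- The graph and the constants zero and one are in place. -/
structure Env (G : SimpleGraph (Fin n)) (s : State) : Prop where
  size : s.reg 0 = n
  zero : s.reg 5 = 0
  one : s.reg 6 = 1
  adj : ∀ u v : Fin n, s.arr 0 (u * n + v) = if G.Adj u v then 1 else 0

/-- The graph and the constants are not overwritten. -/
def Cmd.keeps (c : Cmd) : Bool :=
  (0 ∉ c.regs : Bool) && (5 ∉ c.regs : Bool) && (6 ∉ c.regs : Bool) && (0 ∉ c.arrs : Bool)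

lemma Env.frame {G : SimpleGraph (Fin n)} {s s' : State} {c : Cmd} (h : Env G s)
    (hf : Frame c s s') (hc : c.keeps = true) : Env G s' := by
  simp only [keeps, Bool.and_eq_true, decide_eq_true_eq] at hc
  obtain ⟨⟨⟨h0, h5⟩, h6⟩, ha⟩ := hc
  exact ⟨(hf.reg h0).trans h.size, (hf.reg h5).trans h.zero, (hf.reg h6).trans h.one,
    fun u v => by rw [hf.arr ha]; exact h.adj u v⟩

lemma Env.exec {G : SimpleGraph (Fin n)} {s : State} {c : Cmd} (h : Env G s)
    (hc : c.keeps = true) : Env G (exec c s) := h.frame (frame_exec c s) hc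

/-- The members of `F` below `k`. -/
def below (F : Finset (Fin n)) (k : ℕ) : Finset (Fin n) := F.filter fun w => (w : ℕ) < k

lemma mem_below {F : Finset (Fin n)} {k : ℕ} {w : Fin n} :
    w ∈ below F k ↔ w ∈ F ∧ (w : ℕ) < k := Finset.mem_filter

@[simp] lemma below_zero (F : Finset (Fin n)) : below F 0 = ∅ := by
  ext w; simp [mem_below]

@[simp] lemma below_self (F : Finset (Fin n)) : below F n = F := by
  ext w; simp [mem_below]

lemma below_succ (F : Finset (Fin n)) (v : Fin n) :
    below F (v + 1) = if v ∈ F then insert v (below F v) else below F v := by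
  ext w
  split_ifs with h <;> simp only [mem_below, Finset.mem_insert]
  · constructor
    · rintro ⟨h1, h2⟩
      by_cases hw : w = v
      · exact Or.inl hw
      · exact Or.inr ⟨h1, by have := Fin.val_ne_of_ne hw; omega⟩
    · rintro (rfl | ⟨h1, h2⟩)
      · exact ⟨h, by omega⟩
      · exact ⟨h1, by omega⟩
  · constructor
    · rintro ⟨h1, h2⟩
      refine ⟨h1, ?_⟩
      have : w ≠ v := fun e => h (e ▸ h1)
      have := Fin.val_ne_of_ne this
      omega
    · rintro ⟨h1, h2⟩
      exact ⟨h1, by omega⟩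

lemma card_below_succ (F : Finset (Fin n)) (v : Fin n) :
    (below F (v + 1)).card = (below F v).card + if v ∈ F then 1 else 0 := by
  rw [below_succ]
  split_ifs
  · rw [Finset.card_insert_of_notMem]
    simp [mem_below]
  · rfl

/-- Write the contents of register `r` to all entries of the array `a`. -/
def fill (a r : ℕ) : Cmd := forn 40 (store a 40 r)

lemma fill_spec {s : State} (hn : s.reg 0 = n) {a r : ℕ} (hr : r ≠ 40) (v : Fin n) :
    (exec (fill a r) s).arr a v = s.reg r := by
  refine exec_forn_induction' hn (fun k st => ∀ v : Fin n, (v : ℕ) < k → st.arr a v = s.reg r)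
    (by simp [regs]) (by simp [regs]) (by simp) ?_ v v.2
  intro w st hw hf hI v hv
  have hreg : st.reg r = s.reg r := hf.reg (by simp [regs, hr])
  simp only [exec_store, setReg_arr, setArr_arr_apply, hw, true_and, hreg]
  split_ifs with h
  · rfl
  · exact hI v (by omega)

lemma rep_fill_empty {G : SimpleGraph (Fin n)} {s : State} (h : Env G s) (a : ℕ) :
    Rep (exec (fill a 5) s) a (∅ : Finset (Fin n)) := fun v => by
  rw [fill_spec h.size (by decide), h.zero]; simp

lemma rep_fill_univ {G : SimpleGraph (Fin n)} {s : State} (h : Env G s) (a : ℕ) :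
    Rep (exec (fill a 6) s) a (Finset.univ : Finset (Fin n)) := fun v => by
  rw [fill_spec h.size (by decide), h.one]; simp

/-- `b[u]` becomes the number of neighbours of `u` in the set `a`. -/
def nbrCount (a b : ℕ) : Cmd :=
  const 22 0 ;;
  forn 20 (const 23 0 ;;
    forn 21 (load 24 0 22 ;;
      ite (.eq 24 6) (load 24 a 21 ;; ite (.eq 24 6) (succ 23) skip) skip ;;
      succ 22) ;;
    store b 20 23)

/-- The machine cannot multiply. Register `22` runs through the adjacency matrix without being reset
between rows, so it always holds `u * n + v`. -/
lemma nbrCount_row {G : SimpleGraph (Fin n)} {s : State} (hs : Env G s) {a : ℕ}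
    {F : Finset (Fin n)} (hF : Rep s a F) {u : Fin n} (h22 : s.reg 22 = u * n)
    (h23 : s.reg 23 = 0) {s' : State}
    (hs' : s' = exec (forn 21 (load 24 0 22 ;;
      ite (.eq 24 6) (load 24 a 21 ;; ite (.eq 24 6) (succ 23) skip) skip ;; succ 22)) s) :
    s'.reg 22 = u * n + n ∧ s'.reg 23 = (nbrs G F u).card := by
  have := exec_forn_induction' (i := 21) (c := load 24 0 22 ;;
      ite (.eq 24 6) (load 24 a 21 ;; ite (.eq 24 6) (succ 23) skip) skip ;; succ 22) hs.size
    (fun k st => st.reg 22 = u * n + k ∧ st.reg 23 = (below (nbrs G F u) k).card)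
    (by simp [regs]) (by simp [regs]) (by simp [h22, h23]) ?_
  · rw [hs']; simpa using this
  intro v st hv hf hI
  have h1 : st.arr 0 = s.arr 0 := hf.arr (by simp [arrs])
  have h2 : st.arr a = s.arr a := hf.arr (by simp [arrs])
  have h6 : st.reg 6 = 1 := (hf.reg (by simp [regs])).trans hs.one
  have hadj := hs.adj u v
  have hv' := hF v
  obtain ⟨hI1, hI2⟩ := hI
  rw [card_below_succ]
  generalize (u : ℕ) * n = m at *
  by_cases hA : G.Adj u v <;> by_cases hvF : v ∈ F <;>
    simp [hv, hI1, hI2, h1, h2, h6, hadj, hv', mem_nbrs, hA, hvF] <;> omega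

lemma nbrCount_spec {G : SimpleGraph (Fin n)} {s : State} (hs : Env G s) {a b : ℕ}
    (hab : a ≠ b) (hb : b ≠ 0) {F : Finset (Fin n)} (hF : Rep s a F) (u : Fin n) :
    (exec (nbrCount a b) s).arr b u = (nbrs G F u).card := by
  rw [nbrCount, exec_seq]
  have hn : (exec (const 22 0) s).reg 0 = n := by simp [hs.size]
  refine (exec_forn_induction' hn (fun k st => st.reg 22 = k * n ∧
    ∀ u : Fin n, (u : ℕ) < k → st.arr b u = (nbrs G F u).card)
    (by simp [regs]) (by simp [regs]) (by simp) ?_).2 u u.2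
  intro w st hw hf hI
  have hst : Env G st := by
    refine (hs.exec (c := const 22 0) (by decide)).frame hf ?_
    simp [keeps, regs, arrs, hb.symm]
  have hFst : Rep st a F := (hF.congr (s' := exec (const 22 0) s) rfl).frame hf
    (by simp [arrs, hab])
  simp only [exec_seq]
  obtain ⟨s', hs'⟩ : ∃ s', s' = exec (forn 21 (load 24 0 22 ;;
      ite (.eq 24 6) (load 24 a 21 ;; ite (.eq 24 6) (succ 23) skip) skip ;; succ 22))
      (exec (const 23 0) st) := ⟨_, rfl⟩
  obtain ⟨g1, g2⟩ := nbrCount_row (hst.exec (c := const 23 0) (by decide))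
    (hFst.congr (s' := exec (const 23 0) st) rfl) (u := w) (by simp [hI.1]) (by simp) hs'
  have h20 : s'.reg 20 = w := by
    rw [hs', exec_reg (by simp [regs])]
    simp [hw]
  have hb' : s'.arr b = st.arr b := by
    rw [hs', exec_arr (by simp [arrs])]
    rfl
  rw [← hs']
  refine ⟨by simp [g1, Nat.succ_mul], fun v hv => ?_⟩
  simp only [exec_store, setReg_arr, setArr_arr_apply, h20, hb', true_and, g2]
  split_ifs with h
  · rw [Fin.ext h]
  · exact hI.2 v (by omega)

/-- Ask for a subset of the set `sel` with at most as many members as register `cap` says, and add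
it to the set `dst`. -/
def askSetCmd (sel dst cap : ℕ) : Cmd :=
  const 32 0 ;;
  forn 30 (load 31 sel 30 ;;
    ite (.eq 31 6) (ite (.lt 32 cap)
      (ask 31 ;; ite (.eq 31 6) (store dst 30 6 ;; succ 32) skip) skip) skip)

lemma sim_askSetCmd {G : SimpleGraph (Fin n)} {s : State} (hs : Env G s) {sel dst cap : ℕ}
    (h1 : sel ≠ dst) (h2 : sel ≠ 1) (h3 : dst ≠ 0) (h4 : dst ≠ 1)
    (h5 : cap ∉ [1, 2, 3, 30, 31, 32]) {F S : Finset (Fin n)} (hF : Rep s sel F)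
    (hS : Rep s dst S) :
    Sim (· = s) (askSetCmd sel dst cap) (askSet F (s.reg cap)) fun T s' => Rep s' dst (S ∪ T) := by
  have hcap : cap ≠ 1 ∧ cap ≠ 2 ∧ cap ≠ 3 ∧ cap ≠ 30 ∧ cap ≠ 31 ∧ cap ≠ 32 := by
    simpa [not_or] using h5
  obtain ⟨c1, c2, c3, c30, c31, c32⟩ := hcap
  refine Sim.pre' (by decide) ?_
  refine (Sim.forn (fun k T st => (Env G st ∧ Rep st sel F ∧ st.reg cap = s.reg cap) ∧
    Rep st dst (S ∪ T) ∧ st.reg 32 = T.card ∧ ∀ w ∈ T, (w : ℕ) < k)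
    (by simp [regs, ask]) (by simp [regs, ask]) ?_ ?_).weaken (fun _ h => h)
      fun T s' h => h.2.1
  · rintro _ rfl
    refine ⟨by simp [hs.size], ⟨?_, ?_, ?_⟩, ?_, ?_, ?_⟩
    · exact (hs.exec (c := const 32 0 ;; const 30 0) (by decide))
    · exact hF.congr rfl
    · simp [c30, c32]
    · rw [Finset.union_empty]; exact hS.congr rfl
    · simp
    · simp
  · intro v T
    refine Sim.of_forall fun st hst => ?_
    obtain ⟨⟨⟨hE, hFs, hc⟩, hR, h32, hlt⟩, h30, hn⟩ := hst
    -- Only earlier vertices have been added, so inserting `v` raises the cardinality that register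
    -- `32` keeps.
    have hvT : v ∉ T := fun h => absurd (hlt v h) (lt_irrefl _)
    refine Sim.pre' (by simp [noAsk, regs, arrs]) ?_
    have hE' := hE.exec (c := load 31 sel 30) (by rfl)
    have hload : (exec (load 31 sel 30) st).reg 31 = if v ∈ F then 1 else 0 := by
      simp [h30, hFs v]
    have hkeep : ∀ st' : State, Env G st' → st'.arr sel = st.arr sel → st'.reg cap = st.reg cap →
        Env G (st'.setReg 30 (v + 1)) ∧ Rep (st'.setReg 30 (v + 1)) sel F ∧
          (st'.setReg 30 (v + 1)).reg cap = s.reg cap := by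
      intro st' h h' h''
      refine ⟨h.exec (c := const 30 (v + 1)) (by simp [keeps, regs, arrs]), hFs.congr h', ?_⟩
      simp [c30, h'', hc]
    have hskip : ∀ st', Frame (load 31 sel 30) st st' → (Env G (st'.setReg 30 (v + 1)) ∧
        Rep (st'.setReg 30 (v + 1)) sel F ∧ (st'.setReg 30 (v + 1)).reg cap = s.reg cap) ∧
        Rep (st'.setReg 30 (v + 1)) dst (S ∪ T) ∧ (st'.setReg 30 (v + 1)).reg 32 = T.card ∧
        ∀ w ∈ T, (w : ℕ) < v + 1 := by
      intro st' hf
      refine ⟨hkeep st' (hE.frame hf (by rfl)) (hf.arr (by simp [arrs]))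
        (hf.reg (by simp [regs, c31])), hR.congr (hf.arr (by simp [arrs])), ?_,
        fun w hw => (hlt w hw).trans (Nat.lt_succ_self _)⟩
      rw [setReg_reg, if_neg (by decide), hf.reg (by simp [regs]), h32]
    have hsk := hskip _ (frame_exec (load 31 sel 30) st)
    by_cases hvF : v ∈ F
    · have : askStep F (s.reg cap) v T = if T.card < s.reg cap then
          node (leaf T) (leaf (insert v T)) else leaf T := by
        simp [askStep, hvF]
      rw [this]
      rw [if_pos hvF] at hload
      refine Sim.ite_true (hload.trans hE'.one.symm) (Sim.ite' ?_ (fun hlt' => ?_)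
        fun _ => Sim.pure' (by rfl) hsk)
      · simp only [Test.Holds]
        rw [exec_reg (by simp [regs]), exec_reg (by simp [regs, c31]), h32, hc]
      -- The node is split into a bare question and a continuation that depends on the answer.
      · show Sim _ _ ((node (leaf false) (leaf true)).bind fun b =>
          cond b (leaf (insert v T)) (leaf T)) _
        refine Sim.bind' (Q := fun b s' => s'.reg 31 = b.toNat)
          (Sim.ask (by decide) (fun _ _ _ _ h _ _ _ => h)) ?_
        intro b s₂ hb hf
        have hf₂ : Frame (load 31 sel 30 ;; ask 31) st s₂ := by
          refine ⟨fun hx => ?_, fun ha => ?_, fun ho => ?_⟩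
          · simp only [regs, List.mem_append, not_or] at hx
            rw [hf.reg hx.2, exec_reg hx.1]
          · simp only [arrs, List.mem_append, not_or] at ha
            rw [hf.arr ha.2, exec_arr ha.1]
          · rw [hf.out (by rfl), exec_out (by rfl)]
        have hE₂ : Env G s₂ := hE.frame hf₂ (by rfl)
        have h32₂ : s₂.reg 32 = T.card := (hf₂.reg (by simp [regs, ask])).trans h32
        have h30₂ : s₂.reg 30 = v := (hf₂.reg (by simp [regs, ask])).trans h30
        have hcap₂ : s₂.reg cap = st.reg cap :=
          hf₂.reg (by simp [regs, ask, c31, c1, c3])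
        have hsel₂ : s₂.arr sel = st.arr sel := hf₂.arr (by simp [arrs, ask, h2])
        have hdst₂ : s₂.arr dst = st.arr dst := hf₂.arr (by simp [arrs, ask, h4])
        cases b
        · refine Sim.pure' (by simp [noAsk, regs, arrs]; exact h4.symm) ?_
          have h0 : ¬ s₂.reg 31 = s₂.reg 6 := by rw [hb, hE₂.one]; simp
          rw [exec_ite_eq, if_neg h0, exec_skip]
          refine ⟨hkeep _ hE₂ hsel₂ hcap₂, hR.congr hdst₂, by simp [h32₂],
            fun w hw => (hlt w hw).trans (Nat.lt_succ_self _)⟩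
        · refine Sim.pure' (by simp [noAsk, regs, arrs]; exact h4.symm) ?_
          have h0 : s₂.reg 31 = s₂.reg 6 := by rw [hb, hE₂.one]; simp
          rw [exec_ite_eq, if_pos h0]
          refine ⟨hkeep _ (hE₂.exec (by simp [keeps, regs, arrs]; exact h3.symm)) ?_ ?_, ?_, ?_, ?_⟩
          · rw [exec_arr (by simp [arrs, h1]), hsel₂]
          · rw [exec_reg (by simp [regs, c32]), hcap₂]
          · intro w
            simp only [exec_seq, exec_store, exec_succ, setReg_arr, setArr_arr_apply, h30₂, hdst₂,
              hE₂.one, true_and, hR w, Finset.mem_union, Finset.mem_insert, ← Fin.ext_iff]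
            by_cases hwv : w = v <;> simp [hwv]
          · simp [h32₂, Finset.card_insert_of_notMem hvT]
          · intro w hw
            rcases Finset.mem_insert.1 hw with rfl | hw
            · omega
            · have := hlt w hw
              omega
    · have : askStep F (s.reg cap) v T = leaf T := by simp [askStep, hvF]
      rw [this]
      rw [if_neg hvF] at hload
      refine Sim.ite_false (fun h0 => ?_) (Sim.pure' (by rfl) hsk)
      rw [Test.Holds, hload, hE'.one] at h0
      simp at h0

end Subroutines

end CDS

namespace CDS

open Cmd BitTree

/-! ### Programs for the pieces of the decoder -/

section DecoderProgram

variable {n : ℕ}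

/-- Counting loops that compute an array entry by entry. -/
lemma exec_forn_map {i : ℕ} {c : Cmd} {s : State} (hn : s.reg 0 = n) {b : ℕ} (g : Fin n → ℕ)
    (hi : i ∉ 0 :: c.regs) (hc : 0 ∉ c.regs)
    (step : ∀ (v : Fin n) st, st.reg i = (v : ℕ) → Frame (forn i c) s st →
      st.arr b v = s.arr b v →
      (exec c st).arr b v = g v ∧ ∀ w : Fin n, w ≠ v → (exec c st).arr b w = st.arr b w)
    (v : Fin n) : (exec (forn i c) s).arr b v = g v := by
  refine (exec_forn_induction' hn (fun k st =>
    (∀ w : Fin n, (w : ℕ) < k → st.arr b w = g w) ∧ ∀ w : Fin n, k ≤ w → st.arr b w = s.arr b w)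
    hi hc (by simp) ?_).1 v v.2
  intro v st hv hf ⟨h1, h2⟩
  obtain ⟨g1, g2⟩ := step v st hv hf (h2 v le_rfl)
  simp only [setReg_arr]
  refine ⟨fun w hw => ?_, fun w hw => ?_⟩
  · by_cases hwv : w = v
    · rw [hwv, g1]
    · rw [g2 w hwv]
      have := Fin.val_ne_of_ne hwv
      exact h1 w (by omega)
  · rw [g2 w (by rintro rfl; omega)]
    exact h2 w (by omega)

/-- The neighbourhood of the centres: from the counts in array `6` compute the set (array `3`), its
complement (array `5`) and its size (register `41`). -/
def splitCmd : Cmd :=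
  const 41 0 ;;
  forn 33 (load 34 6 33 ;;
    ite (.lt 5 34) (store 3 33 6 ;; store 5 33 5 ;; succ 41) (store 3 33 5))

/-- The program only clears entries of array `5`; to obtain the complement it has to start with the
full set. -/
lemma splitCmd_spec {G : SimpleGraph (Fin n)} {s : State} (hs : Env G s) {A : Finset (Fin n)}
    (h5 : Rep s 5 (Finset.univ : Finset (Fin n)))
    (h6 : ∀ u : Fin n, s.arr 6 u = (nbrs G A u).card) :
    Rep (exec splitCmd s) 3 (nbhd G A) ∧ Rep (exec splitCmd s) 5 (nbhd G A)ᶜ ∧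
      (exec splitCmd s).reg 41 = (nbhd G A).card := by
  have hs' := hs.exec (c := const 41 0) (by rfl)
  have hcond : ∀ (v : Fin n) (st : State), st.reg 33 = (v : ℕ) →
      Frame (forn 33 (load 34 6 33 ;; ite (.lt 5 34) (store 3 33 6 ;; store 5 33 5 ;; succ 41)
        (store 3 33 5))) (exec (const 41 0) s) st →
      st.reg 5 = 0 ∧ st.reg 6 = 1 ∧ st.arr 6 v = (nbrs G A v).card ∧
        (v ∈ nbhd G A ↔ 0 < (nbrs G A v).card) := by
    intro v st hv hf
    refine ⟨(hf.reg (by decide)).trans hs'.zero, (hf.reg (by decide)).trans hs'.one, ?_, ?_⟩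
    · rw [hf.arr (by decide)]; exact h6 v
    · simp [nbhd]
  refine ⟨fun v => ?_, fun v => ?_, ?_⟩
  · rw [splitCmd, exec_seq]
    refine exec_forn_map hs'.size (fun v => if v ∈ nbhd G A then 1 else 0) (by decide) (by decide)
      ?_ v
    intro v st hv hf _
    obtain ⟨e5, e6, e, hX⟩ := hcond v st hv hf
    by_cases hv' : 0 < (nbrs G A v).card <;>
      simp [hv, e5, e6, e, hX, hv', ← Fin.ext_iff] <;> intro w hw <;> simp [hw]
  · rw [splitCmd, exec_seq]
    refine exec_forn_map hs'.size (fun v => if v ∈ (nbhd G A)ᶜ then 1 else 0) (by decide)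
      (by decide) ?_ v
    intro v st hv hf hold
    obtain ⟨e5, e6, e, hX⟩ := hcond v st hv hf
    have := h5 v
    simp only [Finset.mem_univ, if_true] at this
    simp only [exec_const, setReg_arr, this] at hold
    by_cases hv' : 0 < (nbrs G A v).card
    · simp [hv, e5, e6, e, hX, hv', ← Fin.ext_iff]
      intro w hw
      simp [hw]
    · simp [hv, e5, e, hX, hv', hold]
  · rw [splitCmd, exec_seq]
    have := exec_forn_induction' (i := 33) (c := load 34 6 33 ;; ite (.lt 5 34)
      (store 3 33 6 ;; store 5 33 5 ;; succ 41) (store 3 33 5)) hs'.size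
      (fun k st => st.reg 41 = (below (nbhd G A) k).card) (by decide) (by decide) (by simp) ?_
    · rw [this]; simp
    intro v st hv hf hI
    obtain ⟨e5, e6, e, hX⟩ := hcond v st hv hf
    rw [card_below_succ]
    by_cases hv' : 0 < (nbrs G A v).card <;> simp [hv, e5, e6, e, hX, hv', hI]

/-- Division by repeated counting. -/
def divCmd (x d out : ℕ) : Cmd :=
  const out 0 ;; const 50 0 ;;
  forn 51 (ite (.lt 51 x) (succ 50 ;; ite (.eq 50 d) (succ out ;; const 50 0) skip) skip)

/-- Among the `n` rounds just the first `s.reg x` are active, hence the minima in the invariant and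
the need for `s.reg x ≤ n`. Register `50` is the remainder so far, `out` the quotient. -/
lemma divCmd_spec {s : State} (hn : s.reg 0 = n) {x d out : ℕ} (hx : s.reg x ≤ n)
    (hd : 0 < s.reg d) (h1 : out ∉ [0, x, d, 50, 51]) (h2 : x ∉ [50, 51]) (h3 : d ∉ [50, 51]) :
    (exec (divCmd x d out) s).reg out = s.reg x / s.reg d := by
  simp only [List.mem_cons, not_or, List.not_mem_nil, not_false_eq_true, and_true] at h1 h2 h3
  obtain ⟨o0, ox, od, o50, o51⟩ := h1
  have hn' : (exec (const 50 0) (exec (const out 0) s)).reg 0 = n := by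
    simp [hn]; omega
  rw [divCmd, exec_seq, exec_seq]
  have := exec_forn_induction' (i := 51) (c := ite (.lt 51 x) (succ 50 ;;
    ite (.eq 50 d) (succ out ;; const 50 0) skip) skip) hn'
    (fun k st => st.reg out = min k (s.reg x) / s.reg d ∧ st.reg 50 = min k (s.reg x) % s.reg d)
    (by simp [regs]; omega) (by simp [regs]; omega) (by simp [o50, o51]) ?_
  · rw [this.1, min_eq_right hx]
  intro v st hv hf ⟨hI1, hI2⟩
  have ex : st.reg x = s.reg x := by
    rw [hf.reg (by simp [regs]; omega)]
    simp [h2.1, Ne.symm ox]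
  have ed : st.reg d = s.reg d := by
    rw [hf.reg (by simp [regs]; omega)]
    simp [h3.1, Ne.symm od]
  by_cases hlt : (v : ℕ) < s.reg x
  · have hm1 : min (v : ℕ) (s.reg x) = v := by omega
    have hm2 : min ((v : ℕ) + 1) (s.reg x) = v + 1 := by omega
    rw [hm1] at hI1 hI2
    rw [hm2]
    have hdm := Nat.div_add_mod (v : ℕ) (s.reg d)
    have hml := Nat.mod_lt (v : ℕ) hd
    by_cases heq : (v : ℕ) % s.reg d + 1 = s.reg d
    · have e1 : ((v : ℕ) + 1) / s.reg d = (v : ℕ) / s.reg d + 1 := by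
        rw [← Nat.add_div_right _ hd]
        have : (v : ℕ) + 1 = s.reg d * ((v : ℕ) / s.reg d + 1) := by rw [Nat.mul_succ]; omega
        have h' : (v : ℕ) + s.reg d = s.reg d * ((v : ℕ) / s.reg d + 1) + (v : ℕ) % s.reg d := by
          rw [Nat.mul_succ]; omega
        rw [this, h', Nat.mul_div_cancel_left _ hd, Nat.mul_add_div hd, Nat.div_eq_of_lt hml]
      have e2 : ((v : ℕ) + 1) % s.reg d = 0 := by
        have : (v : ℕ) + 1 = s.reg d * ((v : ℕ) / s.reg d + 1) := by rw [Nat.mul_succ]; omega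
        rw [this, Nat.mul_mod_right]
      simp [hv, ex, ed, hlt, hI1, hI2, heq, h3.1, o50, o51, e1, e2]
    · have hlt' : (v : ℕ) % s.reg d + 1 < s.reg d := by omega
      have e1 : ((v : ℕ) + 1) / s.reg d = (v : ℕ) / s.reg d := by
        have h' : (v : ℕ) + 1 = s.reg d * ((v : ℕ) / s.reg d) + ((v : ℕ) % s.reg d + 1) := by omega
        rw [h', Nat.mul_add_div hd, Nat.div_eq_of_lt hlt']
        rfl
      have e2 : ((v : ℕ) + 1) % s.reg d = (v : ℕ) % s.reg d + 1 := by
        have h' : (v : ℕ) + 1 = s.reg d * ((v : ℕ) / s.reg d) + ((v : ℕ) % s.reg d + 1) := by omega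
        rw [h', Nat.mul_add_mod, Nat.mod_eq_of_lt hlt']
      simp [hv, ex, ed, hlt, hI1, hI2, heq, h3.1, o50, o51, e1, e2]
  · have hm1 : min (v : ℕ) (s.reg x) = s.reg x := by omega
    have hm2 : min ((v : ℕ) + 1) (s.reg x) = s.reg x := by omega
    rw [hm1] at hI1 hI2
    rw [hm2]
    simp [hv, ex, hlt, hI1, hI2, o51]

/-- The parameters are in the registers `10`, …, `17`. -/
structure HasParams (p : Params) (s : State) : Prop where
  a : s.reg 10 = p.a
  cap : s.reg 11 = p.cap
  ratio : s.reg 12 = p.ratio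
  deg : s.reg 13 = p.deg
  codeg : s.reg 14 = p.codeg
  blk : s.reg 15 = p.blk
  num : s.reg 16 = p.num
  rest : s.reg 17 = p.rest

lemma HasParams.congr {p : Params} {s s' : State} (h : HasParams p s)
    (h' : ∀ x ∈ [10, 11, 12, 13, 14, 15, 16, 17], s'.reg x = s.reg x) : HasParams p s' := by
  simp only [List.mem_cons, List.not_mem_nil, or_false, forall_eq_or_imp, forall_eq] at h'
  obtain ⟨h0, h1, h2, h3, h4, h5, h6, h7⟩ := h'
  exact ⟨h0.trans h.a, h1.trans h.cap, h2.trans h.ratio, h3.trans h.deg, h4.trans h.codeg,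
    h5.trans h.blk, h6.trans h.num, h7.trans h.rest⟩

lemma HasParams.frame {p : Params} {s s' : State} {c : Cmd} (h : HasParams p s)
    (hf : Frame c s s') (hc : ∀ x ∈ [10, 11, 12, 13, 14, 15, 16, 17], x ∉ c.regs) :
    HasParams p s' := h.congr fun x hx => hf.reg (hc x hx)

/-- The set of `lowVertices`, from the counts in the arrays `6` and `7`. -/
def lowCmd : Cmd :=
  forn 35 (load 36 6 35 ;; load 37 7 35 ;; const 38 0 ;;
    ite (.lt 36 13) (ite (.eq 37 5) (const 38 1) skip) skip ;; store 8 35 38)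

lemma lowCmd_spec {G : SimpleGraph (Fin n)} {p : Params} {s : State} (hs : Env G s)
    (hp : HasParams p s) {R T : Finset (Fin n)}
    (h6 : ∀ u : Fin n, s.arr 6 u = (nbrs G R u).card)
    (h7 : ∀ u : Fin n, s.arr 7 u = (nbrs G T u).card) :
    Rep (exec lowCmd s) 8 (lowVertices G p R T) := by
  refine exec_forn_map hs.size _ (by decide) (by decide) ?_
  intro v st hv hf _
  have e5 : st.reg 5 = 0 := (hf.reg (by decide)).trans hs.zero
  have e13 : st.reg 13 = p.deg := (hf.reg (by decide)).trans hp.deg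
  have e6 : st.arr 6 v = (nbrs G R v).card := by rw [hf.arr (by decide)]; exact h6 v
  have e7 : st.arr 7 v = (nbrs G T v).card := by rw [hf.arr (by decide)]; exact h7 v
  have hmem : v ∈ lowVertices G p R T ↔ (nbrs G R v).card < p.deg ∧ (nbrs G T v).card = 0 := by
    simp [lowVertices]
  by_cases h1 : (nbrs G R v).card < p.deg <;> by_cases h2 : (nbrs G T v).card = 0 <;>
    simp [hv, e5, e13, e6, e7, h1, h2, hmem, ← Fin.ext_iff] <;> intro w hw <;> simp [hw]

/-- The set of `hubs` (array `9`), which is removed from the set in array `5`. -/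
def hubCmd : Cmd :=
  forn 35 (load 36 6 35 ;; load 37 5 35 ;; const 38 0 ;;
    ite (.lt 14 36) (copy 38 37) skip ;; store 9 35 38 ;; ite (.eq 38 6) (store 5 35 5) skip)

lemma hubCmd_spec {G : SimpleGraph (Fin n)} {p : Params} {s : State} (hs : Env G s)
    (hp : HasParams p s) {R Q : Finset (Fin n)} (h5 : Rep s 5 R)
    (h6 : ∀ u : Fin n, s.arr 6 u = (nbrs G Q u).card) :
    Rep (exec hubCmd s) 9 (hubs G p R Q) ∧ Rep (exec hubCmd s) 5 (R \ hubs G p R Q) := by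
  have key : ∀ (v : Fin n) (st : State), Frame hubCmd s st → st.reg 5 = 0 ∧ st.reg 6 = 1 ∧
      st.reg 14 = p.codeg ∧ st.arr 6 v = (nbrs G Q v).card ∧
      (v ∈ hubs G p R Q ↔ v ∈ R ∧ p.codeg < (nbrs G Q v).card) := by
    intro v st hf
    refine ⟨(hf.reg (by decide)).trans hs.zero, (hf.reg (by decide)).trans hs.one,
      (hf.reg (by decide)).trans hp.codeg, ?_, by simp [hubs]⟩
    rw [hf.arr (by decide)]; exact h6 v
  have h5' : Rep (exec hubCmd s) 5 (R \ hubs G p R Q) := by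
    refine exec_forn_map hs.size _ (by decide) (by decide) ?_
    intro v st hv hf hold
    obtain ⟨e5, e6, e14, e, hmem⟩ := key v st hf
    rw [h5 v] at hold
    by_cases h1 : v ∈ R <;> by_cases h2 : p.codeg < (nbrs G Q v).card <;>
      simp [hv, e5, e6, e14, e, hold, h1, h2, hmem, ← Fin.ext_iff]
    intro w hw
    simp [hw]
  refine ⟨?_, h5'⟩
  -- The two arrays have to be followed together: the test at `v` reads the entry of array `5` that
  -- the same round may clear.
  have h9 := exec_forn_induction' (i := 35) (c := load 36 6 35 ;; load 37 5 35 ;; const 38 0 ;;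
    ite (.lt 14 36) (copy 38 37) skip ;; store 9 35 38 ;; ite (.eq 38 6) (store 5 35 5) skip)
    hs.size (fun k st => (∀ w : Fin n, (w : ℕ) < k →
        st.arr 9 w = if w ∈ hubs G p R Q then 1 else 0) ∧
      ∀ w : Fin n, k ≤ w → st.arr 5 w = if w ∈ R then 1 else 0) (by decide) (by decide)
      ⟨by simp, fun w _ => h5 w⟩ ?_
  · exact fun v => h9.1 v v.2
  intro v st hv hf ⟨hI1, hI2⟩
  obtain ⟨e5, e6, e14, e, hmem⟩ := key v st hf
  have hold := hI2 v le_rfl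
  have hne : ∀ w : Fin n, w ≠ v → (w : ℕ) ≠ v := fun w => Fin.val_ne_of_ne
  constructor
  · intro w hw
    by_cases hwv : w = v
    · subst hwv
      by_cases h1 : w ∈ R <;> by_cases h2 : p.codeg < (nbrs G Q w).card <;>
        simp [hv, e5, e6, e14, e, hold, h1, h2, hmem]
    · have := hI1 w (by have := hne w hwv; omega)
      by_cases h1 : v ∈ R <;> by_cases h2 : p.codeg < (nbrs G Q v).card <;>
        simp [hv, e5, e6, e14, e, hold, h1, h2, this, hne w hwv]
  · intro w hw
    have := hI2 w (by omega)
    have hwv : (w : ℕ) ≠ v := by omega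
    by_cases h1 : v ∈ R <;> by_cases h2 : p.codeg < (nbrs G Q v).card <;>
      simp [hv, e5, e6, e14, e, hold, h1, h2, this, hwv]

/-- Ask for a nonempty set of neighbours (array `11`) in the set in array `5`; register `45` holds
the number of these neighbours. -/
def blockCmd : Cmd :=
  forn 48 (load 49 11 48 ;;
    ite (.eq 49 6) (load 49 5 48 ;;
      ite (.eq 49 6) (store 5 48 5 ;; pred 45 ;; const 49 0 ;;
        ite (.eq 45 5) (ite (.eq 46 5) (const 49 1) skip) skip ;;
        ite (.eq 49 6) (store 4 48 6 ;; const 46 1)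
          (ask 49 ;; ite (.eq 49 6) (store 4 48 6 ;; const 46 1) skip)) skip) skip)

/-- Register `45` counts the block vertices not yet considered, register `46` tells whether one has
been chosen. If the count reaches zero with nothing chosen, the vertex is added without asking. -/
lemma sim_blockCmd {G : SimpleGraph (Fin n)} {s : State} (hs : Env G s) {u : Fin n}
    {R S : Finset (Fin n)}
    (h11 : ∀ v : Fin n, s.arr 11 v = (nbrs G {u} v).card)
    (h5 : Rep s 5 R) (h4 : Rep s 4 S) (h45 : s.reg 45 = (nbrs G R u).card) (h46 : s.reg 46 = 0) :
    Sim (· = s) blockCmd (askBlock (nbrs G R u)) fun T s' =>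
      Rep s' 5 (R \ nbrs G R u) ∧ Rep s' 4 (S ∪ T.1) := by
  classical
  set B := nbrs G R u with hB
  have hrow : ∀ v : Fin n, (nbrs G {u} v).card = if G.Adj u v then 1 else 0 := by
    intro v
    by_cases h : G.Adj u v
    · have : nbrs G {u} v = {u} := by
        ext w; simp only [mem_nbrs, Finset.mem_singleton]
        exact ⟨fun h => h.1, fun e => ⟨e, e ▸ h.symm⟩⟩
      simp [this, h]
    · have : nbrs G {u} v = ∅ := by
        ext w; simp only [mem_nbrs, Finset.mem_singleton, Finset.notMem_empty, iff_false, not_and]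
        rintro rfl h'; exact h h'.symm
      simp [this, h]
  refine (Sim.forn (fun k (Tc : Finset (Fin n) × ℕ) st => (Env G st ∧
      ∀ v : Fin n, st.arr 11 v = if G.Adj u v then 1 else 0) ∧ Rep st 5 (R \ below B k) ∧
    Rep st 4 (S ∪ Tc.1) ∧ st.reg 45 = Tc.2 ∧ st.reg 46 = if Tc.1 = ∅ then 0 else 1)
    (by decide) (by decide) ?_ ?_).weaken (fun _ h => h) fun T s' h => ⟨?_, h.2.2.1⟩
  · rintro _ rfl
    refine ⟨hs.size, ⟨hs.exec (c := const 48 0) (by rfl), fun v => ?_⟩, ?_, ?_, ?_, ?_⟩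
    · rw [setReg_arr, h11, hrow]
    · rw [below_zero, Finset.sdiff_empty]; exact h5.congr rfl
    · rw [Finset.union_empty]; exact h4.congr rfl
    · simp [h45]
    · simp [h46]
  · intro v ⟨T, c⟩
    refine Sim.of_forall fun st hst => ?_
    obtain ⟨⟨⟨hE, hN⟩, hR, hS, hc, hf46⟩, h48, hn⟩ := hst
    simp only at hR hS hc hf46
    have hskip : ∀ st', Frame (load 49 11 48) st st' → v ∉ B →
        (Env G (st'.setReg 48 (v + 1)) ∧
          ∀ w : Fin n, (st'.setReg 48 (v + 1)).arr 11 w = if G.Adj u w then 1 else 0) ∧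
        Rep (st'.setReg 48 (v + 1)) 5 (R \ below B (v + 1)) ∧
        Rep (st'.setReg 48 (v + 1)) 4 (S ∪ T) ∧ (st'.setReg 48 (v + 1)).reg 45 = c ∧
        (st'.setReg 48 (v + 1)).reg 46 = if T = ∅ then 0 else 1 := by
      intro st' hf hvB
      refine ⟨⟨(hE.frame hf (by rfl)).exec (c := const 48 (v + 1)) (by rfl), fun w => ?_⟩, ?_, ?_,
        ?_, ?_⟩
      · rw [setReg_arr, hf.arr (by decide)]; exact hN w
      · rw [below_succ, if_neg hvB]; exact hR.congr (hf.arr (by decide))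
      · exact hS.congr (hf.arr (by decide))
      · rw [setReg_reg, if_neg (by decide), hf.reg (by decide), hc]
      · rw [setReg_reg, if_neg (by decide), hf.reg (by decide), hf46]
    -- Array `5` loses the block during the loop, but the entry of `v` is not cleared before round
    -- `v`, so membership in the block can still be read off.
    have hvR : st.arr 5 v = if v ∈ R then 1 else 0 := by
      have : v ∉ below B v := by simp [mem_below]
      rw [hR v]
      simp [this]
    by_cases hvB : v ∈ B
    · obtain ⟨hvR', hadj⟩ := mem_nbrs.1 hvB
      rw [if_pos hvR'] at hvR
      have hrowv : st.arr 11 v = 1 := by rw [hN v, if_pos hadj]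
      have e : blockStep B v (T, c) = if c - 1 = 0 ∧ T = ∅ then leaf (insert v T, c - 1)
          else node (leaf (T, c - 1)) (leaf (insert v T, c - 1)) := by
        simp [blockStep, hvB]
      rw [e]
      refine Sim.pre' (by rfl) (Sim.ite_true (by simp [Test.Holds, h48, hrowv, hE.one])
        (Sim.pre' (by rfl) (Sim.ite_true (by simp [Test.Holds, h48, hvR, hE.one]) ?_)))
      refine Sim.pre' (by rfl) (Sim.pre' (by rfl) (Sim.pre' (by rfl) (Sim.pre' (by rfl) ?_)))
      obtain ⟨s₁, hs₁⟩ : ∃ s₁, s₁ = exec (load 49 11 48 ;; load 49 5 48 ;; store 5 48 5 ;; pred 45 ;;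
        const 49 0 ;; ite (.eq 45 5) (ite (.eq 46 5) (const 49 1) skip) skip) st := ⟨_, rfl⟩
      have hfr : Frame (load 49 11 48 ;; load 49 5 48 ;; store 5 48 5 ;; pred 45 ;;
        const 49 0 ;; ite (.eq 45 5) (ite (.eq 46 5) (const 49 1) skip) skip) st s₁ :=
        hs₁ ▸ frame_exec _ _
      simp only [exec_seq] at hs₁
      rw [← hs₁]
      have hE₁ : Env G s₁ := hE.frame hfr (by rfl)
      have h45₁ : s₁.reg 45 = c - 1 := by
        rw [hs₁]
        simp only [exec_load, exec_store, exec_pred, exec_const, exec_ite_eq, exec_skip]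
        split_ifs <;> simp [hc]
      have h46₁ : s₁.reg 46 = if T = ∅ then 0 else 1 := (hfr.reg (by decide)).trans hf46
      have h48₁ : s₁.reg 48 = v := (hfr.reg (by decide)).trans h48
      have h49₁ : s₁.reg 49 = if c - 1 = 0 ∧ T = ∅ then 1 else 0 := by
        rw [hs₁]
        by_cases hT : T = ∅ <;> by_cases hc1 : c - 1 = 0 <;>
          simp [hc, hE.zero, hf46, hT, hc1]
      have h5₁ : Rep s₁ 5 (R \ below B (v + 1)) := by
        intro w
        have harr : s₁.arr 5 w = if w = v then 0 else st.arr 5 w := by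
          rw [hs₁]
          simp only [exec_load, exec_store, exec_pred, exec_const, exec_ite_eq, exec_skip]
          split_ifs <;> simp_all [Fin.ext_iff, hE.zero]
        rw [harr, below_succ, if_pos hvB, hR w]
        by_cases hwv : w = v <;> simp [hwv]
      have h4₁ : s₁.arr 4 = st.arr 4 := hfr.arr (by decide)
      have h11₁ : s₁.arr 11 = st.arr 11 := hfr.arr (by decide)
      have hhit : ∀ s₂, (∀ x ∉ [1, 3, 49], s₂.reg x = s₁.reg x) → (∀ a ≠ 1, s₂.arr a = s₁.arr a) →
          (Env G ((exec (store 4 48 6 ;; const 46 1) s₂).setReg 48 (v + 1)) ∧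
          ∀ w : Fin n, ((exec (store 4 48 6 ;; const 46 1) s₂).setReg 48 (v + 1)).arr 11 w =
            if G.Adj u w then 1 else 0) ∧
          Rep ((exec (store 4 48 6 ;; const 46 1) s₂).setReg 48 (v + 1)) 5
            (R \ below B (v + 1)) ∧
          Rep ((exec (store 4 48 6 ;; const 46 1) s₂).setReg 48 (v + 1)) 4 (S ∪ insert v T) ∧
          ((exec (store 4 48 6 ;; const 46 1) s₂).setReg 48 (v + 1)).reg 45 = c - 1 ∧
          ((exec (store 4 48 6 ;; const 46 1) s₂).setReg 48 (v + 1)).reg 46 =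
            if insert v T = ∅ then 0 else 1 := by
        intro s₂ hr ha
        have hE₂ : Env G s₂ := ⟨(hr 0 (by decide)).trans hE₁.size, (hr 5 (by decide)).trans hE₁.zero,
          (hr 6 (by decide)).trans hE₁.one, by rw [ha 0 (by decide)]; exact hE₁.adj⟩
        refine ⟨⟨(hE₂.exec (c := store 4 48 6 ;; const 46 1) (by rfl)).exec
          (c := const 48 (v + 1)) (by rfl), fun w => ?_⟩, ?_, ?_, ?_, ?_⟩
        · simp [ha 11, h11₁, hN w]
        · intro w
          simp [ha 5, h5₁ w]
        · intro w
          simp only [exec_seq, exec_store, exec_const, setReg_arr, setArr_arr_apply,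
            ha 4 (by decide), h4₁, hr 48 (by decide), h48₁, hE₂.one, hS w, true_and,
            Finset.mem_union, Finset.mem_insert, ← Fin.ext_iff]
          by_cases hwv : w = v <;> simp [hwv]
        · simp [hr 45, h45₁]
        · simp
      refine Sim.ite' ?_ (fun hφ => Sim.pure' (by rfl) (hhit s₁ (fun _ _ => rfl) fun _ _ => rfl))
        fun hφ => ?_
      · rw [Test.Holds, h49₁, hE₁.one]
        split_ifs with h <;> simp [h]
      · show Sim _ _ ((node (leaf false) (leaf true)).bind fun b =>
          cond b (leaf (insert v T, c - 1)) (leaf (T, c - 1))) _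
        refine Sim.bind' (Q := fun b s₂ => s₂.reg 49 = b.toNat ∧
          (∀ x ∉ [1, 3, 49], s₂.reg x = s₁.reg x) ∧ ∀ a ≠ 1, s₂.arr a = s₁.arr a)
          (Sim.ask (by decide) ?_) ?_
        · rintro _ s' b rfl hz hr ha _
          refine ⟨hz, fun x hx => ?_, ha⟩
          simp only [List.mem_cons, not_or] at hx
          exact hr x hx.2.2.1 hx.1 hx.2.1
        · rintro b s₂ ⟨hz, hr, ha⟩ -
          have h6₂ : s₂.reg 6 = 1 := (hr 6 (by decide)).trans hE₁.one
          cases b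
          · refine Sim.ite_false ?_ (Sim.pure' (by rfl) ?_)
            · rw [Test.Holds, hz, h6₂]; simp
            · have hE₂ : Env G s₂ := ⟨(hr 0 (by decide)).trans hE₁.size,
                (hr 5 (by decide)).trans hE₁.zero, h6₂,
                by rw [ha 0 (by decide)]; exact hE₁.adj⟩
              refine ⟨⟨hE₂.exec (c := const 48 (v + 1)) (by rfl), fun w => ?_⟩, ?_, ?_, ?_, ?_⟩
              · simp [ha 11, h11₁, hN w]
              · exact h5₁.congr (ha 5 (by decide))
              · exact hS.congr ((ha 4 (by decide)).trans h4₁)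
              · simp [hr 45, h45₁]
              · simp [hr 46, h46₁]
          · refine Sim.ite_true ?_ (Sim.pure' (by rfl) (hhit s₂ hr ha))
            rw [Test.Holds, hz, h6₂]; rfl
    · have e : blockStep B v (T, c) = leaf (T, c) := by simp [blockStep, hvB]
      rw [e]
      refine Sim.pre' (by rfl) ?_
      by_cases hadj : G.Adj u v
      · have hrowv : st.arr 11 v = 1 := by rw [hN v, if_pos hadj]
        have hvR' : v ∉ R := fun h => hvB (mem_nbrs.2 ⟨h, hadj⟩)
        rw [if_neg hvR'] at hvR
        refine Sim.ite_true (by simp [Test.Holds, h48, hrowv, hE.one]) (Sim.pre' (by rfl)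
          (Sim.ite_false (by simp [Test.Holds, h48, hvR, hE.one]) (Sim.pure' (by rfl) ?_)))
        refine hskip _ ⟨fun hx => ?_, fun _ => rfl, fun _ => rfl⟩ hvB
        simp only [regs, List.mem_singleton] at hx
        simp [hx]
      · have hrowv : st.arr 11 v = 0 := by rw [hN v, if_neg hadj]
        exact Sim.ite_false (by simp [Test.Holds, h48, hrowv, hE.one])
          (Sim.pure' (by rfl) (hskip _ (frame_exec _ _) hvB))
  · have := h.2.1
    rwa [below_self] at this

end DecoderProgram

end CDS

namespace CDS

open Cmd BitTree

/-! ### The program of the decoder -/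

section DecoderCommand

variable {n : ℕ}

/-- For the vertex in register `44`: its row (array `11`), the number of its undecided neighbours
(register `45`) and of its neighbours in the current set (register `46`). -/
def selectPrep : Cmd :=
  fill 10 5 ;; store 10 44 6 ;; nbrCount 10 11 ;; nbrCount 5 6 ;; nbrCount 4 7 ;;
    load 45 6 44 ;; load 46 7 44

/-- The step of the selection of blocks for the vertex in register `44`. -/
def selectCmd : Cmd :=
  selectPrep ;; ite (.lt 43 16) (ite (.eq 46 5) (ite (.lt 5 45) (ite (.lt 45 15)
    (succ 43 ;; blockCmd) skip) skip) skip) skip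

/-- The row of `u` in the adjacency matrix starts at an index that is a product. It is obtained
instead as the array of neighbour counts for the singleton `{u}`. -/
lemma selectPrep_spec {G : SimpleGraph (Fin n)} {s : State} (hs : Env G s) {u : Fin n}
    (h44 : s.reg 44 = u) {R S : Finset (Fin n)} (h5 : Rep s 5 R) (h4 : Rep s 4 S) :
    (∀ v : Fin n, (exec selectPrep s).arr 11 v = (nbrs G {u} v).card) ∧
      (exec selectPrep s).reg 45 = (nbrs G R u).card ∧
      (exec selectPrep s).reg 46 = (nbrs G S u).card := by
  obtain ⟨s₁, hs₁⟩ : ∃ s₁, s₁ = exec (fill 10 5 ;; store 10 44 6) s := ⟨_, rfl⟩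
  obtain ⟨s₂, hs₂⟩ : ∃ s₂, s₂ = exec (nbrCount 10 11) s₁ := ⟨_, rfl⟩
  obtain ⟨s₃, hs₃⟩ : ∃ s₃, s₃ = exec (nbrCount 5 6) s₂ := ⟨_, rfl⟩
  obtain ⟨s₄, hs₄⟩ : ∃ s₄, s₄ = exec (nbrCount 4 7) s₃ := ⟨_, rfl⟩
  have hs' : exec selectPrep s = exec (load 45 6 44 ;; load 46 7 44) s₄ := by
    rw [hs₄, hs₃, hs₂, hs₁]; rfl
  have f₁ : Frame _ s s₁ := hs₁ ▸ frame_exec _ _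
  have f₂ : Frame _ s₁ s₂ := hs₂ ▸ frame_exec _ _
  have f₃ : Frame _ s₂ s₃ := hs₃ ▸ frame_exec _ _
  have f₄ : Frame _ s₃ s₄ := hs₄ ▸ frame_exec _ _
  have E₁ := hs.frame f₁ (by rfl)
  have E₂ := E₁.frame f₂ (by rfl)
  have E₃ := E₂.frame f₃ (by rfl)
  have r10 : Rep s₁ 10 ({u} : Finset (Fin n)) := by
    intro v
    have h44' : (exec (fill 10 5) s).reg 44 = u := (exec_reg (by decide)).trans h44
    have h6' : (exec (fill 10 5) s).reg 6 = 1 := (exec_reg (by decide)).trans hs.one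
    rw [hs₁]
    simp only [exec_seq, exec_store, setArr_arr_apply, h44', h6', true_and,
      fill_spec hs.size (show 5 ≠ 40 by decide) v, hs.zero, Finset.mem_singleton, Fin.ext_iff]
  have a11 : ∀ v : Fin n, s₂.arr 11 v = (nbrs G {u} v).card := fun v => by
    rw [hs₂]; exact nbrCount_spec E₁ (by decide) (by decide) r10 v
  have a6 : ∀ v : Fin n, s₃.arr 6 v = (nbrs G R v).card := fun v => by
    rw [hs₃]
    exact nbrCount_spec E₂ (by decide) (by decide)
      ((h5.frame f₁ (by decide)).frame f₂ (by decide)) v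
  have a7 : ∀ v : Fin n, s₄.arr 7 v = (nbrs G S v).card := fun v => by
    rw [hs₄]
    exact nbrCount_spec E₃ (by decide) (by decide)
      (((h4.frame f₁ (by decide)).frame f₂ (by decide)).frame f₃ (by decide)) v
  have r44 : s₄.reg 44 = u := by
    rw [f₄.reg (by decide), f₃.reg (by decide), f₂.reg (by decide), f₁.reg (by decide), h44]
  rw [hs']
  refine ⟨fun v => ?_, ?_, ?_⟩
  · simp only [exec_seq, exec_load, setReg_arr]
    rw [f₄.arr (by decide), f₃.arr (by decide), a11]
  · simp [r44, f₄.arr (show 6 ∉ _ by decide), a6]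
  · simp [r44, a7]

/-- What the state holds during the selection of blocks. -/
structure SelectInv (G : SimpleGraph (Fin n)) (p : Params)
    (x : Finset (Fin n) × Finset (Fin n) × ℕ) (s : State) : Prop where
  env : Env G s
  params : HasParams p s
  undecided : Rep s 5 x.1
  current : Rep s 4 x.2.1
  count : s.reg 43 = x.2.2

lemma SelectInv.setReg {G : SimpleGraph (Fin n)} {p : Params}
    {x : Finset (Fin n) × Finset (Fin n) × ℕ} {s : State} (h : SelectInv G p x s) (k : ℕ) :
    SelectInv G p x (s.setReg 44 k) :=
  ⟨h.env.exec (c := const 44 k) (by rfl), h.params.frame (frame_exec (const 44 k) s)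
    (by simp [regs]), h.undecided.congr rfl, h.current.congr rfl, by simp [h.count]⟩

lemma sim_selectCmd {G : SimpleGraph (Fin n)} {p : Params} {s : State} {u : Fin n}
    {x : Finset (Fin n) × Finset (Fin n) × ℕ} (h : SelectInv G p x s) (h44 : s.reg 44 = u) :
    Sim (· = s) selectCmd (selectStep G p u x) (SelectInv G p) := by
  obtain ⟨R, S, m⟩ := x
  obtain ⟨a11, r45, r46⟩ := selectPrep_spec h.env h44 h.undecided h.current
  simp only at r45 r46
  obtain ⟨s₁, hs₁⟩ : ∃ s₁, s₁ = exec selectPrep s := ⟨_, rfl⟩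
  rw [selectCmd]
  refine Sim.pre' (by rfl) ?_
  rw [← hs₁] at a11 r45 r46 ⊢
  have f₁ : Frame _ s s₁ := hs₁ ▸ frame_exec _ _
  have hI : SelectInv G p (R, S, m) s₁ := ⟨h.env.frame f₁ (by rfl),
    h.params.frame f₁ (by decide), h.undecided.frame f₁ (by decide),
    h.current.frame f₁ (by decide), (f₁.reg (by decide)).trans h.count⟩
  have hskip : ¬ (m < p.num ∧ (nbrs G S u).card = 0 ∧ 0 < (nbrs G R u).card ∧
      (nbrs G R u).card < p.blk) → Sim (· = s₁) skip (selectStep G p u (R, S, m))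
        (SelectInv G p) := by
    intro hn
    rw [selectStep, if_neg hn]
    exact Sim.pure' (by rfl) hI
  by_cases c1 : m < p.num
  swap
  · exact Sim.ite_false (by rw [Test.Holds, hI.count, hI.params.num]; exact c1)
      (hskip fun hh => c1 hh.1)
  refine Sim.ite_true (by rw [Test.Holds, hI.count, hI.params.num]; exact c1) ?_
  by_cases c2 : (nbrs G S u).card = 0
  swap
  · exact Sim.ite_false (by rw [Test.Holds, r46, hI.env.zero]; exact c2)
      (hskip fun hh => c2 hh.2.1)
  refine Sim.ite_true (by rw [Test.Holds, r46, hI.env.zero]; exact c2) ?_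
  by_cases c3 : 0 < (nbrs G R u).card
  swap
  · exact Sim.ite_false (by rw [Test.Holds, r45, hI.env.zero]; exact c3)
      (hskip fun hh => c3 hh.2.2.1)
  refine Sim.ite_true (by rw [Test.Holds, r45, hI.env.zero]; exact c3) ?_
  by_cases c4 : (nbrs G R u).card < p.blk
  swap
  · exact Sim.ite_false (by rw [Test.Holds, r45, hI.params.blk]; exact c4)
      (hskip fun hh => c4 hh.2.2.2)
  refine Sim.ite_true (by rw [Test.Holds, r45, hI.params.blk]; exact c4) ?_
  rw [selectStep, if_pos ⟨c1, c2, c3, c4⟩]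
  refine Sim.pre' (by rfl) ?_
  have f₂ := frame_exec (succ 43) s₁
  have hblock := sim_blockCmd (G := G) (s := exec (succ 43) s₁) (hI.env.frame f₂ (by rfl)) a11
    (hI.undecided.frame f₂ (by decide)) (hI.current.frame f₂ (by decide))
    ((f₂.reg (by decide)).trans r45) ((f₂.reg (by decide)).trans (r46.trans c2))
  intro orc q s' hs' hA
  obtain ⟨π, T, g1, g2, g3, g4⟩ := hblock orc q s' hs' hA
  subst hs'
  have f₃ := frame_exec blockCmd (exec (succ 43) s₁)
  refine ⟨π, (R \ nbrs G R u, S ∪ T.1, m + 1), ?_, ?_, g3, g4⟩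
  · have := g1.bind (f := fun T => leaf (R \ nbrs G R u, S ∪ T.1, m + 1)) (.leaf _)
    rwa [List.append_nil] at this
  exact ⟨(hI.env.frame f₂ (by rfl)).frame f₃ (by rfl),
    (hI.params.frame f₂ (by decide)).frame f₃ (by decide), g2.1, g2.2, by
      rw [f₃.reg (by decide)]; simp [hI.count]⟩

/-- The sets `lowVertices` and `hubs`. -/
def lowPrep : Cmd := nbrCount 5 6 ;; nbrCount 4 7 ;; lowCmd ;; nbrCount 8 6 ;; hubCmd

lemma lowPrep_spec {G : SimpleGraph (Fin n)} {p : Params} {s : State} (hs : Env G s)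
    (hp : HasParams p s) {R T : Finset (Fin n)} (h5 : Rep s 5 R) (h4 : Rep s 4 T) :
    Rep (exec lowPrep s) 9 (hubs G p R (lowVertices G p R T)) ∧
      Rep (exec lowPrep s) 5 (R \ hubs G p R (lowVertices G p R T)) := by
  obtain ⟨s₁, hs₁⟩ : ∃ s₁, s₁ = exec (nbrCount 5 6) s := ⟨_, rfl⟩
  obtain ⟨s₂, hs₂⟩ : ∃ s₂, s₂ = exec (nbrCount 4 7) s₁ := ⟨_, rfl⟩
  obtain ⟨s₃, hs₃⟩ : ∃ s₃, s₃ = exec lowCmd s₂ := ⟨_, rfl⟩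
  obtain ⟨s₄, hs₄⟩ : ∃ s₄, s₄ = exec (nbrCount 8 6) s₃ := ⟨_, rfl⟩
  have hs' : exec lowPrep s = exec hubCmd s₄ := by
    rw [hs₄, hs₃, hs₂, hs₁]; rfl
  have f₁ : Frame _ s s₁ := hs₁ ▸ frame_exec _ _
  have f₂ : Frame _ s₁ s₂ := hs₂ ▸ frame_exec _ _
  have f₃ : Frame _ s₂ s₃ := hs₃ ▸ frame_exec _ _
  have f₄ : Frame _ s₃ s₄ := hs₄ ▸ frame_exec _ _
  have E₁ := hs.frame f₁ (by rfl)
  have E₂ := E₁.frame f₂ (by rfl)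
  have E₃ := E₂.frame f₃ (by rfl)
  have E₄ := E₃.frame f₄ (by rfl)
  have p₂ := (hp.frame f₁ (by decide)).frame f₂ (by decide)
  have p₄ := (p₂.frame f₃ (by decide)).frame f₄ (by decide)
  have a6 : ∀ v : Fin n, s₂.arr 6 v = (nbrs G R v).card := fun v => by
    rw [f₂.arr (by decide), hs₁]
    exact nbrCount_spec hs (by decide) (by decide) h5 v
  have a7 : ∀ v : Fin n, s₂.arr 7 v = (nbrs G T v).card := fun v => by
    rw [hs₂]
    exact nbrCount_spec E₁ (by decide) (by decide) (h4.frame f₁ (by decide)) v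
  have r8 : Rep s₃ 8 (lowVertices G p R T) := hs₃ ▸ lowCmd_spec E₂ p₂ a6 a7
  have a6' : ∀ v : Fin n, s₄.arr 6 v = (nbrs G (lowVertices G p R T) v).card := fun v => by
    rw [hs₄]
    exact nbrCount_spec E₃ (by decide) (by decide) r8 v
  rw [hs']
  exact hubCmd_spec E₄ p₄ ((((h5.frame f₁ (by decide)).frame f₂ (by decide)).frame f₃
    (by decide)).frame f₄ (by decide)) a6'

/-- The program for `decodeLow`. -/
def lowPart : Cmd :=
  lowPrep ;; askSetCmd 9 4 0 ;; const 43 0 ;; forn 44 selectCmd ;;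
    ite (.lt 43 16) (const 18 0) (const 18 1)

/-- What the state holds when `decodeStart` is finished. -/
structure StartInv (x : Finset (Fin n) × Finset (Fin n) × Bool) (s : State) : Prop where
  undecided : Rep s 5 x.1
  current : Rep s 4 x.2.1
  flag : s.reg 18 = x.2.2.toNat

lemma sim_lowPart {G : SimpleGraph (Fin n)} {p : Params} {s : State} (hs : Env G s)
    (hp : HasParams p s) {R T : Finset (Fin n)} (h5 : Rep s 5 R) (h4 : Rep s 4 T) :
    Sim (· = s) lowPart (decodeLow G p R T) StartInv := by
  obtain ⟨r9, r5⟩ := lowPrep_spec hs hp h5 h4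
  obtain ⟨s₁, hs₁⟩ : ∃ s₁, s₁ = exec lowPrep s := ⟨_, rfl⟩
  rw [lowPart, decodeLow]
  refine Sim.pre' (by rfl) ?_
  rw [← hs₁] at r9 r5 ⊢
  have f₁ : Frame _ s s₁ := hs₁ ▸ frame_exec _ _
  have E₁ := hs.frame f₁ (by rfl)
  -- Register `0` holds `n`, so this capacity is no restriction.
  have hask := sim_askSetCmd (cap := 0) E₁ (show 9 ≠ 4 by decide) (by decide) (by decide)
    (by decide) (by decide) r9 (h4.frame f₁ (by decide))
  rw [E₁.size] at hask
  refine Sim.bind' hask ?_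
  intro T' s₂ h4₂ f₂
  refine Sim.pre' (by rfl) ?_
  have f₃ := frame_exec (const 43 0) s₂
  have hI : SelectInv G p (R \ hubs G p R (lowVertices G p R T), T ∪ T', 0)
      (exec (const 43 0) s₂) :=
    ⟨(E₁.frame f₂ (by rfl)).frame f₃ (by rfl),
      ((hp.frame f₁ (by decide)).frame f₂ (by decide)).frame f₃ (by decide),
      (r5.frame f₂ (by decide)).frame f₃ (by decide), h4₂.frame f₃ (by decide), by simp⟩
  refine Sim.bind (Sim.forn (fun _ => SelectInv G p) (by decide) (by decide) ?_ ?_) ?_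
  · rintro _ rfl
    exact ⟨hI.env.size, hI.setReg 0⟩
  · intro v x
    exact Sim.of_forall fun st hst => (sim_selectCmd hst.1 hst.2.1).weaken (fun _ h => h)
      fun x' s' h => h.setReg _
  · intro x
    refine Sim.of_forall fun st hst => Sim.pure' (by rfl) ⟨?_, ?_, ?_⟩
    · exact hst.undecided.frame (frame_exec _ _) (by decide)
    · exact hst.current.frame (frame_exec _ _) (by decide)
    · by_cases h : x.2.2 < p.num <;> simp [hst.count, hst.params.num, h]

/-- Initialization of the decoder: nothing is decided. -/
def startPrep : Cmd := fill 4 5 ;; fill 2 5 ;; fill 5 6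

lemma startPrep_spec {G : SimpleGraph (Fin n)} {s : State} (hs : Env G s) :
    Rep (exec startPrep s) 4 (∅ : Finset (Fin n)) ∧ Rep (exec startPrep s) 2 (∅ : Finset (Fin n)) ∧
      Rep (exec startPrep s) 5 (Finset.univ : Finset (Fin n)) := by
  have E₁ := hs.exec (c := fill 4 5) (by rfl)
  have E₂ := E₁.exec (c := fill 2 5) (by rfl)
  refine ⟨?_, ?_, rep_fill_univ E₂ 5⟩
  · exact ((rep_fill_empty hs 4).frame (frame_exec (fill 2 5) _) (by decide)).frame
      (frame_exec (fill 5 6) _) (by decide)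
  · exact (rep_fill_empty E₁ 2).frame (frame_exec (fill 5 6) _) (by decide)

/-- The program for `decodeStart`. -/
def startCmd : Cmd :=
  startPrep ;; askSetCmd 5 2 10 ;; nbrCount 2 6 ;; splitCmd ;; askSetCmd 3 4 11 ;;
    divCmd 41 12 42 ;; ite (.lt 42 10) lowPart (const 18 1)

lemma sim_startCmd {G : SimpleGraph (Fin n)} {p : Params} {s : State} (hs : Env G s)
    (hp : HasParams p s) (hr : 0 < p.ratio) :
    Sim (· = s) startCmd (decodeStart G p) StartInv := by
  obtain ⟨r4, r2, r5⟩ := startPrep_spec hs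
  obtain ⟨s₁, hs₁⟩ : ∃ s₁, s₁ = exec startPrep s := ⟨_, rfl⟩
  rw [startCmd, decodeStart]
  refine Sim.pre' (by rfl) ?_
  rw [← hs₁] at r4 r2 r5 ⊢
  have f₁ : Frame _ s s₁ := hs₁ ▸ frame_exec _ _
  have E₁ := hs.frame f₁ (by rfl)
  have p₁ := hp.frame f₁ (by decide)
  have hask := sim_askSetCmd (cap := 10) E₁ (show 5 ≠ 2 by decide) (by decide) (by decide)
    (by decide) (by decide) r5 r2
  rw [p₁.a] at hask
  refine Sim.bind' hask ?_
  intro A s₂ h2₂ f₂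
  rw [Finset.empty_union] at h2₂
  have E₂ := E₁.frame f₂ (by rfl)
  have p₂ := p₁.frame f₂ (by decide)
  refine Sim.pre' (by rfl) (Sim.pre' (by rfl) ?_)
  obtain ⟨s₃, hs₃⟩ : ∃ s₃, s₃ = exec (nbrCount 2 6) s₂ := ⟨_, rfl⟩
  obtain ⟨s₄, hs₄⟩ : ∃ s₄, s₄ = exec splitCmd s₃ := ⟨_, rfl⟩
  rw [← hs₃, ← hs₄]
  have f₃ : Frame _ s₂ s₃ := hs₃ ▸ frame_exec _ _
  have f₄ : Frame _ s₃ s₄ := hs₄ ▸ frame_exec _ _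
  have E₃ := E₂.frame f₃ (by rfl)
  have E₄ := E₃.frame f₄ (by rfl)
  have p₄ := (p₂.frame f₃ (by decide)).frame f₄ (by decide)
  have a6 : ∀ v : Fin n, s₃.arr 6 v = (nbrs G A v).card := fun v => by
    rw [hs₃]
    exact nbrCount_spec E₂ (by decide) (by decide) h2₂ v
  obtain ⟨q3, q5, q41⟩ := splitCmd_spec E₃ ((r5.frame f₂ (by decide)).frame f₃ (by decide)) a6
  rw [← hs₄] at q3 q5 q41
  have r4₄ : Rep s₄ 4 (∅ : Finset (Fin n)) :=
    ((r4.frame f₂ (by decide)).frame f₃ (by decide)).frame f₄ (by decide)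
  have hask := sim_askSetCmd (cap := 11) E₄ (show 3 ≠ 4 by decide) (by decide) (by decide)
    (by decide) (by decide) q3 r4₄
  rw [p₄.cap] at hask
  refine Sim.bind' hask ?_
  intro T s₅ h4₅ f₅
  rw [Finset.empty_union] at h4₅
  have E₅ := E₄.frame f₅ (by rfl)
  have p₅ := p₄.frame f₅ (by decide)
  have r41 : s₅.reg 41 = (nbhd G A).card := (f₅.reg (by decide)).trans q41
  refine Sim.pre' (by rfl) ?_
  have f₆ := frame_exec (divCmd 41 12 42) s₅
  have hdiv := divCmd_spec E₅.size (x := 41) (d := 12) (out := 42)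
    (by rw [r41]; exact (Finset.card_le_univ _).trans_eq (Fintype.card_fin n))
    (by rw [p₅.ratio]; exact hr) (by decide) (by decide) (by decide)
  rw [r41, p₅.ratio] at hdiv
  have p₆ := p₅.frame f₆ (by decide)
  refine Sim.ite' (by rw [Test.Holds, hdiv, p₆.a]) (fun _ => ?_) fun _ => Sim.pure' (by rfl) ?_
  · exact sim_lowPart (E₅.frame f₆ (by rfl)) p₆ ((q5.frame f₅ (by decide)).frame f₆ (by decide))
      (h4₅.frame f₆ (by decide))
  · have f₇ := frame_exec (const 18 1) (exec (divCmd 41 12 42) s₅)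
    exact ⟨((q5.frame f₅ (by decide)).frame f₆ (by decide)).frame f₇ (by decide),
      (h4₅.frame f₆ (by decide)).frame f₇ (by decide), by simp⟩

/-- The program for `decode`. -/
def decodeCmd : Cmd := startCmd ;; ite (.eq 18 6) (askSetCmd 5 4 17 ;; skip) skip

lemma sim_decodeCmd {G : SimpleGraph (Fin n)} {p : Params} {s : State} (hs : Env G s)
    (hp : HasParams p s) (hr : 0 < p.ratio) :
    Sim (· = s) decodeCmd (decode G p) fun S s' => Rep s' 4 S := by
  refine Sim.bind' (sim_startCmd hs hp hr) ?_
  rintro ⟨R, S, b⟩ s₁ ⟨h5, h4, h18⟩ f₁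
  have E₁ := hs.frame f₁ (by rfl)
  have p₁ := hp.frame f₁ (by decide)
  refine Sim.ite' ?_ (fun _ => ?_) fun _ => Sim.pure' (by rfl) h4
  · rw [Test.Holds, h18, E₁.one]
    cases b <;> simp
  · have hask := sim_askSetCmd (cap := 17) E₁ (show 5 ≠ 4 by decide) (by decide) (by decide)
      (by decide) (by decide) h5 h4
    rw [p₁.rest] at hask
    exact Sim.bind_pure hask (by rfl) fun _ _ h => h

end DecoderCommand

end CDS

namespace CDS

open Cmd BitTree

/-! ### Fractions of n as parameters, and the combined search -/

section Search

variable {n : ℕ}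

/-- The counter is increased before it is compared with zero, so the quotient never grows. This
matches `n / 0 = 0`, by which a parameter zero stands for the bound zero. -/
lemma divCmd_zero {s : State} (hn : s.reg 0 = n) {x d out : ℕ} (hd : s.reg d = 0)
    (h1 : out ∉ [0, x, d, 50, 51]) (h3 : d ∉ [50, 51]) :
    (exec (divCmd x d out) s).reg out = 0 := by
  simp only [List.mem_cons, not_or, List.not_mem_nil, not_false_eq_true, and_true] at h1 h3
  obtain ⟨o0, ox, od, o50, o51⟩ := h1
  have hn' : (exec (const 50 0) (exec (const out 0) s)).reg 0 = n := by
    simp [hn]; omega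
  rw [divCmd, exec_seq, exec_seq]
  refine exec_forn_induction' (i := 51) (c := ite (.lt 51 x) (succ 50 ;;
    ite (.eq 50 d) (succ out ;; const 50 0) skip) skip) hn' (fun _ st => st.reg out = 0)
    (by simp [regs]; omega) (by simp [regs]; omega) (by simp [o50, o51]) ?_
  intro v st hv hf hI
  have ed : st.reg d = 0 := by
    rw [hf.reg (by simp [regs]; omega)]
    simp [h3.1, Ne.symm od, hd]
  by_cases hlt : (v : ℕ) < st.reg x <;> simp [hv, ed, hlt, hI, h3.1, o50, o51]

/-- The parameters for graphs on `n` vertices, some of which are fractions of `n`. -/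
def Params.scale (m : Params) (n : ℕ) : Params :=
  ⟨n / m.a, n / m.cap, m.ratio, m.deg, m.codeg, m.blk, n / m.num, n / m.rest⟩

/-- `out` becomes the integral part of the `q`-th part of `n`. -/
def fracCmd (q out : ℕ) : Cmd := const 60 q ;; divCmd 0 60 out

lemma fracCmd_spec {s : State} (hn : s.reg 0 = n) {q out : ℕ} (h : out ∉ [0, 60, 50, 51]) :
    (exec (fracCmd q out) s).reg out = n / q := by
  have hn' : (exec (const 60 q) s).reg 0 = n := by simp [hn]
  simp only [List.mem_cons, not_or, List.not_mem_nil, not_false_eq_true, and_true] at h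
  rcases Nat.eq_zero_or_pos q with rfl | hq
  · rw [fracCmd, exec_seq, divCmd_zero hn' (by simp) (by simp; tauto) (by decide), Nat.div_zero]
  · rw [fracCmd, exec_seq, divCmd_spec hn' (by simp [hn]) (by simpa) (by simp; tauto) (by decide)
      (by decide)]
    simp [hn]

/-- Write the parameters to the registers `10`, …, `17`. -/
def setParams (m : Params) : Cmd :=
  fracCmd m.a 10 ;; fracCmd m.cap 11 ;; fracCmd m.num 16 ;; fracCmd m.rest 17 ;;
    const 12 m.ratio ;; const 13 m.deg ;; const 14 m.codeg ;; const 15 m.blk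

lemma setParams_spec {s : State} (hn : s.reg 0 = n) (m : Params) :
    HasParams (m.scale n) (exec (setParams m) s) := by
  obtain ⟨s₁, hs₁⟩ : ∃ s₁, s₁ = exec (fracCmd m.a 10) s := ⟨_, rfl⟩
  obtain ⟨s₂, hs₂⟩ : ∃ s₂, s₂ = exec (fracCmd m.cap 11) s₁ := ⟨_, rfl⟩
  obtain ⟨s₃, hs₃⟩ : ∃ s₃, s₃ = exec (fracCmd m.num 16) s₂ := ⟨_, rfl⟩
  obtain ⟨s₄, hs₄⟩ : ∃ s₄, s₄ = exec (fracCmd m.rest 17) s₃ := ⟨_, rfl⟩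
  have hs' : exec (setParams m) s = exec (const 12 m.ratio ;; const 13 m.deg ;;
      const 14 m.codeg ;; const 15 m.blk) s₄ := by
    rw [hs₄, hs₃, hs₂, hs₁]; rfl
  have f₂ : Frame _ s₁ s₂ := hs₂ ▸ frame_exec _ _
  have f₃ : Frame _ s₂ s₃ := hs₃ ▸ frame_exec _ _
  have f₄ : Frame _ s₃ s₄ := hs₄ ▸ frame_exec _ _
  have n₁ : s₁.reg 0 = n := by rw [hs₁, exec_reg (by simp [fracCmd, divCmd, regs])]; exact hn
  have n₂ : s₂.reg 0 = n := (f₂.reg (by simp [fracCmd, divCmd, regs])).trans n₁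
  have n₃ : s₃.reg 0 = n := (f₃.reg (by simp [fracCmd, divCmd, regs])).trans n₂
  have r10 : s₄.reg 10 = n / m.a := by
    rw [f₄.reg (by simp [fracCmd, divCmd, regs]), f₃.reg (by simp [fracCmd, divCmd, regs]),
      f₂.reg (by simp [fracCmd, divCmd, regs]), hs₁, fracCmd_spec hn (by decide)]
  have r11 : s₄.reg 11 = n / m.cap := by
    rw [f₄.reg (by simp [fracCmd, divCmd, regs]), f₃.reg (by simp [fracCmd, divCmd, regs]), hs₂,
      fracCmd_spec n₁ (by decide)]
  have r16 : s₄.reg 16 = n / m.num := by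
    rw [f₄.reg (by simp [fracCmd, divCmd, regs]), hs₃, fracCmd_spec n₂ (by decide)]
  have r17 : s₄.reg 17 = n / m.rest := by rw [hs₄, fracCmd_spec n₃ (by decide)]
  rw [hs']
  constructor <;> simp [Params.scale, r10, r11, r16, r17]

/-- The decoder with the parameters `m`. -/
def modeCmd (m : Params) : Cmd := setParams m ;; decodeCmd

lemma sim_modeCmd {G : SimpleGraph (Fin n)} {s : State} (hs : Env G s) {m : Params}
    (hr : 0 < m.ratio) :
    Sim (· = s) (modeCmd m) (decode G (m.scale n)) fun S s' => Rep s' 4 S := by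
  refine Sim.pre' (by rfl) ?_
  exact sim_decodeCmd (hs.exec (by rfl)) (setParams_spec hs.size m) hr

/-- Four decoders; the first one is used for graphs on less than `N` vertices. -/
structure Modes where
  N : ℕ
  small : Params
  few : Params
  wide : Params
  narrow : Params

/-- The ratios are positive. -/
structure Modes.Pos (M : Modes) : Prop where
  small : 0 < M.small.ratio
  few : 0 < M.few.ratio
  wide : 0 < M.wide.ratio
  narrow : 0 < M.narrow.ratio

/-- Run the first decoder on small graphs, and otherwise one of the other three. -/
noncomputable def search (M : Modes) (G : SimpleGraph (Fin n)) : BitTree (Finset (Fin n)) :=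
  if n < M.N then decode G (M.small.scale n) else
    node (decode G (M.few.scale n)) (node (decode G (M.wide.scale n)) (decode G (M.narrow.scale n)))

/-- The program for `search`. -/
def searchCmd (M : Modes) : Cmd :=
  const 60 M.N ;; ite (.lt 0 60) (modeCmd M.small)
    (ask 60 ;; ite (.eq 60 6) (ask 60 ;; ite (.eq 60 6) (modeCmd M.narrow) (modeCmd M.wide))
      (modeCmd M.few))

lemma sim_ask_ite {α : Type} {G : SimpleGraph (Fin n)} {s : State} (hs : Env G s) {c d : Cmd}
    {t t' : BitTree α} {Q : α → State → Prop} (hc : ∀ s', Env G s' → Sim (· = s') c t Q)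
    (hd : ∀ s', Env G s' → Sim (· = s') d t' Q) :
    Sim (· = s) (ask 60 ;; ite (.eq 60 6) c d) (node t' t) Q := by
  show Sim _ _ ((node (leaf false) (leaf true)).bind fun b => cond b t t') _
  refine Sim.bind' (Q := fun b s' => s'.reg 60 = b.toNat)
    (Sim.ask (by decide) (fun _ _ _ _ h _ _ _ => h)) ?_
  intro b s' hb hf
  have E := hs.frame hf (by rfl)
  cases b
  · exact Sim.ite_false (by rw [Test.Holds, hb, E.one]; simp) (hd s' E)
  · exact Sim.ite_true (by rw [Test.Holds, hb, E.one]; rfl) (hc s' E)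

lemma sim_searchCmd {G : SimpleGraph (Fin n)} {s : State} (hs : Env G s) {M : Modes}
    (hM : M.Pos) : Sim (· = s) (searchCmd M) (search M G) fun S s' => Rep s' 4 S := by
  have E := hs.exec (c := const 60 M.N) (by rfl)
  refine Sim.pre' (by rfl) (Sim.ite' ?_ (fun _ => sim_modeCmd E hM.small) fun _ => ?_)
  · rw [Test.Holds, E.size]; simp
  · exact sim_ask_ite E (fun s' h' => sim_ask_ite h' (fun _ h => sim_modeCmd h hM.narrow)
      fun _ h => sim_modeCmd h hM.wide) fun s' h => sim_modeCmd h hM.few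

end Search

/-! ### Testing for minimal connected dominating sets -/

section Check

variable {n : ℕ}

/-- Add the vertices of `S` with a neighbour in `B`. -/
noncomputable def reachStep (G : SimpleGraph (Fin n)) (S B : Finset (Fin n)) : Finset (Fin n) :=
  B ∪ S.filter fun v => 0 < (nbrs G B v).card

lemma mem_reachStep {G : SimpleGraph (Fin n)} {S B : Finset (Fin n)} {v : Fin n} :
    v ∈ reachStep G S B ↔ v ∈ B ∨ v ∈ S ∧ 0 < (nbrs G B v).card := by
  simp [reachStep]

/-- The vertices of `S` at distance at most `k` from `r`. -/
noncomputable def reach (G : SimpleGraph (Fin n)) (S : Finset (Fin n)) (r : Fin n) (k : ℕ) :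
    Finset (Fin n) :=
  (reachStep G S)^[k] {r}

lemma reach_succ (G : SimpleGraph (Fin n)) (S : Finset (Fin n)) (r : Fin n) (k : ℕ) :
    reach G S r (k + 1) = reachStep G S (reach G S r k) := Function.iterate_succ_apply' _ _ _

/-- The sets grow strictly until they become stationary, and they cannot exceed `n` vertices. -/
lemma reachStep_reach (G : SimpleGraph (Fin n)) (S : Finset (Fin n)) (r : Fin n) :
    reachStep G S (reach G S r n) = reach G S r n := by
  have key : ∀ k, reachStep G S (reach G S r k) = reach G S r k ∨
      k + 1 ≤ (reach G S r k).card := by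
    intro k
    induction k with
    | zero => right; simp [reach]
    | succ k ih =>
      by_cases h : reachStep G S (reach G S r k) = reach G S r k
      · left; rw [reach_succ, h, h]
      · right
        have h1 := ih.resolve_left h
        have h2 : reach G S r k ⊂ reach G S r (k + 1) := by
          rw [reach_succ]
          exact Finset.ssubset_iff_subset_ne.2 ⟨Finset.subset_union_left, Ne.symm h⟩
        have := Finset.card_lt_card h2
        omega
  refine (key n).resolve_right fun h => ?_
  have := (Finset.card_le_univ (reach G S r n)).trans_eq (Fintype.card_fin n)
  omega

/-- The vertices reached from `r` form the least closed set containing `r`. A closed set that avoids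
`r` has a closed complement in `S`, which contains all of them. -/
lemma connected_iff_subset_reach (G : SimpleGraph (Fin n)) {S : Finset (Fin n)} {r : Fin n}
    (hr : r ∈ S) : (G.induce (S : Set (Fin n))).Connected ↔ S ⊆ reach G S r n := by
  have hcl : ClosedIn G S (reach G S r n) := by
    intro x hx y hy hxy
    rw [← reachStep_reach, mem_reachStep]
    exact Or.inr ⟨hy, Finset.card_pos.2 ⟨x, mem_nbrs.2 ⟨hx, hxy.symm⟩⟩⟩
  have hmin : ∀ B, r ∈ B → ClosedIn G S B → ∀ k, reach G S r k ⊆ B := by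
    intro B hB hc k
    induction k with
    | zero => simpa [reach] using hB
    | succ k ih =>
      intro v hv
      rw [reach_succ, mem_reachStep] at hv
      rcases hv with hv | ⟨hv, hc'⟩
      · exact ih hv
      · obtain ⟨x, hx⟩ := Finset.card_pos.1 hc'
        obtain ⟨hx, hvx⟩ := mem_nbrs.1 hx
        exact hc x (ih hx) v hv hvx.symm
  have hrS : ∀ k, r ∈ reach G S r k := by
    intro k
    induction k with
    | zero => simp [reach]
    | succ k ih => rw [reach_succ, mem_reachStep]; exact Or.inl ih
  have hsub := hmin S hr (fun x _ y hy _ => hy) n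
  rw [induce_connected_iff]
  constructor
  · rintro ⟨-, h⟩
    exact (h _ hsub ⟨r, hrS n⟩ hcl).symm.subset
  · intro h
    refine ⟨⟨r, hr⟩, fun B hB ⟨b, hb⟩ hc => ?_⟩
    by_cases hrB : r ∈ B
    · exact Finset.Subset.antisymm hB (h.trans (hmin B hrB hc n))
    · have := hmin (S \ B) (Finset.mem_sdiff.2 ⟨hr, hrB⟩) (fun x hx y hy hxy => by
        rw [Finset.mem_sdiff] at hx ⊢
        exact ⟨hy, fun hyB => hx.2 (hc y hyB x hx.1 hxy.symm)⟩) n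
      exact absurd hb (Finset.mem_sdiff.1 (this (h (hB hb)))).2

/-- Register `73` becomes a member of the set `a`, register `70` tells whether there is one. -/
def pickCmd (a : ℕ) : Cmd :=
  const 70 0 ;; const 73 0 ;;
    forn 71 (load 72 a 71 ;; ite (.eq 72 6) (copy 73 71 ;; const 70 1) skip)

lemma pickCmd_spec {G : SimpleGraph (Fin n)} {s : State} (hs : Env G s) {a : ℕ}
    {S : Finset (Fin n)} (h : Rep s a S) :
    ((exec (pickCmd a) s).reg 70 = 0 ∧ S = ∅) ∨
      (exec (pickCmd a) s).reg 70 = 1 ∧ ∃ r ∈ S, (exec (pickCmd a) s).reg 73 = r := by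
  rw [pickCmd, exec_seq, exec_seq]
  have E := (hs.exec (c := const 70 0) (by rfl)).exec (c := const 73 0) (by rfl)
  have := exec_forn_induction' (i := 71)
    (c := load 72 a 71 ;; ite (.eq 72 6) (copy 73 71 ;; const 70 1) skip) E.size
    (fun k st => (st.reg 70 = 0 ∧ below S k = ∅) ∨ st.reg 70 = 1 ∧ ∃ r ∈ S, st.reg 73 = r)
    (by simp [regs]) (by simp [regs]) (Or.inl (by simp)) ?_
  · simpa using this
  intro v st hv hf hI
  have h6 : st.reg 6 = 1 := (hf.reg (by simp [regs])).trans E.one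
  have ha : st.arr a v = if v ∈ S then 1 else 0 := by
    rw [hf.arr (by simp [arrs])]; exact h v
  by_cases hvS : v ∈ S
  · right
    rw [if_pos hvS] at ha
    simp only [exec_seq, exec_load, exec_ite_eq, setReg_reg, if_true, hv, ha, h6]
    simp only [show (6 : ℕ) ≠ 72 by decide, if_false, if_true]
    exact ⟨by simp, v, hvS, by simp [hv]⟩
  · rw [if_neg hvS] at ha
    rw [below_succ, if_neg hvS]
    simpa [hv, ha, h6] using hI

/-- One step of the search in the set `a`, from the vertices in array `12`. -/
def roundCmd (a : ℕ) : Cmd :=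
  nbrCount 12 6 ;; forn 71 (load 72 6 71 ;;
    ite (.lt 5 72) (load 72 a 71 ;; ite (.eq 72 6) (store 12 71 6) skip) skip)

lemma roundCmd_spec {G : SimpleGraph (Fin n)} {s : State} (hs : Env G s) {a : ℕ} (ha : a ≠ 6)
    (ha' : a ≠ 12) {S B : Finset (Fin n)} (h : Rep s a S) (hB : Rep s 12 B) :
    Rep (exec (roundCmd a) s) 12 (reachStep G S B) := by
  have E := hs.exec (c := nbrCount 12 6) (by rfl)
  have a6 := nbrCount_spec (b := 6) hs (by decide) (by decide) hB
  have f := frame_exec (nbrCount 12 6) s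
  rw [roundCmd, exec_seq]
  refine exec_forn_map E.size _ (by simp [regs]) (by simp [regs]) ?_
  intro v st hv hf hold
  have e5 : st.reg 5 = 0 := (hf.reg (by simp [regs])).trans E.zero
  have e6 : st.reg 6 = 1 := (hf.reg (by simp [regs])).trans E.one
  have ea : st.arr a v = if v ∈ S then 1 else 0 := by
    rw [hf.arr (by simp [arrs, ha']), f.arr (by simp [arrs, nbrCount, ha])]; exact h v
  have ec : st.arr 6 v = (nbrs G B v).card := by
    rw [hf.arr (by simp [arrs])]; exact a6 v
  rw [f.arr (by decide), hB v] at hold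
  have hm := mem_reachStep (G := G) (S := S) (B := B) (v := v)
  by_cases h1 : 0 < (nbrs G B v).card <;> by_cases h2 : v ∈ S <;>
    simp [hv, e5, e6, ea, ec, hold, h1, h2, hm, ← Fin.ext_iff]
  intro w hw
  simp [hw]

/-- Array `12` becomes the set of vertices that can be reached from the vertex in register `73`. -/
def reachCmd (a : ℕ) : Cmd := fill 12 5 ;; store 12 73 6 ;; forn 76 (roundCmd a)

lemma reachCmd_spec {G : SimpleGraph (Fin n)} {s : State} (hs : Env G s) {a : ℕ} (ha : a ≠ 6)
    (ha' : a ≠ 12) {S : Finset (Fin n)} (h : Rep s a S) {r : Fin n} (hr : s.reg 73 = r) :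
    Rep (exec (reachCmd a) s) 12 (reach G S r n) := by
  have f₁ := frame_exec (fill 12 5 ;; store 12 73 6) s
  have E := hs.frame f₁ (by rfl)
  have r0 : Rep (exec (fill 12 5 ;; store 12 73 6) s) 12 (reach G S r 0) := by
    intro v
    have h73 : (exec (fill 12 5) s).reg 73 = r := (exec_reg (by decide)).trans hr
    have h6 : (exec (fill 12 5) s).reg 6 = 1 := (exec_reg (by decide)).trans hs.one
    simp only [exec_seq, exec_store, setArr_arr_apply, h73, h6, true_and,
      fill_spec hs.size (show 5 ≠ 40 by decide) v, hs.zero, reach, Function.iterate_zero, id,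
      Finset.mem_singleton, Fin.ext_iff]
  have hS : Rep (exec (fill 12 5 ;; store 12 73 6) s) a S := h.frame f₁ (by simp [arrs, fill, ha'])
  show Rep (exec (forn 76 (roundCmd a)) (exec (fill 12 5 ;; store 12 73 6) s)) _ _
  refine exec_forn_induction' E.size (fun k st => Rep st 12 (reach G S r k))
    (by simp [regs, roundCmd, nbrCount]) (by simp [regs, roundCmd, nbrCount]) (r0.congr rfl) ?_
  intro v st hv hf hI
  rw [reach_succ]
  exact (roundCmd_spec (E.frame hf (by rfl)) ha ha'
    (hS.frame hf (by simp [arrs, roundCmd, nbrCount, ha, ha'])) hI).congr rfl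

/-- Register `70` is set to zero if the set `a` is not dominating or not contained in the set in
array `12`. -/
def judgeCmd (a : ℕ) : Cmd :=
  nbrCount a 7 ;; forn 71 (load 72 a 71 ;; load 74 12 71 ;; load 78 7 71 ;;
    ite (.eq 72 6) (ite (.eq 74 6) skip (const 70 0)) (ite (.eq 78 5) (const 70 0) skip))

open Classical in
lemma judgeCmd_spec {G : SimpleGraph (Fin n)} {s : State} (hs : Env G s) {a : ℕ} (ha : a ≠ 7)
    {S B : Finset (Fin n)} (h : Rep s a S) (hB : Rep s 12 B) :
    (exec (judgeCmd a) s).reg 70 = if IsDominating G S ∧ S ⊆ B then s.reg 70 else 0 := by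
  have E := hs.exec (c := nbrCount a 7) (by rfl)
  have a7 := nbrCount_spec (b := 7) hs ha (by decide) h
  have f := frame_exec (nbrCount a 7) s
  rw [judgeCmd, exec_seq]
  obtain ⟨φ, hφ⟩ : ∃ φ : ℕ → Prop, ∀ k, φ k ↔ ∀ v : Fin n, (v : ℕ) < k →
      (v ∈ S ∧ v ∈ B) ∨ (v ∉ S ∧ (nbrs G S v).card ≠ 0) := ⟨_, fun _ => Iff.rfl⟩
  have := exec_forn_induction' (i := 71) (c := load 72 a 71 ;; load 74 12 71 ;; load 78 7 71 ;;
    ite (.eq 72 6) (ite (.eq 74 6) skip (const 70 0)) (ite (.eq 78 5) (const 70 0) skip)) E.size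
    (fun k st => st.reg 70 = if φ k then s.reg 70 else 0)
    (by simp [regs]) (by simp [regs])
    (by simp [hφ, f.reg (show 70 ∉ _ by simp [nbrCount, regs])]) ?_
  · rw [this]
    congr 1
    rw [eq_iff_iff, hφ]
    have hcard : ∀ v : Fin n, (nbrs G S v).card ≠ 0 ↔ ∃ u ∈ S, G.Adj v u := by
      intro v
      rw [Finset.card_ne_zero]
      exact ⟨fun ⟨u, hu⟩ => ⟨u, mem_nbrs.1 hu⟩, fun ⟨u, hu⟩ => ⟨u, mem_nbrs.2 hu⟩⟩
    constructor
    · intro h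
      refine ⟨fun v hv => ?_, fun v hv => ?_⟩
      · rcases h v v.2 with h | h
        · exact absurd h.1 hv
        · exact (hcard v).1 h.2
      · rcases h v v.2 with h | h
        · exact h.2
        · exact absurd hv h.1
    · rintro ⟨hd, hs⟩ v -
      by_cases hv : v ∈ S
      · exact Or.inl ⟨hv, hs hv⟩
      · exact Or.inr ⟨hv, (hcard v).2 (hd v hv)⟩
  intro v st hv hf hI
  have e5 : st.reg 5 = 0 := (hf.reg (by simp [regs])).trans E.zero
  have e6 : st.reg 6 = 1 := (hf.reg (by simp [regs])).trans E.one
  have ea : st.arr a v = if v ∈ S then 1 else 0 := by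
    rw [hf.arr (by simp [arrs]), f.arr (by simp [arrs, nbrCount, ha])]; exact h v
  have eB : st.arr 12 v = if v ∈ B then 1 else 0 := by
    rw [hf.arr (by simp [arrs]), f.arr (by simp [arrs, nbrCount])]; exact hB v
  have ec : st.arr 7 v = (nbrs G S v).card := by
    rw [hf.arr (by simp [arrs])]; exact a7 v
  have hsplit : φ (v + 1) ↔ φ v ∧ ((v ∈ S ∧ v ∈ B) ∨ (v ∉ S ∧ (nbrs G S v).card ≠ 0)) := by
    rw [hφ, hφ]
    constructor
    · exact fun h => ⟨fun w hw => h w (by omega), h v (by omega)⟩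
    · rintro ⟨h1, h2⟩ w hw
      by_cases hwv : w = v
      · rw [hwv]; exact h2
      · have := Fin.val_ne_of_ne hwv
        exact h1 w (by omega)
  simp only [hsplit]
  by_cases h1 : v ∈ S
  · by_cases h2 : v ∈ B <;> simp [hv, e6, ea, eB, h1, h2, hI]
  · by_cases h2 : (nbrs G S v).card = 0 <;> simp [hv, e5, e6, ea, ec, h1, h2, hI]

/-- Register `70` tells whether the set `a` is a connected dominating set. -/
def checkCmd (a : ℕ) : Cmd := pickCmd a ;; reachCmd a ;; judgeCmd a

open Classical in
lemma checkCmd_spec {G : SimpleGraph (Fin n)} {s : State} (hs : Env G s) {a : ℕ}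
    (ha : a ∉ [6, 7, 12]) {S : Finset (Fin n)} (h : Rep s a S) :
    (exec (checkCmd a) s).reg 70 = if IsConnectedDominating G S then 1 else 0 := by
  simp only [List.mem_cons, not_or, List.not_mem_nil, not_false_eq_true, and_true] at ha
  obtain ⟨a6, a7, a12⟩ := ha
  rw [checkCmd, exec_seq, exec_seq]
  have hp := pickCmd_spec hs h
  have f₁ := frame_exec (pickCmd a) s
  have E₁ := hs.frame f₁ (by rfl)
  have r₁ : Rep (exec (pickCmd a) s) a S := h.frame f₁ (by simp [arrs, pickCmd])
  generalize exec (pickCmd a) s = s₁ at *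
  have f₂ := frame_exec (reachCmd a) s₁
  have E₂ := E₁.frame f₂ (by rfl)
  have r₂ : Rep (exec (reachCmd a) s₁) a S :=
    r₁.frame f₂ (by simp [arrs, reachCmd, roundCmd, nbrCount, fill, a6, a12])
  have h70 : (exec (reachCmd a) s₁).reg 70 = s₁.reg 70 :=
    f₂.reg (by simp [regs, reachCmd, roundCmd, nbrCount, fill])
  rcases hp with ⟨hp, rfl⟩ | ⟨hp, r, hr, h73⟩
  -- No root exists. The flag is already zero, and the remaining loop can only write zero to it.
  · have : ¬ IsConnectedDominating G (∅ : Finset (Fin n)) := by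
      rw [IsConnectedDominating, induce_connected_iff]
      simp
    rw [if_neg this]
    have f₃ := frame_exec (nbrCount a 7) (exec (reachCmd a) s₁)
    rw [judgeCmd, exec_seq]
    refine exec_forn_induction' (E₂.frame f₃ (by rfl)).size (fun _ st => st.reg 70 = 0)
      (by simp [regs]) (by simp [regs]) ?_ ?_
    · rw [setReg_reg, if_neg (by decide), f₃.reg (by simp [regs, nbrCount]), h70, hp]
    · intro v st _ _ hI
      rw [setReg_reg, if_neg (by decide)]
      simp only [exec_seq, exec_load, exec_ite_eq, exec_skip, exec_const]
      split_ifs <;> simp [hI]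
  · have h12 := reachCmd_spec E₁ a6 a12 r₁ h73
    rw [judgeCmd_spec E₂ a7 r₂ h12, h70, hp]
    congr 1
    rw [eq_iff_iff, IsConnectedDominating, connected_iff_subset_reach G hr]

/-- Copy the array `a` to the array `b`. -/
def copyCmd (a b : ℕ) : Cmd := forn 79 (load 78 a 79 ;; store b 79 78)

lemma copyCmd_spec {s : State} (hn : s.reg 0 = n) {a b : ℕ} (hab : a ≠ b) {S : Finset (Fin n)}
    (h : Rep s a S) : Rep (exec (copyCmd a b) s) b S := by
  refine exec_forn_map hn _ (by simp [regs]) (by simp [regs]) ?_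
  intro v st hv hf _
  have ea : st.arr a v = if v ∈ S then 1 else 0 := by
    rw [hf.arr (by simp [arrs, hab])]; exact h v
  refine ⟨by simp [hv, ea], fun w hw => ?_⟩
  simp [hv, ← Fin.ext_iff, hw]

/-- Register `75` is set to zero if the set in array `4` without the vertex in register `77` is a
connected dominating set. -/
def deletionCmd : Cmd :=
  load 78 4 77 ;; ite (.eq 78 6)
    (copyCmd 4 13 ;; store 13 77 5 ;; checkCmd 13 ;; ite (.eq 70 6) (const 75 0) skip) skip

/-- Register `75` tells whether the set in array `4` is a minimal connected dominating set. -/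
def minimalCmd : Cmd :=
  (checkCmd 4 ;; copy 75 70) ;; forn 77 deletionCmd

open Classical in
-- By `isMinimalConnectedDominating_iff` it suffices to test the `n` single deletions.
lemma minimalCmd_spec {G : SimpleGraph (Fin n)} {s : State} (hs : Env G s)
    {S : Finset (Fin n)} (h : Rep s 4 S) :
    (exec minimalCmd s).reg 75 = if IsMinimalConnectedDominating G S then 1 else 0 := by
  rw [minimalCmd, exec_seq]
  have f₁ := frame_exec (checkCmd 4 ;; copy 75 70) s
  have E₁ := hs.frame f₁ (by rfl)
  have r₁ := h.frame f₁ (by decide)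
  have h75 : (exec (checkCmd 4 ;; copy 75 70) s).reg 75 =
      if IsConnectedDominating G S then 1 else 0 := by
    rw [exec_seq, exec_copy, setReg_reg, if_pos rfl, checkCmd_spec hs (by decide) h]
  generalize exec (checkCmd 4 ;; copy 75 70) s = s₁ at *
  have := exec_forn_induction' (i := 77) (c := deletionCmd) E₁.size
    (fun k st => st.reg 75 = if IsConnectedDominating G S ∧ ∀ v : Fin n, (v : ℕ) < k → v ∈ S →
      ¬ IsConnectedDominating G (S.erase v) then 1 else 0) (by decide) (by decide)
      (by simpa using h75) ?_
  · rw [this]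
    congr 1
    rw [eq_iff_iff, isMinimalConnectedDominating_iff]
    exact and_congr_right fun _ => ⟨fun h v => h v v.2, fun h v _ => h v⟩
  intro v st hv hf hI
  have E := E₁.frame hf (by rfl)
  have r := r₁.frame hf (by decide)
  have hsplit : (∀ w : Fin n, (w : ℕ) < v + 1 → w ∈ S → ¬ IsConnectedDominating G (S.erase w)) ↔
      (∀ w : Fin n, (w : ℕ) < v → w ∈ S → ¬ IsConnectedDominating G (S.erase w)) ∧
        (v ∈ S → ¬ IsConnectedDominating G (S.erase v)) := by
    constructor
    · exact fun h => ⟨fun w hw => h w (by omega), h v (by omega)⟩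
    · rintro ⟨h1, h2⟩ w hw
      by_cases hwv : w = v
      · rw [hwv]; exact h2
      · have := Fin.val_ne_of_ne hwv
        exact h1 w (by omega)
  simp only [hsplit]
  have e4 : st.arr 4 v = if v ∈ S then 1 else 0 := r v
  by_cases hvS : v ∈ S
  swap
  · simp [deletionCmd, hv, e4, hvS, E.one, hI]
  rw [if_pos hvS] at e4
  obtain ⟨s₂, hs₂⟩ : ∃ s₂, s₂ = exec (copyCmd 4 13 ;; store 13 77 5) (exec (load 78 4 77) st) :=
    ⟨_, rfl⟩
  have f₂ : Frame (load 78 4 77 ;; copyCmd 4 13 ;; store 13 77 5) st s₂ :=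
    hs₂ ▸ frame_exec (load 78 4 77 ;; copyCmd 4 13 ;; store 13 77 5) _
  have E₂ := E.frame f₂ (by rfl)
  have r13 : Rep s₂ 13 (S.erase v) := by
    intro w
    have hc := copyCmd_spec (s := exec (load 78 4 77) st) (n := n) (a := 4) (b := 13)
      (by simp [E.size]) (by decide) (r.congr rfl) w
    have e77 : (exec (copyCmd 4 13) (exec (load 78 4 77) st)).reg 77 = v := by
      rw [exec_reg (by decide), exec_reg (by decide), hv]
    have e5 : (exec (copyCmd 4 13) (exec (load 78 4 77) st)).reg 5 = 0 := by
      rw [exec_reg (by decide), exec_reg (by decide), E.zero]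
    rw [hs₂, exec_seq, exec_store, setArr_arr_apply, hc, e77, e5]
    by_cases hwv : w = v <;> simp [hwv, ← Fin.ext_iff]
  have h70 := checkCmd_spec E₂ (by decide) r13
  have f₃ := frame_exec (checkCmd 13) s₂
  have h75' : (exec (checkCmd 13) s₂).reg 75 = st.reg 75 := by
    rw [f₃.reg (by decide), f₂.reg (by decide)]
  have h6' : (exec (checkCmd 13) s₂).reg 6 = 1 := by
    rw [f₃.reg (by decide), E₂.one]
  have hex : exec deletionCmd st = exec (ite (.eq 70 6) (const 75 0) skip) (exec (checkCmd 13) s₂) := by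
    rw [hs₂, deletionCmd, exec_seq, exec_ite_eq, if_pos]
    · rfl
    · simp [hv, e4, E.one]
  rw [hex, setReg_reg, if_neg (by decide), exec_ite_eq, h70, h6']
  by_cases hc : IsConnectedDominating G (S.erase v) <;> simp [hc, hvS, h75', hI]

end Check

end CDS

namespace CDS

open Cmd BitTree

/-! ### A trie that prevents repeated output -/

section Trie

variable {n : ℕ}

/-- The characteristic vector of a set as a word. -/
def word (S : Finset (Fin n)) : List Bool := List.ofFn fun v => decide (v ∈ S)

@[simp] lemma length_word (S : Finset (Fin n)) : (word S).length = n := by simp [word]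

lemma word_injective : Function.Injective (word (n := n)) := by
  intro S T h
  ext v
  simpa using congrFun (List.ofFn_injective h) v

lemma take_word_succ (S : Finset (Fin n)) (v : Fin n) :
    (word S).take (v + 1) = (word S).take v ++ [decide (v ∈ S)] := by
  rw [← List.take_concat_get' _ _ (by simp)]
  simp [word]

/-- The array with the edges that are labelled `b`. -/
def branch (b : Bool) : ℕ := if b then 15 else 14

/-- The arrays `14` and `15` hold a trie for the set `P` of words; `lab` maps the nodes, which are
the numbers up to the one in register `85`, to words. -/
structure IsTrie (P : List Bool → Prop) (s : State) (lab : ℕ → List Bool) : Prop where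
  root : lab 0 = []
  mem : ∀ i ≤ s.reg 85, P (lab i)
  surj : ∀ w, P w → ∃ i ≤ s.reg 85, lab i = w
  inj : ∀ i ≤ s.reg 85, ∀ j ≤ s.reg 85, lab i = lab j → i = j
  child : ∀ i ≤ s.reg 85, ∀ b, (s.arr (branch b) i = 0 ∧ ¬ P (lab i ++ [b])) ∨
    (s.arr (branch b) i ≠ 0 ∧ s.arr (branch b) i ≤ s.reg 85 ∧
      lab (s.arr (branch b) i) = lab i ++ [b])
  fresh : ∀ i > s.reg 85, ∀ b, s.arr (branch b) i = 0
  closed : ∀ w b, P (w ++ [b]) → P w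

lemma IsTrie.congr {P Q : List Bool → Prop} {s s' : State} {lab : ℕ → List Bool}
    (h : IsTrie P s lab) (hPQ : ∀ w, Q w ↔ P w) (h85 : s'.reg 85 = s.reg 85)
    (h14 : s'.arr 14 = s.arr 14) (h15 : s'.arr 15 = s.arr 15) : IsTrie Q s' lab := by
  obtain rfl : Q = P := funext fun w => propext (hPQ w)
  have hb : ∀ b, s'.arr (branch b) = s.arr (branch b) := by
    intro b; cases b
    · exact h14
    · exact h15
  constructor
  · exact h.root
  · rw [h85]; exact h.mem
  · rw [h85]; exact h.surj
  · rw [h85]; exact h.inj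
  · simp only [h85, hb]; exact h.child
  · simp only [h85, hb]; exact h.fresh
  · exact h.closed

/-- A new leaf of the trie. -/
lemma IsTrie.extend {P : List Bool → Prop} {s s' : State} {lab : ℕ → List Bool}
    (h : IsTrie P s lab) {i : ℕ} (hi : i ≤ s.reg 85) {b : Bool} (hb : ¬ P (lab i ++ [b]))
    (h85 : s'.reg 85 = s.reg 85 + 1)
    (harr : ∀ c j, s'.arr (branch c) j =
      if c = b ∧ j = i then s.reg 85 + 1 else s.arr (branch c) j) :
    IsTrie (fun w => P w ∨ w = lab i ++ [b]) s'
      (Function.update lab (s.reg 85 + 1) (lab i ++ [b])) := by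
  have hold : ∀ j ≤ s.reg 85,
      Function.update lab (s.reg 85 + 1) (lab i ++ [b]) j = lab j := fun j hj =>
    Function.update_of_ne (by omega) _ _
  have hnew : Function.update lab (s.reg 85 + 1) (lab i ++ [b]) (s.reg 85 + 1) = lab i ++ [b] :=
    Function.update_self _ _ _
  have hcase : ∀ j ≤ s'.reg 85, j ≤ s.reg 85 ∨ j = s.reg 85 + 1 := by
    intro j hj; omega
  constructor
  · rw [hold 0 (by omega)]; exact h.root
  · intro j hj
    rcases hcase j hj with hj | rfl
    · rw [hold j hj]; exact Or.inl (h.mem j hj)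
    · rw [hnew]; exact Or.inr rfl
  · rintro w (hw | rfl)
    · obtain ⟨j, hj, rfl⟩ := h.surj w hw
      exact ⟨j, by omega, hold j hj⟩
    · exact ⟨_, h85.ge, hnew⟩
  · intro j hj k hk hjk
    rcases hcase j hj with hj | rfl <;> rcases hcase k hk with hk | rfl
    · rw [hold j hj, hold k hk] at hjk
      exact h.inj j hj k hk hjk
    · rw [hold j hj, hnew] at hjk
      exact absurd (hjk ▸ h.mem j hj) hb
    · rw [hold k hk, hnew] at hjk
      exact absurd (hjk ▸ h.mem k hk) hb
    · rfl
  · intro j hj c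
    rw [harr, h85]
    rcases hcase j hj with hj | rfl
    · rw [hold j hj]
      by_cases hc : c = b ∧ j = i
      · rw [if_pos hc, hnew, hc.1, hc.2]
        exact Or.inr ⟨by omega, le_rfl, rfl⟩
      · rw [if_neg hc]
        rcases h.child j hj c with ⟨h1, h2⟩ | ⟨h1, h2, h3⟩
        · refine Or.inl ⟨h1, ?_⟩
          -- The new word determines its last letter and its parent, so it is a child of node `i`
          -- along `b` and of no other node.
          rintro (h4 | h4)
          · exact h2 h4
          · obtain ⟨h5, h6⟩ := List.append_inj' h4 rfl
            exact hc ⟨by simpa using h6, h.inj j hj i hi h5⟩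
        · exact Or.inr ⟨h1, by omega, by rw [hold _ h2]; exact h3⟩
    · rw [hnew, if_neg (by omega)]
      refine Or.inl ⟨h.fresh _ (by omega) c, ?_⟩
      rintro (h4 | h4)
      · exact hb (h.closed _ _ h4)
      · have := congrArg List.length h4
        simp at this
  · intro j hj c
    rw [harr, if_neg (by omega)]
    exact h.fresh j (by omega) c
  · rintro w c (hw | hw)
    · exact Or.inl (h.closed w c hw)
    · obtain ⟨rfl, -⟩ := List.append_inj' hw rfl
      exact Or.inl (h.mem i hi)

/-- One step down in the trie, along the edge for the vertex in register `82`. -/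
def trieStep : Cmd :=
  load 83 4 82 ;; ite (.eq 83 6) (load 84 15 80) (load 84 14 80) ;;
    ite (.eq 84 5) (succ 85 ;; copy 84 85 ;;
      ite (.eq 83 6) (store 15 80 84) (store 14 80 84) ;; const 81 1) skip ;;
    copy 80 84

lemma trieStep_old {s : State} {v : Fin n} {b : Bool} (h82 : s.reg 82 = v) (h5 : s.reg 5 = 0)
    (h6 : s.reg 6 = 1) (h4 : s.arr 4 v = b.toNat) (hc : s.arr (branch b) (s.reg 80) ≠ 0) :
    (exec trieStep s).reg 80 = s.arr (branch b) (s.reg 80) ∧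
      (exec trieStep s).reg 81 = s.reg 81 ∧ (exec trieStep s).reg 85 = s.reg 85 ∧
      (exec trieStep s).arr = s.arr := by
  cases b <;> simp only [branch] at hc ⊢ <;>
    simp_all [trieStep]

lemma trieStep_new {s : State} {v : Fin n} {b : Bool} (h82 : s.reg 82 = v) (h5 : s.reg 5 = 0)
    (h6 : s.reg 6 = 1) (h4 : s.arr 4 v = b.toNat) (hc : s.arr (branch b) (s.reg 80) = 0) :
    (exec trieStep s).reg 80 = s.reg 85 + 1 ∧
      (exec trieStep s).reg 81 = 1 ∧ (exec trieStep s).reg 85 = s.reg 85 + 1 ∧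
      ∀ c j, (exec trieStep s).arr (branch c) j =
        if c = b ∧ j = s.reg 80 then s.reg 85 + 1 else s.arr (branch c) j := by
  cases b <;> simp only [branch] at hc ⊢ <;> simp_all [trieStep]

open Classical in
-- The stored words are closed under prefixes: as soon as one prefix of `word S` is missing, all
-- longer ones are. Hence a node is created during the descent precisely when the whole word is new.
lemma trieLoop_spec {G : SimpleGraph (Fin n)} {s : State} (hs : Env G s)
    {P : List Bool → Prop} (hP : ∃ lab, IsTrie P s lab) {S : Finset (Fin n)} (h4 : Rep s 4 S)
    (h80 : s.reg 80 = 0) (h81 : s.reg 81 = 0) :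
    (∃ lab, IsTrie (fun w => P w ∨ w <+: word S) (exec (forn 82 trieStep) s) lab) ∧
      (exec (forn 82 trieStep) s).reg 81 = if P (word S) then 0 else 1 := by
  obtain ⟨lab, hlab⟩ := hP
  have hP0 : P [] := hlab.root ▸ hlab.mem 0 (by omega)
  have := exec_forn_induction' (i := 82) (c := trieStep) hs.size (fun k st =>
    (∃ lab, IsTrie (fun w => P w ∨ w <+: (word S).take k) st lab ∧ st.reg 80 ≤ st.reg 85 ∧
      lab (st.reg 80) = (word S).take k) ∧
    st.reg 81 = if P ((word S).take k) then 0 else 1) (by decide) (by decide) ?_ ?_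
  · rw [List.take_of_length_le (by simp)] at this
    obtain ⟨⟨lab, h, -⟩, h'⟩ := this
    exact ⟨⟨lab, h⟩, h'⟩
  · refine ⟨⟨lab, hlab.congr ?_ (by simp) rfl rfl, by simp [h80], ?_⟩, by simp [hP0, h81]⟩
    · intro w
      simp only [List.take_zero, List.prefix_nil]
      exact ⟨fun h => h.elim id (fun e => e ▸ hP0), Or.inl⟩
    · simp [h80, hlab.root]
  · rintro v st hv hf ⟨⟨lab', hl, hle, hcur⟩, h81⟩
    have E := hs.frame hf (by rfl)
    have e4 : st.arr 4 v = (decide (v ∈ S)).toNat := by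
      rw [hf.arr (by decide), h4 v]
      by_cases h : v ∈ S <;> simp [h]
    -- A node for the longer prefix cannot stem from the current insertion, so if it exists its word
    -- was stored before.
    have hnp : ¬ ((word S).take (v + 1) <+: (word S).take v) := fun h => by
      have := h.length_le
      simp at this
    have hPQ : ∀ w, (P w ∨ w <+: (word S).take (v + 1)) ↔
        (P w ∨ w <+: (word S).take v) ∨ w = (word S).take (v + 1) := by
      intro w
      rw [take_word_succ, List.prefix_concat_iff]
      tauto
    have hch := hl.child _ hle (decide (v ∈ S))
    rw [hcur, ← take_word_succ] at hch
    rcases hch with ⟨hc, hn⟩ | ⟨hc, hle', hlab'⟩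
    · obtain ⟨g80, g81, g85, garr⟩ := trieStep_new hv E.zero E.one e4 hc
      have hext := hl.extend (s' := exec trieStep st) (b := decide (v ∈ S)) hle
        (by rw [hcur, ← take_word_succ]; exact hn) g85 garr
      rw [hcur, ← take_word_succ] at hext
      refine ⟨⟨_, hext.congr hPQ (by simp) rfl rfl, ?_, ?_⟩, ?_⟩
      · simp [g80, g85]
      · simp [g80]
      · simp only [setReg_reg, g81]
        rw [if_neg fun h => hn (Or.inl h)]
        simp
    · obtain ⟨g80, g81, g85, garr⟩ := trieStep_old hv E.zero E.one e4 hc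
      have hin := hl.mem _ hle'
      rw [hlab'] at hin
      have hin' := hin.resolve_right hnp
      have hin'' : P ((word S).take v) := by
        rw [take_word_succ] at hin'
        exact hlab.closed _ _ hin'
      refine ⟨⟨lab', hl.congr ?_ (by simp [g85]) ?_ ?_, ?_, ?_⟩, ?_⟩
      · intro w
        rw [hPQ w]
        exact ⟨fun h => h.elim id (fun e => e ▸ hin), Or.inl⟩
      · rw [setReg_arr, garr]
      · rw [setReg_arr, garr]
      · simpa [g80, g85] using hle'
      · simpa [g80] using hlab'
      · simp only [setReg_reg, g81, h81, hin', hin'']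
        simp

/-- Print the set in array `4`. -/
def emitCmd : Cmd := forn 82 (load 83 4 82 ;; emit 83)

lemma emitCmd_spec {s : State} (hn : s.reg 0 = n) {S : Finset (Fin n)} (h4 : Rep s 4 S) :
    (exec emitCmd s).out = s.out ++ charVector S := by
  have := exec_forn_induction' (i := 82) (c := load 83 4 82 ;; emit 83) hn (fun k st =>
    st.out = s.out ++ (charVector S).take k) (by decide) (by decide) (by simp) ?_
  · rw [List.take_of_length_le (by simp [charVector])] at this
    exact this
  intro v st hv hf hI
  have e4 : st.arr 4 v = if v ∈ S then 1 else 0 := by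
    rw [hf.arr (by decide)]; exact h4 v
  rw [← List.take_concat_get' _ _ (by simp [charVector])]
  simp [hI, hv, e4, charVector]

/-- The prefixes of the words of members of the list. -/
def IsPrefixOf (L : List (Finset (Fin n))) (w : List Bool) : Prop :=
  w = [] ∨ ∃ S ∈ L, w <+: word S

/-- The sets in the list have been printed, and are stored in the trie. -/
structure Printed (L : List (Finset (Fin n))) (s : State) : Prop where
  nodup : L.Nodup
  out : s.out = (L.map charVector).flatten
  trie : ∃ lab, IsTrie (IsPrefixOf L) s lab

lemma Printed.frame {L : List (Finset (Fin n))} {s s' : State} {c : Cmd} (h : Printed L s)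
    (hf : Frame c s s') (hc : c.silent = true) (h85 : 85 ∉ c.regs) (h14 : 14 ∉ c.arrs)
    (h15 : 15 ∉ c.arrs) : Printed L s' := by
  obtain ⟨lab, hl⟩ := h.trie
  exact ⟨h.nodup, (hf.out hc).trans h.out,
    lab, hl.congr (fun _ => Iff.rfl) (hf.reg h85) (hf.arr h14) (hf.arr h15)⟩

/-- Print the set in array `4` unless it is stored in the trie. -/
def printCmd : Cmd :=
  (const 80 0 ;; const 81 0) ;; forn 82 trieStep ;; ite (.eq 81 6) emitCmd skip

/-- For `n = 0` the word of the empty set is the root, which is always present, so the trie would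
report it as printed; hence `hn`. -/
lemma printCmd_spec {G : SimpleGraph (Fin n)} {s : State} (hs : Env G s) (hn : 0 < n)
    {L : List (Finset (Fin n))} (hL : Printed L s) {S : Finset (Fin n)} (h4 : Rep s 4 S) :
    ∃ L', Printed L' (exec printCmd s) ∧ ∀ T, T ∈ L' ↔ T ∈ L ∨ T = S := by
  classical
  have f₁ := frame_exec (const 80 0 ;; const 81 0) s
  have E₁ := hs.frame f₁ (by rfl)
  have P₁ := hL.frame f₁ (by rfl) (by decide) (by decide) (by decide)
  have r₁ := h4.frame f₁ (by decide)
  obtain ⟨⟨lab, hlab⟩, h81⟩ := trieLoop_spec E₁ P₁.trie r₁ (by simp) (by simp)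
  have f₂ := frame_exec (forn 82 trieStep) (exec (const 80 0 ;; const 81 0) s)
  have E₂ := E₁.frame f₂ (by rfl)
  have r₂ := r₁.frame f₂ (by decide)
  have o₂ := f₂.out (by rfl)
  rw [P₁.out] at o₂
  rw [printCmd, exec_seq, exec_seq]
  generalize exec (forn 82 trieStep) (exec (const 80 0 ;; const 81 0) s) = s₂ at *
  have hmem : IsPrefixOf L (word S) ↔ S ∈ L := by
    constructor
    · rintro (h | ⟨T, hT, h⟩)
      · have := congrArg List.length h
        simp at this
        omega
      · rwa [word_injective (h.eq_of_length (by simp))]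
    · exact fun h => Or.inr ⟨S, h, List.prefix_rfl⟩
  rw [exec_ite_eq, h81, E₂.one]
  by_cases hS : S ∈ L
  · rw [if_pos (hmem.2 hS), if_neg (by decide)]
    refine ⟨L, ⟨hL.nodup, o₂, lab, hlab.congr (fun w => ?_) rfl rfl rfl⟩, fun T => ?_⟩
    · exact ⟨Or.inl, fun h => h.elim id fun h => Or.inr ⟨S, hS, h⟩⟩
    · exact ⟨Or.inl, fun h => h.elim id fun h => h ▸ hS⟩
  · rw [if_neg fun h => hS (hmem.1 h), if_pos rfl]
    have f₃ := frame_exec emitCmd s₂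
    refine ⟨L ++ [S], ⟨?_, ?_, lab, hlab.congr (fun w => ?_) (f₃.reg (by decide))
      (f₃.arr (by decide)) (f₃.arr (by decide))⟩, fun T => by simp⟩
    · rw [List.nodup_append]
      exact ⟨hL.nodup, by simp, fun a ha b hb => by
        rintro rfl; exact hS ((List.mem_singleton.1 hb) ▸ ha)⟩
    · rw [emitCmd_spec E₂.size r₂, o₂]; simp
    · simp only [IsPrefixOf, List.mem_append, List.mem_singleton, or_and_right, exists_or,
        exists_eq_left, or_assoc]

end Trie

/-! ### Traversal of the search tree by replaying bit strings -/

section MainLoop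

variable {n : ℕ}

/-- The bits in the list (the last bit comes first), followed by zeros. -/
def bitsOf (ρ : List Bool) (i : ℕ) : Bool := ρ.reverse.getD i false

lemma bitsOf_cons_of_lt {ρ : List Bool} {b : Bool} {i : ℕ} (h : i < ρ.length) :
    bitsOf (b :: ρ) i = bitsOf ρ i := by
  simp only [bitsOf, List.reverse_cons]
  rw [List.getD_append _ _ _ _ (by simpa using h)]

lemma bitsOf_cons_self (ρ : List Bool) (b : Bool) : bitsOf (b :: ρ) ρ.length = b := by
  simp [bitsOf, List.getD_eq_getElem?_getD]

lemma bitsOf_of_le {ρ : List Bool} {i : ℕ} (h : ρ.length ≤ i) : bitsOf ρ i = false := by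
  simp only [bitsOf]
  rw [List.getD_eq_default _ _ (by simpa using h)]

lemma bitsOf_cons_false (ρ : List Bool) : bitsOf (false :: ρ) = bitsOf ρ := by
  funext i
  rcases lt_trichotomy i ρ.length with h | rfl | h
  · exact bitsOf_cons_of_lt h
  · rw [bitsOf_cons_self, bitsOf_of_le le_rfl]
  · rw [bitsOf_of_le (by simpa using h), bitsOf_of_le h.le]

/-- The next round is going to follow the bits `ρ`. -/
structure Ready (ρ : List Bool) (s : State) : Prop where
  go : s.reg 4 = 0
  bits : ∀ i < s.reg 2, s.arr 1 i = (bitsOf ρ i).toNat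
  rest : ∀ i, s.reg 2 ≤ i → bitsOf ρ i = false

/-- All bit sequences that start with `ρ` have been followed. -/
def Finished : List Bool → State → Prop
  | [], s => s.reg 4 = 1
  | true :: ρ, s => Finished ρ s
  | false :: ρ, s => Ready (true :: ρ) s

/-- Proceed to the next bit sequence in lexicographic order. -/
def nextCmd : Cmd := ite (.eq 3 5) (const 4 1) (copy 2 3 ;; pred 3 ;; store 1 3 6)

lemma lastZero_congr {o o' : ℕ → Bool} {p : ℕ} (h : ∀ i < p, o i = o' i) :
    lastZero o p = lastZero o' p := by
  induction p with
  | zero => rfl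
  | succ p ih => rw [lastZero, lastZero, h p (by omega), ih fun i hi => h i (by omega)]

/-- With the last bit first, the recursion strips the trailing ones, which need no further work,
until the last zero is found. That zero becomes a one, and everything after it is discarded. -/
lemma finished_nextCmd {s : State} (h5 : s.reg 5 = 0) (h6 : s.reg 6 = 1) (h4 : s.reg 4 = 0) :
    ∀ ρ : List Bool, s.reg 3 = lastZero (bitsOf ρ) ρ.length →
      (∀ i < ρ.length, s.arr 1 i = (bitsOf ρ i).toNat) → Finished ρ (exec nextCmd s)
  | [], h3, _ => by
    simp only [List.length_nil, lastZero] at h3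
    simp [Finished, nextCmd, h3, h5]
  | true :: ρ, h3, hb => by
    refine finished_nextCmd h5 h6 h4 ρ ?_ fun i hi => ?_
    · rw [h3, List.length_cons, lastZero, bitsOf_cons_self, if_neg (by decide)]
      exact lastZero_congr fun i hi => bitsOf_cons_of_lt hi
    · rw [hb i (by simp; omega), bitsOf_cons_of_lt hi]
  | false :: ρ, h3, hb => by
    rw [List.length_cons, lastZero, bitsOf_cons_self, if_pos rfl] at h3
    have hne : ¬ s.reg 3 = s.reg 5 := by omega
    rw [nextCmd, exec_ite_eq, if_neg hne]
    refine ⟨by simp [h4], fun i hi => ?_, fun i hi => ?_⟩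
    · simp only [exec_seq, exec_copy, exec_pred, exec_store, setArr_reg, setReg_reg] at hi
      simp [h3] at hi
      simp only [exec_seq, exec_copy, exec_pred, exec_store, setArr_arr_apply, setReg_arr,
        setReg_reg]
      by_cases hir : i = ρ.length
      · simp [hir, h3, h6, bitsOf_cons_self]
      · have hlt : i < ρ.length := by omega
        rw [bitsOf_cons_of_lt hlt]
        simp [h3, hir, hb i (by simp; omega), bitsOf_cons_of_lt hlt]
    · simp only [exec_seq, exec_copy, exec_pred, exec_store, setArr_reg, setReg_reg] at hi
      simp [h3] at hi
      exact bitsOf_of_le (by simpa using hi)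

/-- One round: run the decoder with the prescribed bits, and print the result if it is a minimal
connected dominating set. -/
def bodyCmd (M : Modes) : Cmd :=
  (const 1 0 ;; const 3 0) ;; searchCmd M ;; minimalCmd ;; ite (.eq 75 6) printCmd skip ;; nextCmd

/-- The paths to leaves are prefix-free and determine the results. -/
lemma BitTree.Path.unique {α : Type} {t : BitTree α} {π ρ : List Bool} {a b : α}
    (h : t.Path π a) (h' : t.Path ρ b)
    (hπ : ∀ i (hi : i < π.length) (hi' : i < ρ.length), π[i] = ρ[i]) : π = ρ ∧ a = b := by
  induction h generalizing ρ with
  | leaf a => cases h'; exact ⟨rfl, rfl⟩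
  | left h ih =>
    cases h' with
    | left h' =>
      obtain ⟨rfl, rfl⟩ := ih h' fun i hi hi' => by
        exact hπ (i + 1) (Nat.succ_lt_succ hi) (Nat.succ_lt_succ hi')
      exact ⟨rfl, rfl⟩
    | right h' => exact absurd (hπ 0 (by simp) (by simp)) (by simp)
  | right h ih =>
    cases h' with
    | left h' => exact absurd (hπ 0 (by simp) (by simp)) (by simp)
    | right h' =>
      obtain ⟨rfl, rfl⟩ := ih h' fun i hi hi' => by
        exact hπ (i + 1) (Nat.succ_lt_succ hi) (Nat.succ_lt_succ hi')
      exact ⟨rfl, rfl⟩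

lemma searchCmd_frame (M : Modes) : 4 ∉ (searchCmd M).regs ∧ 85 ∉ (searchCmd M).regs ∧
    14 ∉ (searchCmd M).arrs ∧ 15 ∉ (searchCmd M).arrs := by
  -- What is written does not depend on the parameters, so they may be replaced by numerals that
  -- allow evaluation.
  have h : ∀ M', (searchCmd M).regs = (searchCmd M').regs ∧
    (searchCmd M).arrs = (searchCmd M').arrs := fun _ => ⟨rfl, rfl⟩
  rw [(h ⟨0, ⟨0, 0, 0, 0, 0, 0, 0, 0⟩, ⟨0, 0, 0, 0, 0, 0, 0, 0⟩, ⟨0, 0, 0, 0, 0, 0, 0, 0⟩,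
    ⟨0, 0, 0, 0, 0, 0, 0, 0⟩⟩).1, (h ⟨0, ⟨0, 0, 0, 0, 0, 0, 0, 0⟩, ⟨0, 0, 0, 0, 0, 0, 0, 0⟩,
    ⟨0, 0, 0, 0, 0, 0, 0, 0⟩, ⟨0, 0, 0, 0, 0, 0, 0, 0⟩⟩).2]
  decide +kernel

set_option maxRecDepth 10000 in
lemma bodyCmd_spec {G : SimpleGraph (Fin n)} {M : Modes} (hM : M.Pos) {s : State} (hs : Env G s)
    {L : List (Finset (Fin n))} (hL : Printed L s) {ρ : List Bool} (hρ : Ready ρ s)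
    {S : Finset (Fin n)} (hS : (search M G).Path ρ.reverse S) :
    Finished ρ (exec (bodyCmd M) s) ∧ ∃ L', Printed L' (exec (bodyCmd M) s) ∧
      ∀ T, T ∈ L' ↔ T ∈ L ∨ T = S ∧ IsMinimalConnectedDominating G T := by
  classical
  have f₁ := frame_exec (const 1 0 ;; const 3 0) s
  have E₁ := hs.frame f₁ (by rfl)
  have P₁ := hL.frame f₁ (by rfl) (by decide) (by decide) (by decide)
  have hA : AskInv (bitsOf ρ) 0 (exec (const 1 0 ;; const 3 0) s) := by
    refine ⟨by simp, by simp [lastZero], E₁.zero, ?_, ?_⟩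
    · rw [f₁.reg (by decide), f₁.arr (by decide)]
      exact fun i hi => hρ.bits i (by omega)
    · rw [f₁.reg (by decide)]
      exact fun i _ => hρ.rest i
  have h4₁ : (exec (const 1 0 ;; const 3 0) s).reg 4 = 0 := (f₁.reg (by decide)).trans hρ.go
  have hex : exec (bodyCmd M) s = exec (minimalCmd ;; ite (.eq 75 6) printCmd skip ;; nextCmd)
      (exec (searchCmd M) (exec (const 1 0 ;; const 3 0) s)) := rfl
  generalize exec (const 1 0 ;; const 3 0) s = s₁ at *
  -- The oracle consists of the bits of `ρ`, so the path taken agrees with the path of `S` where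
  -- both are defined; by uniqueness the replay ends at `S`.
  obtain ⟨π, S', hπ, r₂, A₂, hb⟩ := sim_searchCmd E₁ hM _ _ _ rfl hA
  obtain ⟨rfl, rfl⟩ := hπ.unique hS fun i hi hi' => by
    rw [hb i hi, zero_add, bitsOf, List.getD_eq_getElem _ _ hi']
  rw [zero_add] at A₂
  have f₂ := frame_exec (searchCmd M) s₁
  have fs := searchCmd_frame M
  have E₂ := E₁.frame f₂ (by rfl)
  have P₂ := P₁.frame f₂ (by rfl) fs.2.1 fs.2.2.1 fs.2.2.2
  have h4₂ : (exec (searchCmd M) s₁).reg 4 = 0 :=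
    (f₂.reg fs.1).trans h4₁
  generalize exec (searchCmd M) s₁ = s₂ at *
  have h75 := minimalCmd_spec E₂ r₂
  have f₃ := frame_exec minimalCmd s₂
  have E₃ := E₂.frame f₃ (by rfl)
  have P₃ := P₂.frame f₃ (by rfl) (by decide) (by decide) (by decide)
  have r₃ := r₂.frame f₃ (by decide)
  have A₃ := A₂.exec (c := minimalCmd) (by rfl)
  have h4₃ := (f₃.reg (x := 4) (by decide)).trans h4₂
  rw [exec_seq, exec_seq] at hex
  generalize exec minimalCmd s₂ = s₃ at *
  have hprint : ∃ L', Printed L' (exec (ite (.eq 75 6) printCmd skip) s₃) ∧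
      ∀ T, T ∈ L' ↔ T ∈ L ∨ T = S' ∧ IsMinimalConnectedDominating G T := by
    rw [exec_ite_eq, h75, E₃.one]
    by_cases hm : IsMinimalConnectedDominating G S'
    · rw [if_pos hm, if_pos rfl]
      have hn : 0 < n := by
        obtain ⟨⟨v, -⟩, -⟩ := (induce_connected_iff G S').1 hm.1.2
        exact Fin.pos v
      obtain ⟨L', h1, h2⟩ := printCmd_spec E₃ hn P₃ r₃
      refine ⟨L', h1, fun T => ?_⟩
      rw [h2]
      exact or_congr_right ⟨fun h => ⟨h, h ▸ hm⟩, fun h => h.1⟩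
    · rw [if_neg hm, if_neg (by decide)]
      refine ⟨L, P₃, fun T => ⟨Or.inl, ?_⟩⟩
      rintro (h | ⟨rfl, h⟩)
      · exact h
      · exact absurd h hm
  have f₄ := frame_exec (ite (.eq 75 6) printCmd skip) s₃
  have E₄ := E₃.frame f₄ (by rfl)
  have A₄ := A₃.exec (c := ite (.eq 75 6) printCmd skip) (by rfl)
  have h4₄ := (f₄.reg (x := 4) (by decide)).trans h4₃
  generalize exec (ite (.eq 75 6) printCmd skip) s₃ = s₄ at *
  have f₅ := frame_exec nextCmd s₄
  rw [hex]
  obtain ⟨L', h1, h2⟩ := hprint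
  refine ⟨finished_nextCmd E₄.zero E₄.one h4₄ ρ ?_ fun i hi => A₄.bits i (by simp [hi]),
    L', h1.frame f₅ (by rfl) (by decide) (by decide) (by decide), h2⟩
  simpa using A₄.last

/-- From the state `s` the loop gets to the state `s'`, where it continues, in `t` steps. -/
def LoopTo (b : Test) (P : Program) (s s' : State) (t : ℕ) : Prop :=
  ∀ s'' t', Runs (.loop b P) s' s'' t' → Runs (.loop b P) s s'' (t + t')

lemma LoopTo.trans {b : Test} {P : Program} {s s' s'' : State} {t t' : ℕ}
    (h : LoopTo b P s s' t) (h' : LoopTo b P s' s'' t') : LoopTo b P s s'' (t + t') :=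
  fun _ _ hr => by rw [add_assoc]; exact h _ _ (h' _ _ hr)

set_option maxRecDepth 10000 in
lemma bodyCmd_runs (M : Modes) : 0 ∉ (bodyCmd M).regs ∧ (bodyCmd M).loopsOk = true ∧
    (bodyCmd M).keeps = true :=
  have hk : (bodyCmd M).keeps = true := by rfl
  ⟨by simp only [keeps, Bool.and_eq_true, decide_eq_true_eq] at hk; exact hk.1.1.1, by rfl, hk⟩

/-- Induction on the subtree `t` to which the bits `ρ` lead. Entering the left subtree requires no
change, since missing bits count as zero; by the definition of `Finished`, leaving it means being
ready for the right subtree, and leaving the latter means being finished with `ρ`. Each leaf costs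
one round. -/
lemma exists_loopTo {G : SimpleGraph (Fin n)} {M : Modes} (hM : M.Pos)
    (t : BitTree (Finset (Fin n))) : ∀ (ρ : List Bool)
    (_ : ∀ π S, t.Path π S → (search M G).Path (ρ.reverse ++ π) S) (L : List (Finset (Fin n)))
    (s : State) (_ : Env G s) (_ : Printed L s) (_ : Ready ρ s), ∃ s' L' T,
      T ≤ t.size * ((bodyCmd M).cost.eval n + 1) ∧
      LoopTo (.lt 4 6) (bodyCmd M).compile s s' T ∧ Env G s' ∧ Printed L' s' ∧ Finished ρ s' ∧
      ∀ S, S ∈ L' ↔ S ∈ L ∨ S ∈ t.leaves ∧ IsMinimalConnectedDominating G S := by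
  induction t with
  | leaf S =>
    intro ρ hp L s hs hL hρ
    have hS := hp [] S (.leaf S)
    rw [List.append_nil] at hS
    obtain ⟨hfin, L', hL', hmem⟩ := bodyCmd_spec hM hs hL hρ hS
    obtain ⟨b0, bl, bk⟩ := bodyCmd_runs M
    obtain ⟨T, hT, hr⟩ := runs_compile (s := s) b0 bl
    rw [hs.size] at hT
    refine ⟨_, L', T + 1, by simpa using hT, fun s'' t' hr' => ?_, hs.exec bk, hL', hfin,
      fun U => by rw [hmem, mem_leaves_leaf]⟩
    have := Runs.loop_true (b := .lt 4 6) (by simp [Test.Holds, hρ.go, hs.one]) hr hr'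
    rwa [show T + t' + 1 = T + 1 + t' by omega] at this
  | node l r ihl ihr =>
    intro ρ hp L s hs hL hρ
    obtain ⟨s₁, L₁, T₁, b₁, g₁, E₁, P₁, F₁, m₁⟩ := ihl (false :: ρ) (fun π S h => by
      simpa using hp (false :: π) S (.left h)) L s hs hL
        ⟨hρ.go, by rw [bitsOf_cons_false]; exact hρ.bits, by rw [bitsOf_cons_false]; exact hρ.rest⟩
    obtain ⟨s₂, L₂, T₂, b₂, g₂, E₂, P₂, F₂, m₂⟩ := ihr (true :: ρ) (fun π S h => by
      simpa using hp (true :: π) S (.right h)) L₁ s₁ E₁ P₁ F₁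
    refine ⟨s₂, L₂, T₁ + T₂, ?_, g₁.trans g₂, E₂, P₂, F₂, fun S => ?_⟩
    · rw [size_node, add_mul]; omega
    · rw [m₂, m₁, mem_leaves_node]; tauto

lemma env_inputState (G : SimpleGraph (Fin n)) : Env G ((inputState G).setReg 6 1) := by
  refine ⟨by simp [inputState], by simp [inputState], by simp, fun u v => ?_⟩
  simp only [setReg_arr, inputState, true_and]
  congr 1
  rw [eq_iff_iff]
  constructor
  · rintro ⟨-, u', v', h, e⟩
    have hu : (u : ℕ) = u' := by
      have := congrArg (· / n) e
      simp only [mul_comm _ n] at this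
      rwa [Nat.mul_add_div (Fin.pos u), Nat.mul_add_div (Fin.pos u), Nat.div_eq_of_lt v.2,
        Nat.div_eq_of_lt v'.2] at this
    have hv : (v : ℕ) = v' := by rw [hu] at e; omega
    rwa [Fin.ext hu, Fin.ext hv]
  · exact fun h => ⟨rfl, u, v, h, rfl⟩

/-- A program that lists the minimal connected dominating sets among the results of the search. -/
theorem exists_program {M : Modes} (hM : M.Pos) : ∃ (P : Program) (K : Polynomial ℕ),
    ∀ (n : ℕ) (G : SimpleGraph (Fin n)),
      (∀ S, IsMinimalConnectedDominating G S → S ∈ (search M G).leaves) →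
      ∃ t ≤ (search M G).size * K.eval n,
        ListsInTime P G (minimalConnectedDominatingSets G) t := by
  refine ⟨.seq (.const 6 1) (.loop (.lt 4 6) (bodyCmd M).compile), (bodyCmd M).cost + 3,
    fun n G h => ?_⟩
  have E := env_inputState G
  have hP : Printed ([] : List (Finset (Fin n))) ((inputState G).setReg 6 1) := by
    refine ⟨List.nodup_nil, by simp [inputState], fun _ => [], rfl, ?_, ?_, ?_, ?_, ?_, ?_⟩
    · exact fun _ _ => Or.inl rfl
    · rintro w (rfl | ⟨S, hS, -⟩)
      · exact ⟨0, Nat.zero_le _, rfl⟩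
      · simp at hS
    · intro i hi j hj _
      simp [inputState] at hi hj
      rw [hi, hj]
    · intro i _ b
      left
      refine ⟨?_, by simp [IsPrefixOf]⟩
      cases b <;> simp [inputState, branch]
    · intro i _ b
      cases b <;> simp [inputState, branch]
    · simp [IsPrefixOf]
  have hR : Ready [] ((inputState G).setReg 6 1) := by
    refine ⟨by simp [inputState], fun i hi => ?_, fun i _ => bitsOf_of_le (by simp)⟩
    simp [inputState] at hi
  obtain ⟨s', L, T, hT, hloop, E', P', F', hmem⟩ :=
    exists_loopTo hM (search M G) [] (fun π S h => by simpa using h) [] _ E hP hR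
  have hend : Runs (.loop (.lt 4 6) (bodyCmd M).compile) s' s' 1 := by
    refine .loop_false ?_
    have : s'.reg 4 = 1 := F'
    simp [Test.Holds, this, E'.one]
  refine ⟨1 + (T + 1), ?_, s', L, .seq (.const _ _ _) (hloop _ _ hend), P'.out, P'.nodup,
    fun S => ?_⟩
  -- The additional 2 in the cost pays for the initialization and the last test, as there is at
  -- least one leaf.
  · have := (search M G).size_pos
    simp only [Polynomial.eval_add, Polynomial.eval_ofNat]
    nlinarith
  · rw [hmem]
    simp only [List.not_mem_nil, false_or]
    exact ⟨fun h => h.2, fun hS => ⟨h S hS, hS⟩⟩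

end MainLoop

end CDS

namespace CDS

open BitTree

/-! ### Choice of the parameters; every minimal set is found -/

section Correctness

variable {n : ℕ}

/-- The parameters of the algorithm. -/
def modes : Modes where
  -- For `n ≥ 48`, more than `n / 4` members means at least 12.
  N := 48
  -- Zero centres make every neighbourhood count as large, so just the last phase matters; its bound
  -- is `n` here and `n / 4` in `few`.
  small := ⟨0, 0, 1, 0, 1, 0, 1, 1⟩
  few := ⟨0, 0, 1, 0, 1, 0, 1, 4⟩
  -- The capacity is 8 times the number of centres, as a vertex of `U` has at most 8 neighbours in
  -- `S`. With block bound zero no block is ever selected.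
  wide := ⟨2 ^ 31, 2 ^ 28, 80, 0, 1, 0, 1, 1⟩
  -- The centres number only `n / 2 ^ 120` so that guessing them is cheaper than what the `n / 2 ^
  -- 29` blocks of fewer than 80 vertices save, about `n / 2 ^ 109` bits.
  narrow := ⟨2 ^ 120, 2 ^ 117, 256, 256, 2 ^ 17, 80, 2 ^ 29, 1⟩

lemma modes_pos : modes.Pos := ⟨by decide, by decide, by decide, by decide⟩

@[simp] lemma nbhd_empty (G : SimpleGraph (Fin n)) : nbhd G ∅ = ∅ := by
  ext v; simp [mem_nbhd]

lemma card_inter_nbhd_le (G : SimpleGraph (Fin n)) {A S : Finset (Fin n)} {d : ℕ}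
    (h : ∀ u ∈ A, (nbrs G S u).card ≤ d) : (S ∩ nbhd G A).card ≤ A.card * d := by
  classical
  have hsub : S ∩ nbhd G A ⊆ A.biUnion fun u => nbrs G S u := by
    intro v hv
    obtain ⟨hvS, hvA⟩ := Finset.mem_inter.1 hv
    obtain ⟨u, hu, huv⟩ := mem_nbhd.1 hvA
    exact Finset.mem_biUnion.2 ⟨u, hu, mem_nbrs.2 ⟨hvS, huv.symm⟩⟩
  exact (Finset.card_le_card hsub).trans (Finset.card_biUnion_le_card_mul _ _ _ h)

lemma card_le_size (S : Finset (Fin n)) : S.card ≤ n :=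
  (Finset.card_le_univ S).trans_eq (Fintype.card_fin n)

/-- There is a set of vertices with many neighbours outside of which no vertex of `U` has many
neighbours, unless its size is the largest possible one. -/
lemma exists_maximal_expanding (G : SimpleGraph (Fin n)) (U : Finset (Fin n)) (a d : ℕ) :
    ∃ A ⊆ U, A.card ≤ a ∧ d * A.card ≤ (nbhd G A).card ∧
      (A.card < a → ∀ u ∈ U, (nbrs G (nbhd G A)ᶜ u).card < d ∨ d = 0) := by
  classical
  obtain ⟨A, hA, hmax⟩ := Finset.exists_max_image (U.powerset.filter fun A =>
    A.card ≤ a ∧ d * A.card ≤ (nbhd G A).card) Finset.card ⟨∅, by simp⟩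
  simp only [Finset.mem_filter, Finset.mem_powerset] at hA hmax
  refine ⟨A, hA.1, hA.2.1, hA.2.2, fun hlt u hu => ?_⟩
  by_contra! hcon
  obtain ⟨hcon, hd⟩ := hcon
  have huA : u ∉ A := by
    intro huA
    have : nbrs G (nbhd G A)ᶜ u = ∅ := by
      ext w
      simp only [mem_nbrs, Finset.mem_compl, mem_nbhd, Finset.notMem_empty, iff_false, not_and]
      exact fun h1 h2 => h1 ⟨u, huA, h2.symm⟩
    rw [this] at hcon
    simp at hcon
    exact hd hcon
  -- Adding `u` to `A` would bring at least `d` new neighbours, against the maximality of `A`.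
  have hsub : nbhd G A ∪ nbrs G (nbhd G A)ᶜ u ⊆ nbhd G (insert u A) := by
    intro w hw
    rw [mem_nbhd]
    rcases Finset.mem_union.1 hw with hw | hw
    · obtain ⟨x, hx, hwx⟩ := mem_nbhd.1 hw
      exact ⟨x, Finset.mem_insert_of_mem hx, hwx⟩
    · exact ⟨u, Finset.mem_insert_self _ _, (mem_nbrs.1 hw).2.symm⟩
  have hdis : Disjoint (nbhd G A) (nbrs G (nbhd G A)ᶜ u) := by
    rw [Finset.disjoint_left]
    exact fun w hw hw' => Finset.mem_compl.1 (mem_nbrs.1 hw').1 hw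
  have hcard := Finset.card_le_card hsub
  rw [Finset.card_union_of_disjoint hdis] at hcard
  have := hmax (insert u A) ⟨Finset.insert_subset hu hA.1, by
    rw [Finset.card_insert_of_notMem huA]; omega, by
    rw [Finset.card_insert_of_notMem huA, mul_add]; omega⟩
  rw [Finset.card_insert_of_notMem huA] at this
  omega

/-- Either `S` is small, or `n / 2 ^ 31` vertices of `U` have 80 times as many neighbours, or the
failure of the latter is the hypothesis `hb` of the block search around a maximal expanding set of
at most `n / 2 ^ 120` centres. -/
theorem mem_leaves_search (G : SimpleGraph (Fin n)) {S : Finset (Fin n)}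
    (hS : IsMinimalConnectedDominating G S) : S ∈ (search modes G).leaves := by
  classical
  rw [search]
  split_ifs with hn
  · refine mem_leaves_decode_of_large G _ (A := ∅) (by simp) ?_ (by simp) ?_
    · simp [modes, Params.scale]
    · simpa [modes, Params.scale] using card_le_size S
  simp only [mem_leaves_node]
  have hn' : 48 ≤ n := not_lt.1 hn
  by_cases hsmall : S.card ≤ n / 4
  · left
    refine mem_leaves_decode_of_large G _ (A := ∅) (by simp) ?_ (by simp) ?_
    · simp [modes, Params.scale]
    · simpa [modes, Params.scale] using hsmall
  right
  obtain ⟨U, hSU, hU8, hU3⟩ := hS.exists_sparse (by omega)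
  have hU8' : ∀ u ∈ U, (nbrs G S u).card ≤ 8 := fun u hu => by
    convert hU8 u hu using 2; ext; simp [mem_nbrs]
  have hU3' : ∀ s ∈ S, (nbrs G U s).card ≤ 3 := fun u hu => by
    convert hU3 u hu using 2; ext; simp [mem_nbrs]
  by_cases hwide : ∃ A ⊆ U, A.card = n / 2 ^ 31 ∧ 80 * (n / 2 ^ 31) ≤ (nbhd G A).card
  · left
    obtain ⟨A, hAU, hA, hX⟩ := hwide
    have hcap := card_inter_nbhd_le G fun u hu => hU8' u (hAU hu)
    refine mem_leaves_decode_of_large G _ (A := A) ?_ ?_ ?_ ?_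
    · exact hA.le
    · show ¬ _ / 80 < n / 2 ^ 31
      omega
    · show _ ≤ n / 2 ^ 28
      omega
    · show _ ≤ n / 1
      rw [Nat.div_one]; exact card_le_size _
  · right
    push Not at hwide
    obtain ⟨A, hAU, hA, hX, hmax⟩ := exists_maximal_expanding G U (n / 2 ^ 120) 256
    have hcap := card_inter_nbhd_le G fun u hu => hU8' u (hAU hu)
    have hcap' : (S ∩ nbhd G A).card ≤ n / 2 ^ 117 := by omega
    by_cases hlarge : (nbhd G A).card / 256 < n / 2 ^ 120
    · refine mem_leaves_decode_of_small G _ (A := A) (U := U) (b := n / 2 ^ 31) hA hlarge hcap'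
        ?_ ?_ hU3' ?_ hwide ?_
      · show n ≤ n / 1
        rw [Nat.div_one]
      · exact fun u => hS.1.exists_adj (by omega) u
      · exact fun u hu => (hmax (by omega) u hu).resolve_right (by decide)
      · intro y hy
        have hy' : y * 2 ^ 17 ≤ n * 256 := hy
        -- Up to rounding, the four terms are at most `3n / 2 ^ 117`, `3n / 2 ^ 9`, `n / 2 ^ 6` and
        -- `5n / 2 ^ 8`, together less than `n / 16`, whereas `4 |U| ≥ |S| > n / 4`.
        show 3 * (n / 2 ^ 117) + 3 * y + (n / 2 ^ 31) * 256 * 2 ^ 17 +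
          (n / 2 ^ 29) * 80 * 2 ^ 17 < U.card
        omega
    · refine mem_leaves_decode_of_large G _ (A := A) hA hlarge hcap' ?_
      show _ ≤ n / 1
      rw [Nat.div_one]; exact card_le_size _

end Correctness

end CDS

namespace CDS

open BitTree

/-! ### Numerical bounds for the number of leaves -/

section Sizes

variable {n : ℕ}

lemma two_rpow_le {x y : ℝ} (h : x ≤ y) : (2 : ℝ) ^ x ≤ (2 : ℝ) ^ y :=
  Real.rpow_le_rpow_of_exponent_le one_le_two h

lemma two_rpow_add (x y : ℝ) : (2 : ℝ) ^ x * (2 : ℝ) ^ y = (2 : ℝ) ^ (x + y) :=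
  (Real.rpow_add two_pos x y).symm

/-- Comparison of a power with a power of two, from an inequality between integral powers. -/
lemma pow_le_two_rpow {c : ℝ} (hc : 0 ≤ c) {q : ℕ} (hq : q ≠ 0) {p : ℤ} (h : c ^ q ≤ (2 : ℝ) ^ p)
    (x : ℕ) : c ^ x ≤ (2 : ℝ) ^ ((p / q : ℝ) * x) := by
  have hb : c ≤ (2 : ℝ) ^ (p / q : ℝ) := by
    rw [← pow_le_pow_iff_left₀ hc (by positivity) hq, ← Real.rpow_natCast ((2 : ℝ) ^ (p / q : ℝ)),
      ← Real.rpow_mul zero_le_two, div_mul_cancel₀ _ (by exact_mod_cast hq), Real.rpow_intCast]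
    exact h
  calc c ^ x ≤ ((2 : ℝ) ^ (p / q : ℝ)) ^ x := pow_le_pow_left₀ hc hb x
    _ = _ := by rw [← Real.rpow_natCast, ← Real.rpow_mul zero_le_two]

lemma exp_le_two_rpow {x : ℝ} (hx : 0 ≤ x) : Real.exp x ≤ (2 : ℝ) ^ (2 * x) := by
  rw [Real.rpow_def_of_pos two_pos]
  apply Real.exp_le_exp.2
  have := Real.log_two_gt_d9
  nlinarith

lemma one_sub_pow_le {u : ℝ} (hu : 0 ≤ u) (hu1 : u ≤ 1) (m : ℕ) :
    (1 - u) ^ m ≤ (2 : ℝ) ^ (-(m * u)) := by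
  have h1 : 1 - u ≤ (2 : ℝ) ^ (-u) := by
    have h2 := Real.add_one_le_exp (-u)
    rw [Real.rpow_def_of_pos two_pos]
    have h3 : Real.exp (-u) ≤ Real.exp (Real.log 2 * -u) := by
      apply Real.exp_le_exp.2
      have := Real.log_two_lt_d9
      nlinarith
    linarith
  calc (1 - u) ^ m ≤ ((2 : ℝ) ^ (-u)) ^ m := pow_le_pow_left₀ (by linarith) h1 m
    _ = _ := by
      rw [← Real.rpow_natCast, ← Real.rpow_mul zero_le_two]
      congr 1; ring

/-- The weight `μ = 2 ^ k` charges `k` bits to each chosen vertex, and the rest is `(1 + 1 / 2 ^ k)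
^ n ≤ exp (n / 2 ^ k)`. For `a ≈ n / 2 ^ k` centres the total is about `(k + 2) * a` bits. -/
lemma size_askSet_univ_le (a k : ℕ) :
    ((askSet (Finset.univ : Finset (Fin n)) a).size : ℝ) ≤ (2 : ℝ) ^ (k * a + 2 * (n / 2 ^ k : ℝ)) := by
  have h := size_askSet_le (Finset.univ : Finset (Fin n)) a (μ := 2 ^ k) (one_le_pow₀ one_le_two)
  rw [Finset.card_univ, Fintype.card_fin] at h
  refine h.trans ?_
  rw [← two_rpow_add]
  refine mul_le_mul (le_of_eq ?_) ?_ (by positivity) (by positivity)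
  · rw [← pow_mul, ← Real.rpow_natCast]; push_cast; rfl
  · have h1 : (1 + 1 / 2 ^ k : ℝ) ≤ Real.exp (1 / 2 ^ k) := by
      rw [add_comm]; exact Real.add_one_le_exp _
    calc (1 + 1 / 2 ^ k : ℝ) ^ n ≤ Real.exp (1 / 2 ^ k) ^ n := pow_le_pow_left₀ (by positivity) h1 n
      _ = Real.exp (n / 2 ^ k) := by rw [← Real.exp_nat_mul]; congr 1; ring
      _ ≤ _ := exp_le_two_rpow (by positivity)

/-- With `μ = 3` the count is `3 ^ (n / 4) * (4 / 3) ^ n`; from `3 ^ 5 ≤ 2 ^ 8` and `(4 / 3) ^ 2 ≤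
2` the exponent is at most `2 / 5 + 1 / 2 = 9 / 10` of `n`. -/
lemma size_few_le (G : SimpleGraph (Fin n)) :
    ((decode G (modes.few.scale n)).size : ℝ) ≤ (2 : ℝ) ^ ((19 / 20 : ℝ) * n) := by
  have h := size_decode_le G (modes.few.scale n) (μ := 3) (B := (2 : ℝ) ^ ((9 / 10 : ℝ) * n))
    (Rb := fun r => 3 ^ (n / 4) * (1 + 1 / 3) ^ r) (size_askSet_univ_le _ 10)
    (fun R => size_askSet_le R _ (by norm_num)) (by norm_num) ?_ ?_
  · refine h.trans ?_
    rw [two_rpow_add]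
    apply two_rpow_le
    simp only [modes, Params.scale, Nat.div_zero]
    push_cast
    linarith [Nat.cast_nonneg (α := ℝ) n]
  · intro x hx _
    have h0 : (modes.few.scale n).cap = 0 := by simp [modes, Params.scale]
    have h3 := pow_le_two_rpow (c := 3) (by norm_num) (q := 5) (by norm_num) (p := 8)
      (by norm_num) (n / 4)
    have h4 := pow_le_two_rpow (c := 1 + 1 / 3) (by norm_num) (q := 2) (by norm_num) (p := 1)
      (by norm_num) n
    have hcast : ((n / 4 : ℕ) : ℝ) ≤ n / 4 := by exact_mod_cast Nat.cast_div_le (α := ℝ)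
    calc (3 : ℝ) ^ (modes.few.scale n).cap * (1 + 1 / 3) ^ x *
          (3 ^ (n / 4) * (1 + 1 / 3) ^ (n - x)) = 3 ^ (n / 4) * (1 + 1 / 3) ^ n := by
          rw [h0, pow_zero, one_mul, mul_left_comm, ← pow_add, Nat.add_sub_cancel' hx]
      _ ≤ _ := mul_le_mul h3 h4 (by positivity) (by positivity)
      _ ≤ _ := by
        rw [two_rpow_add]
        apply two_rpow_le
        push_cast
        linarith
  · intro x _ y hlt
    simp [modes, Params.scale] at hlt

lemma size_small_le (G : SimpleGraph (Fin n)) (hn : n < 48) :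
    ((decode G (modes.small.scale n)).size : ℝ) ≤ (2 : ℝ) ^ (200 : ℝ) := by
  have h := size_decode_le G (modes.small.scale n) (μ := 1) (B := (2 : ℝ) ^ (n : ℝ))
    (Rb := fun r => 2 ^ r) (size_askSet_univ_le _ 0)
    (fun R => size_askSet_le_two_pow R _) le_rfl ?_ ?_
  · refine h.trans ?_
    rw [two_rpow_add]
    apply two_rpow_le
    have : (n : ℝ) < 48 := by exact_mod_cast hn
    simp only [modes, Params.scale, Nat.div_zero]
    push_cast
    linarith
  · intro x hx _
    rw [one_pow, one_mul, show (1 + 1 / 1 : ℝ) = 2 by norm_num, ← pow_add, Nat.add_sub_cancel' hx,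
      Real.rpow_natCast]
  · intro x _ y hlt
    simp [modes, Params.scale] at hlt

/-- Choosing few members with `μ = 8` costs `9 / 8` instead of 2 per vertex of the neighbourhood,
and `(9 / 16) ^ 5 ≤ 2 ^ (-4)` turns this into a saving of `4 / 5` bit each. -/
lemma large_case_le {cap x : ℕ} (hx : x ≤ n) :
    (8 : ℝ) ^ cap * (1 + 1 / 8) ^ x * 2 ^ (n - x) ≤ (2 : ℝ) ^ (3 * cap + n - 4 / 5 * x : ℝ) := by
  have h1 : (8 : ℝ) ^ cap = (2 : ℝ) ^ (3 * cap : ℝ) := by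
    rw [show (8 : ℝ) = 2 ^ 3 by norm_num, ← pow_mul, ← Real.rpow_natCast]; push_cast; rfl
  have h2 : (1 + 1 / 8 : ℝ) ^ x * 2 ^ (n - x) = 2 ^ n * (9 / 16) ^ x := by
    have : (2 : ℝ) ^ n = 2 ^ (n - x) * 2 ^ x := by rw [← pow_add, Nat.sub_add_cancel hx]
    rw [this, mul_assoc, ← mul_pow, mul_comm]
    norm_num
  have h3 := pow_le_two_rpow (c := 9 / 16) (by norm_num) (q := 5) (by norm_num) (p := -4)
    (by norm_num) x
  rw [mul_assoc, h2, h1, ← Real.rpow_natCast 2 n]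
  calc (2 : ℝ) ^ (3 * cap : ℝ) * ((2 : ℝ) ^ (n : ℝ) * (9 / 16) ^ x)
      ≤ (2 : ℝ) ^ (3 * cap : ℝ) * ((2 : ℝ) ^ (n : ℝ) * (2 : ℝ) ^ (((-4 : ℤ) / (5 : ℕ) : ℝ) * x)) := by
        gcongr
    _ = _ := by
      rw [two_rpow_add, two_rpow_add]
      congr 1
      push_cast
      ring

lemma sub_one_lt_cast_div (m k : ℕ) (hk : 0 < k) : (m / k : ℝ) - 1 < ((m / k : ℕ) : ℝ) := by
  have : m < k * (m / k + 1) := by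
    have := Nat.div_add_mod m k
    have := Nat.mod_lt m hk
    rw [mul_add]; omega
  have h : (m : ℝ) < k * ((m / k : ℕ) + 1) := by exact_mod_cast this
  have hk' : (0 : ℝ) < k := by exact_mod_cast hk
  rw [sub_lt_iff_lt_add, div_lt_iff₀ hk']
  linarith

lemma size_wide_le (G : SimpleGraph (Fin n)) (hn : 0 < n) :
    ((decode G (modes.wide.scale n)).size : ℝ) ≤ (2 : ℝ) ^ (n - 7 * (n / 2 ^ 31) + 64 : ℝ) := by
  have ha1 : ((n / 2 ^ 31 : ℕ) : ℝ) ≤ n / 2 ^ 31 := by exact_mod_cast Nat.cast_div_le (α := ℝ)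
  have ha2 : (n / 2 ^ 31 : ℝ) - 1 < ((n / 2 ^ 31 : ℕ) : ℝ) := by
    exact_mod_cast sub_one_lt_cast_div n (2 ^ 31) (by norm_num)
  have hc : ((n / 2 ^ 28 : ℕ) : ℝ) ≤ n / 2 ^ 28 := by exact_mod_cast Nat.cast_div_le (α := ℝ)
  have hn0 : (0 : ℝ) ≤ n := Nat.cast_nonneg n
  have h := size_decode_le G (modes.wide.scale n) (μ := 8)
    -- In units of `n / 2 ^ 31`: the capacity costs `3 * 8 = 24`, the neighbourhood saves `80 * 4 /
    -- 5 = 64`, a gain of 40; rounding loses at most 64 bits. Guessing the centres costs 33, so 7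
    -- are left.
    (B := (2 : ℝ) ^ (n - 40 * (n / 2 ^ 31) + 64 : ℝ))
    (Rb := fun r => 2 ^ r) (size_askSet_univ_le _ 31)
    (fun R => size_askSet_le_two_pow R _) (by norm_num) ?_ ?_
  · refine h.trans ?_
    rw [two_rpow_add]
    apply two_rpow_le
    show (31 : ℕ) * ((n / 2 ^ 31 : ℕ) : ℝ) + _ + _ ≤ _
    push_cast
    linarith
  · intro x hx hlt
    refine (large_case_le hx).trans (two_rpow_le ?_)
    have hlt' : 80 * (n / 2 ^ 31) ≤ x := by
      have : ¬ x / 80 < n / 2 ^ 31 := hlt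
      omega
    have hlt'' : (80 : ℝ) * ((n / 2 ^ 31 : ℕ) : ℝ) ≤ x := by exact_mod_cast hlt'
    show 3 * ((n / 2 ^ 28 : ℕ) : ℝ) + n - 4 / 5 * x ≤ _
    linarith
  · intro x _ y hlt hy _
    have hx : x ≤ 80 * (n / 2 ^ 31) := by
      have : x / 80 < n / 2 ^ 31 := hlt
      omega
    have hx' : (x : ℝ) ≤ 80 * ((n / 2 ^ 31 : ℕ) : ℝ) := by exact_mod_cast hx
    have hy' : y = 0 := by
      have : y * 1 ≤ n * 0 := hy
      omega
    -- With block bound zero the base is `1 - 1 = 0`, and the exponent `n` is positive: every run of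
    -- the small case is a dead end.
    have hz : (1 - 1 / 2 ^ (modes.wide.scale n).blk : ℝ) ^ (modes.wide.scale n).num = 0 := by
      have : (modes.wide.scale n).num = n := by simp [modes, Params.scale]
      rw [this]
      simp [modes, Params.scale]
      omega
    have he : x + (y + (modes.wide.scale n).blk * (modes.wide.scale n).num) = x := by
      simp [modes, Params.scale, hy']
    rw [hz, he, mul_zero, zero_add, ← Real.rpow_natCast]
    apply two_rpow_le
    linarith

lemma size_narrow_le (G : SimpleGraph (Fin n)) :
    ((decode G (modes.narrow.scale n)).size : ℝ) ≤
      (2 : ℝ) ^ (n - 58 * (n / 2 ^ 120) + 206 : ℝ) := by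
  have ha1 : ((n / 2 ^ 120 : ℕ) : ℝ) ≤ n / 2 ^ 120 := by exact_mod_cast Nat.cast_div_le (α := ℝ)
  have ha2 : (n / 2 ^ 120 : ℝ) - 1 < ((n / 2 ^ 120 : ℕ) : ℝ) := by
    exact_mod_cast sub_one_lt_cast_div n (2 ^ 120) (by norm_num)
  have hm1 : ((n / 2 ^ 29 : ℕ) : ℝ) ≤ n / 2 ^ 29 := by exact_mod_cast Nat.cast_div_le (α := ℝ)
  have hm2 : (n / 2 ^ 29 : ℝ) - 1 < ((n / 2 ^ 29 : ℕ) : ℝ) := by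
    exact_mod_cast sub_one_lt_cast_div n (2 ^ 29) (by norm_num)
  have hc : ((n / 2 ^ 117 : ℕ) : ℝ) ≤ n / 2 ^ 117 := by exact_mod_cast Nat.cast_div_le (α := ℝ)
  have hn0 : (0 : ℝ) ≤ n := Nat.cast_nonneg n
  have h := size_decode_le G (modes.narrow.scale n) (μ := 8)
    -- In units of `n / 2 ^ 120`: the capacity costs 24, the neighbourhood saves `256 * 4 / 5 >
    -- 204`, a gain of more than 180. Guessing the centres costs 122, so 58 are left.
    (B := (2 : ℝ) ^ (n - 180 * (n / 2 ^ 120) + 206 : ℝ))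
    (Rb := fun r => 2 ^ r) (size_askSet_univ_le _ 120)
    (fun R => size_askSet_le_two_pow R _) (by norm_num) ?_ ?_
  · refine h.trans ?_
    rw [two_rpow_add]
    apply two_rpow_le
    show (120 : ℕ) * ((n / 2 ^ 120 : ℕ) : ℝ) + _ + _ ≤ _
    push_cast
    linarith
  · intro x hx hlt
    refine (large_case_le hx).trans (two_rpow_le ?_)
    have hlt' : 256 * (n / 2 ^ 120) ≤ x := by
      have : ¬ x / 256 < n / 2 ^ 120 := hlt
      omega
    have hlt'' : (256 : ℝ) * ((n / 2 ^ 120 : ℕ) : ℝ) ≤ x := by exact_mod_cast hlt'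
    show 3 * ((n / 2 ^ 117 : ℕ) : ℝ) + n - 4 / 5 * x ≤ _
    linarith
  · intro x _ y hlt hy _
    have hx : x ≤ 256 * (n / 2 ^ 120) := by
      have : x / 256 < n / 2 ^ 120 := hlt
      omega
    have hx' : (x : ℝ) ≤ 256 * ((n / 2 ^ 120 : ℕ) : ℝ) := by exact_mod_cast hx
    have hy' : (y : ℝ) * 2 ^ 17 ≤ n * 256 := by
      have : y * 2 ^ 17 ≤ n * 256 := hy
      exact_mod_cast this
    -- The blocks save about `n / 2 ^ 109`, that is 2048 units, far more than the 180 needed.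
    have h1 : (2 : ℝ) ^ n * (1 - 1 / 2 ^ (modes.narrow.scale n).blk) ^ (modes.narrow.scale n).num ≤
        (2 : ℝ) ^ (n - 180 * (n / 2 ^ 120) + 205 : ℝ) := by
      have := one_sub_pow_le (u := 1 / 2 ^ 80) (by norm_num) (by norm_num) (n / 2 ^ 29)
      calc (2 : ℝ) ^ n * (1 - 1 / 2 ^ 80) ^ (n / 2 ^ 29)
          ≤ (2 : ℝ) ^ (n : ℝ) * (2 : ℝ) ^ (-(((n / 2 ^ 29 : ℕ) : ℝ) * (1 / 2 ^ 80))) := by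
            rw [Real.rpow_natCast]
            gcongr
        _ ≤ _ := by
          rw [two_rpow_add]
          apply two_rpow_le
          linarith
    -- Dead ends decide only the neighbourhood, the at most `n / 2 ^ 9` hubs and the block vertices,
    -- a small fraction of all vertices.
    have h2 : (2 : ℝ) ^ (x + (y + (modes.narrow.scale n).blk * (modes.narrow.scale n).num)) ≤
        (2 : ℝ) ^ (n - 180 * (n / 2 ^ 120) + 205 : ℝ) := by
      rw [← Real.rpow_natCast]
      apply two_rpow_le
      show ((x + (y + 80 * (n / 2 ^ 29)) : ℕ) : ℝ) ≤ _
      rw [Nat.cast_add, Nat.cast_add, Nat.cast_mul]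
      push_cast at hm1 ⊢
      linarith
    have h3 : (2 : ℝ) ^ (n - 180 * (n / 2 ^ 120) + 206 : ℝ) =
        2 * (2 : ℝ) ^ (n - 180 * (n / 2 ^ 120) + 205 : ℝ) := by
      rw [show (n - 180 * (n / 2 ^ 120) + 206 : ℝ) = (n - 180 * (n / 2 ^ 120) + 205 : ℝ) + 1 by ring,
        Real.rpow_add two_pos, Real.rpow_one, mul_comm]
    linarith

/-- The narrow mode saves least, and its `58 * n / 2 ^ 120` exceeds `n / 2 ^ 130`. The factor 4
between `2 ^ 208` and `2 ^ 210` covers the sum of the three modes. -/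
theorem size_search_le (G : SimpleGraph (Fin n)) :
    ((search modes G).size : ℝ) ≤ 2 ^ 210 * (2 : ℝ) ^ ((1 - 1 / 2 ^ 130) * n : ℝ) := by
  have hn0 : (0 : ℝ) ≤ n := Nat.cast_nonneg n
  have h208 : (2 : ℝ) ^ 210 = (2 : ℝ) ^ (208 : ℝ) * 4 := by
    rw [show (208 : ℝ) = (208 : ℕ) by norm_num, Real.rpow_natCast]; norm_num
  have key : ∀ x : ℝ, x ≤ (1 - 1 / 2 ^ 130) * n + 208 →
      (2 : ℝ) ^ x ≤ (2 : ℝ) ^ (208 : ℝ) * (2 : ℝ) ^ ((1 - 1 / 2 ^ 130) * n : ℝ) := by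
    intro x hx
    rw [two_rpow_add]
    exact two_rpow_le (by linarith)
  rw [search, h208]
  have hpos : 0 ≤ (2 : ℝ) ^ (208 : ℝ) * (2 : ℝ) ^ ((1 - 1 / 2 ^ 130) * n : ℝ) := by positivity
  split_ifs with hn
  · have := (size_small_le G hn).trans (key _ (by linarith))
    linarith
  · have h48 : (48 : ℝ) ≤ n := by exact_mod_cast not_lt.1 hn
    have h1 := (size_few_le G).trans (key _ (by linarith))
    have h2 := (size_wide_le G (by
      have : 48 ≤ n := not_lt.1 hn
      omega)).trans (key _ (by linarith))
    have h3 := (size_narrow_le G).trans (key _ (by linarith))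
    simp only [size_node, Nat.cast_add]
    linarith

end Sizes

/-! ### From vertex sets of the form Fin n to arbitrary finite ones -/

section Transfer

variable {V W : Type*}

lemma IsConnectedDominating.map {G : SimpleGraph V} {H : SimpleGraph W} {S : Finset V}
    (h : IsConnectedDominating G S) (e : V ≃ W) (he : ∀ u v, G.Adj u v ↔ H.Adj (e u) (e v)) :
    IsConnectedDominating H (S.map e.toEmbedding) := by
  refine ⟨fun v hv => ?_, ?_⟩
  · obtain ⟨u, hu, huv⟩ := h.1 (e.symm v) fun hS => hv (by simpa using hS)
    refine ⟨e u, by simpa using hu, ?_⟩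
    simpa using (he _ _).1 huv
  · let f : G.induce (S : Set V) →g H.induce ((S.map e.toEmbedding : Finset W) : Set W) :=
      ⟨fun x => ⟨e x, by simp⟩, fun {x y} hxy => (he x y).1 hxy⟩
    refine h.2.map f ?_
    rintro ⟨y, hy⟩
    have hy' : e.symm y ∈ (S : Set V) := by simpa using hy
    exact ⟨⟨_, hy'⟩, Subtype.ext (e.apply_symm_apply y)⟩

lemma IsMinimalConnectedDominating.map {G : SimpleGraph V} {H : SimpleGraph W} {S : Finset V}
    (h : IsMinimalConnectedDominating G S) (e : V ≃ W)
    (he : ∀ u v, G.Adj u v ↔ H.Adj (e u) (e v)) :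
    IsMinimalConnectedDominating H (S.map e.toEmbedding) := by
  refine ⟨h.1.map e he, fun T hT hc => h.2 (T.map e.symm.toEmbedding) ?_ (hc.map e.symm ?_)⟩
  · rw [← Finset.map_ssubset_map (f := e.toEmbedding), Finset.map_map]
    convert hT
    ext; simp
  · intro u v
    rw [he]
    simp

/-- Numbering the vertices maps minimal connected dominating sets injectively to results of the
search, of which there are at most as many as leaves. -/
theorem ncard_le_size_search [Fintype V] (G : SimpleGraph V) :
    ∃ G' : SimpleGraph (Fin (Fintype.card V)),
      (minimalConnectedDominatingSets G).ncard ≤ (search modes G').size := by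
  classical
  let e := Fintype.equivFin V
  refine ⟨G.comap e.symm, ?_⟩
  have he : ∀ u v, G.Adj u v ↔ (G.comap e.symm).Adj (e u) (e v) := by simp
  refine le_trans ?_ (List.toFinset_card_le (search modes (G.comap e.symm)).leaves)
  rw [← Set.ncard_coe_finset]
  refine Set.ncard_le_ncard_of_injOn (fun S => S.map e.toEmbedding) (fun S hS => ?_)
    (Finset.map_injective _).injOn (Finset.finite_toSet _)
  have hS' : IsMinimalConnectedDominating G S := hS
  simpa using mem_leaves_search _ (hS'.map e he)

end Transfer

end CDS

theorem theorem1 :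
    ∃ ε : ℝ, (10 : ℝ) ^ (-50 : ℤ) < ε ∧
      (∃ C : ℝ, ∀ (V : Type*) [Fintype V] (G : SimpleGraph V),
        ((CDS.minimalConnectedDominatingSets G).ncard : ℝ) ≤
          C * (2 : ℝ) ^ ((1 - ε) * (Fintype.card V : ℝ))) ∧
      (∃ (P : CDS.Program) (p : Polynomial ℕ), ∀ (n : ℕ) (G : SimpleGraph (Fin n)), ∃ t : ℕ,
        CDS.ListsInTime P G (CDS.minimalConnectedDominatingSets G) t ∧
          (t : ℝ) ≤ (2 : ℝ) ^ ((1 - ε) * (n : ℝ)) * ((p.eval n : ℕ) : ℝ)) := by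
  -- The saving is that of `size_search_le`, and its constant `2 ^ 210` also goes into the
  -- polynomial of the second statement.
  refine ⟨1 / 2 ^ 130, by norm_num, ⟨2 ^ 210, fun V _ G => ?_⟩, ?_⟩
  · obtain ⟨G', h⟩ := CDS.ncard_le_size_search G
    exact (Nat.cast_le.2 h).trans (CDS.size_search_le G')
  · obtain ⟨P, K, hP⟩ := CDS.exists_program CDS.modes_pos
    refine ⟨P, (2 ^ 210 : ℕ) • K, fun n G => ?_⟩
    obtain ⟨t, ht, hL⟩ := hP n G fun S hS => CDS.mem_leaves_search G hS
    refine ⟨t, hL, ?_⟩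
    calc (t : ℝ) ≤ ((CDS.search CDS.modes G).size : ℝ) * (K.eval n : ℕ) := by exact_mod_cast ht
      _ ≤ 2 ^ 210 * (2 : ℝ) ^ ((1 - 1 / 2 ^ 130) * n : ℝ) * (K.eval n : ℕ) := by
        gcongr
        exact CDS.size_search_le G
      _ = _ := by
        rw [Polynomial.eval_smul, smul_eq_mul, Nat.cast_mul]
        push_cast
        ring
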